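/- **Notation.** For $p\ge 0$ and $1\le m\le 2^p$ put $t^0_{pm}=\frac{m-1}{2^p}$, $t^1_{pm}=\frac{2m-1}{2^{p+1}}$, $t^2_{pm}=\frac m{2^p}$, and let $\chi_{pm}=2^p(\mathbf 1_{[t^0_{pm},t^1_{pm})}-\mathbf 1_{[t^1_{pm},t^2_{pm})})$, $\chi_{00}=1$, $\chi_{p0}=0$ for $p\ge1$, $\varphi_{pm}(t)=\int_0^t\chi_{pm}(s)\,\mathrm ds$, and $\varphi_{-10}=1$. A function $g$ on $[0,1]$ with values in a finite-dimensional normed space has the Schauder coefficients $g_{-10}=g(0)$, $g_{00}=g(1)-g(0)$, $g_{p0}=0$ for $p\ge1$, and $g_{pm}=2g(t^1_{pm})-g(t^0_{pm})-g(t^2_{pm})$ for $p\ge 0$, $1\le m\le 2^p$. Write $\Delta_pg=\sum_m g_{pm}\varphi_{pm}$ and $S_pg=\sum_{-1\le q\le p}\Delta_qg$. For $\gamma>0$ let $\|g\|_\gamma=\sup_{p,m}2^{p\gamma}|g_{pm}|$ (supremum over $p\ge-1$ and all $m$), and let $\mathcal C^\gamma$ be the space of continuous $g$ with $\|g\|_\gamma<\infty$.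 The paraproduct is $\pi_<(u,w)=\sum_{p\ge0}S_{p-1}u\,\Delta_pw$. The Lévy area of real functions is $L(g,h)=\sum_{p>q}\sum_{m,n}(g_{pm}h_{qn}-g_{qn}h_{pm})\int_0^\cdot\varphi_{pm}\,\mathrm d\varphi_{qn}$, and for $v$ with values in $\mathbb R^d$ we put $L(v,v)=(L(v^i,v^j))_{1\le i,j\le d}$ whenever the right-hand side makes sense, in particular for $S_kv$ in place of $v$. For $k\ge0$ let $$[v,v]_k(t)=\Big(\sum_{m=1}^{2^k}\big(v^i(t^2_{km}\wedge t)-v^i(t^0_{km}\wedge t)\big)\big(v^j(t^2_{km}\wedge t)-v^j(t^0_{km}\wedge t)\big)\Big)_{1\le i,j\le d},$$ $$I^{\mathrm{It\hat o}}_k(f,\mathrm dv)(t)=\sum_{m=1}^{2^k}f(t^0_{km})\big(v(t^2_{km}\wedge t)-v(t^0_{km}\wedge t)\big).$$ For $v\in\mathcal C^\alpha(\mathbb R^d)$ and $0<\beta\le\alpha$, a path $f$ with values in a finite-dimensional normed space $F$ is paracontrolled by $v$ with derivative $f^v$, written $f\in\mathcal D^\beta_v(F)$, if $f\in\mathcal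 C^\alpha(F)$, $f^v\in\mathcal C^\beta(\mathcal L(\mathbb R^d,F))$ and $f^\sharp:=f-\pi_<(f^v,v)\in\mathcal C^{\alpha+\beta}(F)$; then $\|f\|_{v,\beta}=\|f^v\|_\beta+\|f^\sharp\|_{\alpha+\beta}$. **Corollary.** Let $d,n\in\mathbb N$, $\alpha\in(0,1/2)$ and $\beta\le\alpha$ with $2\alpha+\beta>1$. There is a constant $C$, depending only on $\alpha,\beta,d,n$, such that the following holds. Let $v\in\mathcal C^\alpha(\mathbb R^d)$ and let $f\in\mathcal D^\beta_v(\mathcal L(\mathbb R^d,\mathbb R^n))$ with derivative $f^v$. Assume that $(L(S_kv,S_kv))_k$ converges uniformly on $[0,1]$, with limit denoted $L(v,v)$, that $\sup_k\|L(S_kv,S_kv)\|_{2\alpha}<\infty$, that $([v,v]_k)_k$ converges uniformly on $[0,1]$, with limit denoted $[v,v]$, and that $[v,v]\in\mathcal C^{2\alpha}$. Then $(I^{\mathrm{It\hat o}}_k(f,\mathrm dv))_k$ converges uniformly on $[0,1]$, and its limit, the pathwise Itô integral $I^{\mathrm{It\hat o}}(f,\mathrm dv)$, is in $\mathcal D^\alpha_v(\mathbb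 R^n)$ with derivative $f$ and satisfies $$\|I^{\mathrm{It\hat o}}(f,\mathrm dv)\|_{v,\alpha}\le C\,\|f\|_{v,\beta}\big(1+\|v\|_\alpha^2+\|L(v,v)\|_{2\alpha}+\|[v,v]\|_{2\alpha}\big).$$ -/

import Mathlib

open Set Filter
open scoped ENNReal NNReal

noncomputable section

namespace SchauderIto

/-! Paths on `[0,1]` are functions `ℝ → E`; only their values on `[0,1]` are ever used.
The Schauder system has the constant function (generation `-1`) and, in generation `p ≥ 0`, the
members `m = 0, …, 2^p`; for `p ≥ 1` the member `m = 0` is identically zero.  The generation `-1`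
is written out separately, so that generations are indexed by `ℕ`. -/

/-- `t⁰_{pm} = (m-1)/2^p`, for `m ≥ 1`. -/
def tLeft (p m : ℕ) : ℝ := ((m : ℝ) - 1) / 2 ^ p

/-- `t¹_{pm} = (2m-1)/2^{p+1}`, for `m ≥ 1`. -/
def tMid (p m : ℕ) : ℝ := (2 * (m : ℝ) - 1) / 2 ^ (p + 1)

/-- `t²_{pm} = m/2^p`, for `m ≥ 1`. -/
def tRight (p m : ℕ) : ℝ := (m : ℝ) / 2 ^ p

/-- The rescaled Haar functions `χ_{pm} = 2^{p/2} H_{pm}`, with `χ_{00} = 1` and `χ_{p0} = 0` for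
`p ≥ 1`. -/
def haar (p m : ℕ) (s : ℝ) : ℝ :=
  if m = 0 then (if p = 0 then 1 else 0)
  else if tLeft p m ≤ s ∧ s < tMid p m then 2 ^ p
  else if tMid p m ≤ s ∧ s < tRight p m then -2 ^ p
  else 0

/-- The rescaled Schauder functions `φ_{pm}(t) = ∫_0^t χ_{pm}(s) ds`. -/
def schauder (p m : ℕ) (t : ℝ) : ℝ := ∫ s in (0 : ℝ)..t, haar p m s

section Paths

variable {E F : Type*} [NormedAddCommGroup E] [NormedSpace ℝ E]
  [NormedAddCommGroup F] [NormedSpace ℝ F]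

/-- The Schauder coefficients `f_{pm}` for `p ≥ 0` and `0 ≤ m ≤ 2^p`: `f_{00} = f(1) - f(0)`,
`f_{p0} = 0` for `p ≥ 1`, and `f_{pm} = 2 f(t¹_{pm}) - f(t⁰_{pm}) - f(t²_{pm})` for `m ≥ 1`.
The coefficient of generation `-1` is `f(0)`. -/
def coeff (p m : ℕ) (f : ℝ → E) : E :=
  if m = 0 then (if p = 0 then f 1 - f 0 else 0)
  else (2 : ℝ) • f (tMid p m) - f (tLeft p m) - f (tRight p m)

/-- The Schauder block `Δ_p f = ∑_{m=0}^{2^p} f_{pm} φ_{pm}`, for `p ≥ 0`. -/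
def block (p : ℕ) (f : ℝ → E) (t : ℝ) : E :=
  ∑ m ∈ Finset.range (2 ^ p + 1), schauder p m t • coeff p m f

/-- The partial sum of all blocks of generation smaller than `p`, the block `Δ_{-1} f = f(0)`
included: `sumBelow p f = S_{p-1} f = ∑_{-1 ≤ q < p} Δ_q f`. -/
def sumBelow (p : ℕ) (f : ℝ → E) (t : ℝ) : E :=
  f 0 + ∑ q ∈ Finset.range p, block q f t

/-- The norm `‖f‖_α = sup_{p,m} 2^{pα} |f_{pm}|` over all generations `p ≥ -1`, with value `∞`
if the supremum is infinite. -/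
def hNorm (α : ℝ) (f : ℝ → E) : ℝ≥0∞ :=
  max (ENNReal.ofReal ((2 : ℝ) ^ (-α)) * ‖f 0‖ₑ)
    (⨆ (p : ℕ) (m : ℕ) (_ : m ≤ 2 ^ p),
      ENNReal.ofReal ((2 : ℝ) ^ ((p : ℝ) * α)) * ‖coeff p m f‖ₑ)

/-- `f ∈ 𝒞^α`: `f` is continuous on `[0,1]` and `‖f‖_α < ∞`. -/
def MemC (α : ℝ) (f : ℝ → E) : Prop :=
  ContinuousOn f (Icc 0 1) ∧ hNorm α f < ∞

/-- The paraproduct `π_<(u,w) = ∑_{p ≥ 0} S_{p-1} u Δ_p w`.  The series converges absolutely at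
every point of `[0,1]` if `u` is continuous and `w ∈ 𝒞^α` for some `α > 0`. -/
def paraproduct (u : ℝ → E →L[ℝ] F) (w : ℝ → E) (t : ℝ) : F :=
  ∑' p : ℕ, sumBelow p u t (block p w t)

/-- The remainder `f^♯ = f - π_<(f', v)`. -/
def sharp (v : ℝ → E) (f : ℝ → F) (f' : ℝ → E →L[ℝ] F) (t : ℝ) : F :=
  f t - paraproduct f' v t

/-- `(f, f') ∈ 𝒟^β_v` for a reference path `v ∈ 𝒞^α`: `f` is paracontrolled by `v` with
derivative `f'`. -/
structure IsParacontrolled (α β : ℝ) (v : ℝ → E) (f : ℝ → F) (f' : ℝ → E →L[ℝ] F) : Prop where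
  mem : MemC α f
  mem_deriv : MemC β f'
  mem_sharp : MemC (α + β) (sharp v f f')

/-- `‖f‖_{v,β} = ‖f'‖_β + ‖f^♯‖_{α+β}`. -/
def paraNorm (α β : ℝ) (v : ℝ → E) (f : ℝ → F) (f' : ℝ → E →L[ℝ] F) : ℝ≥0∞ :=
  hNorm β f' + hNorm (α + β) (sharp v f f')

/-- The non-anticipating Riemann sums
`I^{Itô}_k(f,dv)(t) = ∑_{m=1}^{2^k} f(t⁰_{km}) (v(t²_{km} ∧ t) - v(t⁰_{km} ∧ t))`. -/
def itoSum (k : ℕ) (f : ℝ → E →L[ℝ] F) (v : ℝ → E) (t : ℝ) : F :=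
  ∑ m ∈ Finset.Icc 1 (2 ^ k), f (tLeft k m) (v (min (tRight k m) t) - v (min (tLeft k m) t))

end Paths

/-- The iterated integral `∫_0^t φ_{pm} dφ_{qn}`, where `dφ_{qn} = χ_{qn} ds`. -/
def schauderIntegral (p m q n : ℕ) (t : ℝ) : ℝ :=
  ∫ s in (0 : ℝ)..t, schauder p m s * haar q n s

/-- The Lévy area of real-valued paths,
`L(v,w) = ∑_{p > q} ∑_{m,n} (v_{pm} w_{qn} - v_{qn} w_{pm}) ∫_0^· φ_{pm} dφ_{qn}`.
The terms of generation `q = -1` vanish, because there the integrator is constant.  If `v` and `w`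
have only finitely many non-zero blocks, as in `L(S_k v, S_k w)`, this is a finite sum. -/
def levyArea (v w : ℝ → ℝ) (t : ℝ) : ℝ :=
  ∑' p : ℕ, ∑ q ∈ Finset.range p,
    ∑ m ∈ Finset.range (2 ^ p + 1), ∑ n ∈ Finset.range (2 ^ q + 1),
      (coeff p m v * coeff q n w - coeff q n v * coeff p m w) * schauderIntegral p m q n t

/-- The matrix `L(v,v) = (L(v^i, v^j))_{i,j}` of a path in `ℝ^d`. -/
def levyMatrix {d : ℕ} (v : ℝ → EuclideanSpace ℝ (Fin d)) (t : ℝ) :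
    EuclideanSpace ℝ (Fin d × Fin d) :=
  WithLp.toLp 2 fun ij => levyArea (fun s => v s ij.1) (fun s => v s ij.2) t

/-- The matrix `[v,v]_k(t)` of the `k`-th dyadic approximations
`∑_{m=1}^{2^k} (v^i(t²_{km} ∧ t) - v^i(t⁰_{km} ∧ t)) (v^j(t²_{km} ∧ t) - v^j(t⁰_{km} ∧ t))`
of the quadratic variation of a path in `ℝ^d`. -/
def quadVar {d : ℕ} (k : ℕ) (v : ℝ → EuclideanSpace ℝ (Fin d)) (t : ℝ) :
    EuclideanSpace ℝ (Fin d × Fin d) :=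
  WithLp.toLp 2 fun ij => ∑ m ∈ Finset.Icc 1 (2 ^ k),
    (v (min (tRight k m) t) ij.1 - v (min (tLeft k m) t) ij.1) *
      (v (min (tRight k m) t) ij.2 - v (min (tLeft k m) t) ij.2)

end SchauderIto

end

/-! The proof is a sewing argument along dyadic partitions. Let `s < m < t` be the end points and
the midpoint of a dyadic interval of generation `k`, and write `g_{s,t}` for `g(t) - g(s)`. Refining
the Itô sum on this interval changes it by `f_{s,m} v_{m,t}`, which is of order `2^{-2αk}` only: too
large to be summed over `2^k` intervals. Its leading part is `f'(s)` applied to `v_{s,m} ⊗ v_{m,t}`,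
and this tensor is an increment of known paths: the areas `L(S_{k-1}v, S_{k-1}v) - [v,v]_k / 2` of
generations `k+1` and `k` differ over `[s,t]` by exactly `v_{s,m} ⊗ v_{m,t}` (`itoArea_succ_incr`).
The Lévy area supplies the antisymmetric half and the quadratic variation the symmetric one.

So let `D_k` be the limiting area `L(v,v) - [v,v]/2` minus its approximation of generation `k`, and
add `f'(s)` applied to the increment of `D_k` to each summand. Refinement then changes a full
summand by `(f_{s,m} - f'(s) v_{s,m}) v_{m,t}` plus `f'_{s,m}` applied to the increment of `D_{k+1}`
over `[m,t]`. This is of order `2^{-(2α+β)k}` (`almostAdditive_areaDefect`), hence summable over all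
intervals and generations because `2α + β > 1`. The compensated sums converge uniformly
(`exists_compSum_limit`), and their limit `J` satisfies `J_{s,t} = f(s) v_{s,t} + O(2^{-2αk})`
(`norm_limit_sub_le`).

The added compensators vanish in the limit (`compensator_tendsto_zero`). `D_K` tends to zero
uniformly, but without a rate, so `f'` is frozen at a fixed generation; the cost of freezing is
controlled by `∑ |increments of D_K|` over each generation `j ≤ K`, which is `O(2^{(1-2α)j})`. For
the Lévy area this is the assumed uniform bound in `𝒞^{2α}`. For `[v,v]_K` no such bound is assumed;
positivity of its increments gives bounded variation instead.

Paracontrolled paths enter through `norm_paraproduct_incr_le`: the paraproduct of `u` and `w` has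
increments `u(s) w_{s,t}` up to the product of the two regularities. Regularity of the remainder is
thus interchangeable with an expansion of increments. All norms are handled as geometric bounds `B
ρ^p` on generation `p`, with `ρ = 2^{-γ}`. -/

noncomputable section

set_option linter.unusedSectionVars false

namespace SchauderIto

/-! ### Dyadic points -/

/-- The dyadic point `i / 2^p`. -/
def dyad (p i : ℕ) : ℝ := (i : ℝ) / 2 ^ p

theorem tLeft_succ (p i : ℕ) : tLeft p (i + 1) = dyad p i := by
  simp [tLeft, dyad]

theorem tMid_succ (p i : ℕ) : tMid p (i + 1) = dyad (p + 1) (2 * i + 1) := by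
  simp only [tMid, dyad]; push_cast; ring

theorem tRight_succ (p i : ℕ) : tRight p (i + 1) = dyad p (i + 1) := rfl

theorem dyad_double (p i : ℕ) : dyad (p + 1) (2 * i) = dyad p i := by
  simp only [dyad]; push_cast; field_simp; ring

theorem dyad_mul_pow (p j i : ℕ) : dyad (p + j) (i * 2 ^ j) = dyad p i := by
  simp only [dyad]; push_cast; field_simp; ring

theorem dyad_zero (p : ℕ) : dyad p 0 = 0 := by simp [dyad]

theorem dyad_pow (p : ℕ) : dyad p (2 ^ p) = 1 := by simp [dyad]

theorem dyad_nonneg (p i : ℕ) : 0 ≤ dyad p i := by unfold dyad; positivity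

theorem dyad_le_dyad {p i j : ℕ} (h : i ≤ j) : dyad p i ≤ dyad p j := by
  unfold dyad; gcongr

theorem dyad_lt_dyad {p i j : ℕ} (h : i < j) : dyad p i < dyad p j := by
  unfold dyad; gcongr

theorem dyad_le_one {p i : ℕ} (h : i ≤ 2 ^ p) : dyad p i ≤ 1 :=
  (dyad_le_dyad h).trans_eq (dyad_pow p)

theorem dyad_mem {p i : ℕ} (h : i ≤ 2 ^ p) : dyad p i ∈ Icc (0 : ℝ) 1 :=
  ⟨dyad_nonneg p i, dyad_le_one h⟩

theorem dyad_succ_sub (p i : ℕ) : dyad p (i + 1) - dyad p i = (2 ^ p)⁻¹ := by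
  simp only [dyad]; push_cast; ring

theorem dyad_left_lt_mid (p i : ℕ) : dyad p i < dyad (p + 1) (2 * i + 1) := by
  rw [← dyad_double]; exact dyad_lt_dyad (by omega)

theorem dyad_mid_lt_right (p i : ℕ) : dyad (p + 1) (2 * i + 1) < dyad p (i + 1) := by
  rw [← dyad_double p (i + 1)]; exact dyad_lt_dyad (by omega)

theorem exists_dyad_interval (p : ℕ) {t : ℝ} (ht : t ∈ Icc (0 : ℝ) 1) :
    ∃ i < 2 ^ p, t ∈ Icc (dyad p i) (dyad p (i + 1)) := by
  have h2 : (0 : ℝ) < 2 ^ p := by positivity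
  rcases ht.2.lt_or_eq with h | rfl
  · refine ⟨⌊t * 2 ^ p⌋₊, ?_, ?_, ?_⟩
    · rw [Nat.floor_lt (by have := ht.1; positivity)]
      push_cast; nlinarith
    · rw [dyad, div_le_iff₀ h2]
      exact Nat.floor_le (by have := ht.1; positivity)
    · rw [dyad, le_div_iff₀ h2]
      push_cast
      exact (Nat.lt_floor_add_one _).le
  · have h1 : 1 ≤ 2 ^ p := Nat.one_le_two_pow
    refine ⟨2 ^ p - 1, by omega, dyad_le_one (by omega), ?_⟩
    rw [Nat.sub_add_cancel h1, dyad_pow]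

theorem sum_Icc_one_eq_range {M : Type*} [AddCommMonoid M] (n : ℕ) (F : ℕ → M) :
    ∑ m ∈ Finset.Icc 1 n, F m = ∑ i ∈ Finset.range n, F (i + 1) := by
  rw [Finset.range_eq_Ico, Finset.sum_Ico_add' F 0 n 1]
  rfl

theorem sum_Ico_double {M : Type*} [AddCommMonoid M] (F : ℕ → M) (a b : ℕ) :
    ∑ i ∈ Finset.Ico (2 * a) (2 * b), F i
      = ∑ i ∈ Finset.Ico a b, (F (2 * i) + F (2 * i + 1)) := by
  rcases le_or_gt a b with h | h
  · induction b, h using Nat.le_induction with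
    | base => simp
    | succ b h ih =>
      rw [Finset.sum_Ico_succ_top h, ← ih, show 2 * (b + 1) = 2 * b + 1 + 1 by ring,
        Finset.sum_Ico_succ_top (by omega), Finset.sum_Ico_succ_top (by omega), add_assoc]
  · rw [Finset.Ico_eq_empty (by omega), Finset.Ico_eq_empty (by omega)]; simp

theorem sum_range_double {M : Type*} [AddCommMonoid M] (F : ℕ → M) (b : ℕ) :
    ∑ i ∈ Finset.range (2 * b), F i = ∑ i ∈ Finset.range b, (F (2 * i) + F (2 * i + 1)) := by
  rw [Finset.range_eq_Ico, Finset.range_eq_Ico, ← sum_Ico_double F 0 b, mul_zero]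

/-! ### Coefficients and dyadic increments -/

section Paths

variable {E F : Type*} [NormedAddCommGroup E] [NormedSpace ℝ E]
  [NormedAddCommGroup F] [NormedSpace ℝ F]

theorem coeff_succ (p i : ℕ) (g : ℝ → E) :
    coeff p (i + 1) g = (2 : ℝ) • g (dyad (p + 1) (2 * i + 1)) - g (dyad p i)
      - g (dyad p (i + 1)) := by
  simp [coeff, tLeft_succ, tMid_succ, tRight_succ]

theorem coeff_zero_zero (g : ℝ → E) : coeff 0 0 g = g 1 - g 0 := by simp [coeff]

theorem coeff_pos_zero {p : ℕ} (hp : p ≠ 0) (g : ℝ → E) : coeff p 0 g = 0 := by simp [coeff, hp]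

/-- All Schauder coefficients of generation `p ≥ 0` are bounded by `B ρ^p`. -/
def CoeffBound (ρ B : ℝ) (g : ℝ → E) : Prop :=
  ∀ p m, m ≤ 2 ^ p → ‖coeff p m g‖ ≤ B * ρ ^ p

/-- The increments of `g` from the left end point inside a dyadic interval of generation `p` are
bounded by `B ρ^p`. -/
def DyadicHolder (ρ B : ℝ) (g : ℝ → E) : Prop :=
  ∀ p i, i < 2 ^ p → ∀ t ∈ Icc (dyad p i) (dyad p (i + 1)), ‖g t - g (dyad p i)‖ ≤ B * ρ ^ p

/-- The increments of `g` over dyadic intervals of generation `p` are bounded by `B ρ^p`. -/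
def DyadicIncr (ρ B : ℝ) (g : ℝ → E) : Prop :=
  ∀ p i, i < 2 ^ p → ‖g (dyad p (i + 1)) - g (dyad p i)‖ ≤ B * ρ ^ p

theorem DyadicHolder.incr {ρ B : ℝ} {g : ℝ → E} (h : DyadicHolder ρ B g) : DyadicIncr ρ B g :=
  fun p i hi => h p i hi _ ⟨dyad_le_dyad (by omega), le_rfl⟩

/-- Each half of a dyadic interval has as increment half the increment of its parent, plus or minus
half a Schauder coefficient. The recursion `c_{p+1} = (c_p + B ρ^p) / 2` is solved by `c_p = B ρ^p /
(2ρ - 1)`; `ρ > 1/2` means exponent smaller than one. -/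
theorem CoeffBound.incr {ρ B : ℝ} {g : ℝ → E} (hB : 0 ≤ B) (hρ : 1 / 2 < ρ) (hρ1 : ρ < 1)
    (h : CoeffBound ρ B g) : DyadicIncr ρ (B / (2 * ρ - 1)) g := by
  have h0 : 0 < 2 * ρ - 1 := by linarith
  intro p
  induction p with
  | zero =>
    intro i hi
    obtain rfl : i = 0 := by simpa using hi
    have := h 0 0 (by simp)
    rw [coeff_zero_zero] at this
    have e : dyad 0 (0 + 1) = 1 := by simp [dyad]
    rw [e, dyad_zero]
    refine this.trans ?_
    rw [pow_zero, mul_one, mul_one, le_div_iff₀ h0]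
    nlinarith
  | succ p ih =>
    intro i hi
    have key : ∀ x < 2 ^ p, ‖g (dyad (p + 1) (2 * x + 1)) - g (dyad p x)‖
          ≤ B / (2 * ρ - 1) * ρ ^ (p + 1) ∧
        ‖g (dyad p (x + 1)) - g (dyad (p + 1) (2 * x + 1))‖
          ≤ B / (2 * ρ - 1) * ρ ^ (p + 1) := by
      intro x hx
      have h1 := ih x hx
      have h2 := h p (x + 1) hx
      rw [coeff_succ] at h2
      have e1 : g (dyad (p + 1) (2 * x + 1)) - g (dyad p x)
          = (1 / 2 : ℝ) • (g (dyad p (x + 1)) - g (dyad p x)) + (1 / 2 : ℝ) •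
            ((2 : ℝ) • g (dyad (p + 1) (2 * x + 1)) - g (dyad p x) - g (dyad p (x + 1))) := by
        module
      have e2 : g (dyad p (x + 1)) - g (dyad (p + 1) (2 * x + 1))
          = (1 / 2 : ℝ) • (g (dyad p (x + 1)) - g (dyad p x)) - (1 / 2 : ℝ) •
            ((2 : ℝ) • g (dyad (p + 1) (2 * x + 1)) - g (dyad p x) - g (dyad p (x + 1))) := by
        module
      have e3 : 1 / 2 * (B / (2 * ρ - 1) * ρ ^ p) + 1 / 2 * (B * ρ ^ p)
          = B / (2 * ρ - 1) * ρ ^ (p + 1) := by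
        field_simp; ring
      constructor
      · rw [e1, ← e3]
        refine (norm_add_le _ _).trans ?_
        rw [norm_smul, norm_smul, Real.norm_of_nonneg (by norm_num)]
        gcongr
      · rw [e2, ← e3]
        refine (norm_sub_le _ _).trans ?_
        rw [norm_smul, norm_smul, Real.norm_of_nonneg (by norm_num)]
        gcongr
    have hp : 2 ^ (p + 1) = 2 * 2 ^ p := by ring
    rcases Nat.even_or_odd' i with ⟨x, rfl | rfl⟩
    · rw [dyad_double]; exact (key x (by omega)).1
    · rw [show 2 * x + 1 + 1 = 2 * (x + 1) by ring, dyad_double]; exact (key x (by omega)).2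

/-- Chaining: `t` is approached by the left end points of nested dyadic intervals, each step costing
at most one increment of the next generation. The geometric series gives the factor `1 / (1 - ρ)`,
and continuity gives the limit. -/
theorem DyadicIncr.holder {ρ B : ℝ} {g : ℝ → E} (hg : ContinuousOn g (Icc 0 1)) (hB : 0 ≤ B)
    (hρ : 0 < ρ) (hρ1 : ρ < 1) (h : DyadicIncr ρ B g) : DyadicHolder ρ (B / (1 - ρ)) g := by
  intro p i hi t ht
  have hρ' : 0 < 1 - ρ := by linarith
  have ht01 : t ∈ Icc (0 : ℝ) 1 :=
    ⟨(dyad_nonneg p i).trans ht.1, ht.2.trans (dyad_le_one hi)⟩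
  -- a sequence of nested dyadic intervals containing `t`
  have step : ∀ k x, x < 2 ^ k → t ∈ Icc (dyad k x) (dyad k (x + 1)) →
      ∃ y < 2 ^ (k + 1), t ∈ Icc (dyad (k + 1) y) (dyad (k + 1) (y + 1)) ∧
        ‖g (dyad (k + 1) y) - g (dyad k x)‖ ≤ B * ρ ^ (k + 1) := by
    intro k x hx htx
    have hp : 2 ^ (k + 1) = 2 * 2 ^ k := by ring
    rcases le_total t (dyad (k + 1) (2 * x + 1)) with h1 | h1
    · refine ⟨2 * x, by omega, ⟨by rw [dyad_double]; exact htx.1, h1⟩, ?_⟩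
      rw [dyad_double, sub_self, norm_zero]; positivity
    · refine ⟨2 * x + 1, by omega, ⟨h1, ?_⟩, ?_⟩
      · rw [show 2 * x + 1 + 1 = 2 * (x + 1) by ring, dyad_double]; exact htx.2
      · have := h (k + 1) (2 * x) (by omega)
        rwa [dyad_double] at this
  have approx : ∀ j, ∃ x < 2 ^ (p + j), t ∈ Icc (dyad (p + j) x) (dyad (p + j) (x + 1)) ∧
      ‖g (dyad (p + j) x) - g (dyad p i)‖ ≤ B / (1 - ρ) * ρ ^ p * (1 - ρ ^ j) := by
    intro j
    induction j with
    | zero => exact ⟨i, hi, ht, by simp⟩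
    | succ j ih =>
      obtain ⟨x, hx, htx, hb⟩ := ih
      obtain ⟨y, hy, hty, hb'⟩ := step _ x hx htx
      refine ⟨y, hy, hty, ?_⟩
      have e : B / (1 - ρ) * ρ ^ p * (1 - ρ ^ (j + 1)) =
          B * ρ ^ (p + j) + B / (1 - ρ) * ρ ^ p * (1 - ρ ^ j) := by
        field_simp; ring
      have h3 : B * ρ ^ (p + j + 1) ≤ B * ρ ^ (p + j) := by
        gcongr B * ?_
        exact pow_le_pow_of_le_one hρ.le hρ1.le (by omega)
      calc ‖g (dyad (p + (j + 1)) y) - g (dyad p i)‖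
          = ‖(g (dyad (p + j + 1) y) - g (dyad (p + j) x))
              + (g (dyad (p + j) x) - g (dyad p i))‖ := by
            rw [sub_add_sub_cancel]; rfl
        _ ≤ _ := (norm_add_le _ _).trans (by rw [e]; exact add_le_add (hb'.trans h3) hb)
  choose x hx htx hb using approx
  have hlim : Tendsto (fun j => dyad (p + j) (x j)) atTop (nhds t) := by
    have h1 : Tendsto (fun j : ℕ => t - (1 / 2 : ℝ) ^ (p + j)) atTop (nhds t) := by
      have := (tendsto_pow_atTop_nhds_zero_of_lt_one (r := (1 / 2 : ℝ)) (by norm_num)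
        (by norm_num)).comp (tendsto_add_atTop_nat p)
      have := this.const_sub t
      simpa [Function.comp_def, add_comm] using this
    refine tendsto_of_tendsto_of_tendsto_of_le_of_le h1 tendsto_const_nhds (fun j => ?_)
      (fun j => (htx j).1)
    have h2 := (htx j).2
    have h3 := dyad_succ_sub (p + j) (x j)
    simp only [one_div, inv_pow]
    linarith
  have hc : Tendsto (fun j => g (dyad (p + j) (x j))) atTop (nhds (g t)) := by
    refine Tendsto.comp (hg t ht01) (tendsto_nhdsWithin_iff.2 ⟨hlim, ?_⟩)
    exact Eventually.of_forall fun j => dyad_mem (hx j).le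
  refine le_of_tendsto (hc.sub_const _).norm (Eventually.of_forall fun j => (hb j).trans ?_)
  have h1 : ρ ^ j ≥ 0 := by positivity
  have h2 : 0 ≤ B / (1 - ρ) * ρ ^ p := by positivity
  nlinarith

theorem DyadicIncr.coeffBound {ρ B : ℝ} {g : ℝ → E} (hB : 0 ≤ B) (hρ : 0 < ρ) (hρ1 : ρ < 1)
    (h : DyadicIncr ρ B g) : CoeffBound ρ (2 * B) g := by
  intro p m hm
  have hp : 0 ≤ B * ρ ^ p := by positivity
  rcases m with _ | i
  · rcases eq_or_ne p 0 with rfl | hp0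
    · rw [coeff_zero_zero]
      have := h 0 0 (by simp)
      have e : dyad 0 (0 + 1) = 1 := by simp [dyad]
      rw [e, dyad_zero] at this
      linarith
    · rw [coeff_pos_zero hp0, norm_zero]; linarith
  · have hp' : 2 ^ (p + 1) = 2 * 2 ^ p := by ring
    have h1 := h (p + 1) (2 * i) (by omega)
    have h2 := h (p + 1) (2 * i + 1) (by omega)
    rw [show 2 * i + 1 + 1 = 2 * (i + 1) by ring] at h2
    rw [dyad_double] at h1 h2
    have e : coeff p (i + 1) g = (g (dyad (p + 1) (2 * i + 1)) - g (dyad p i))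
        - (g (dyad p (i + 1)) - g (dyad (p + 1) (2 * i + 1))) := by
      rw [coeff_succ]; module
    have h3 : B * ρ ^ (p + 1) ≤ B * ρ ^ p := by
      gcongr B * ?_
      exact pow_le_pow_of_le_one hρ.le hρ1.le (by omega)
    rw [e]
    refine (norm_sub_le _ _).trans ?_
    linarith

/-! ### The norm `hNorm` and bounds on the coefficients -/

theorem rpow_nat_mul_eq (γ : ℝ) (p : ℕ) :
    (2 : ℝ) ^ ((p : ℝ) * γ) = (((2 : ℝ) ^ (-γ)) ^ p)⁻¹ := by
  rw [← Real.rpow_natCast, ← Real.rpow_mul (by norm_num), ← Real.rpow_neg (by norm_num)]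
  congr 1; ring

theorem coeffBound_of_hNorm {γ : ℝ} {g : ℝ → E} (h : hNorm γ g < ∞) :
    CoeffBound ((2 : ℝ) ^ (-γ)) (hNorm γ g).toReal g := by
  intro p m hm
  have h1 : ENNReal.ofReal ((2 : ℝ) ^ ((p : ℝ) * γ)) * ‖coeff p m g‖ₑ ≤ hNorm γ g :=
    by
    refine le_trans ?_ (le_max_right _ _)
    exact le_iSup_of_le p (le_iSup_of_le m (le_iSup (fun _ : m ≤ 2 ^ p =>
      ENNReal.ofReal ((2 : ℝ) ^ ((p : ℝ) * γ)) * ‖coeff p m g‖ₑ) hm))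
  have h2 := ENNReal.toReal_mono h.ne h1
  rw [ENNReal.toReal_mul, ENNReal.toReal_ofReal (by positivity), toReal_enorm,
    rpow_nat_mul_eq] at h2
  have h3 : 0 < ((2 : ℝ) ^ (-γ)) ^ p := by positivity
  rwa [inv_mul_le_iff₀ h3, mul_comm] at h2

theorem norm_zero_le_of_hNorm {γ : ℝ} {g : ℝ → E} (h : hNorm γ g < ∞) :
    (2 : ℝ) ^ (-γ) * ‖g 0‖ ≤ (hNorm γ g).toReal := by
  have h1 : ENNReal.ofReal ((2 : ℝ) ^ (-γ)) * ‖g 0‖ₑ ≤ hNorm γ g := le_max_left _ _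
  have h2 := ENNReal.toReal_mono h.ne h1
  rwa [ENNReal.toReal_mul, ENNReal.toReal_ofReal (by positivity), toReal_enorm] at h2

theorem hNorm_le_ofReal {γ B : ℝ} {g : ℝ → E} (h0 : (2 : ℝ) ^ (-γ) * ‖g 0‖ ≤ B)
    (h : CoeffBound ((2 : ℝ) ^ (-γ)) B g) : hNorm γ g ≤ ENNReal.ofReal B := by
  refine max_le ?_ (iSup_le fun p => iSup_le fun m => iSup_le fun hm => ?_)
  · rw [← ofReal_norm, ← ENNReal.ofReal_mul (by positivity)]
    exact ENNReal.ofReal_le_ofReal h0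
  · rw [← ofReal_norm, ← ENNReal.ofReal_mul (by positivity)]
    refine ENNReal.ofReal_le_ofReal ?_
    rw [rpow_nat_mul_eq, inv_mul_le_iff₀ (by positivity), mul_comm]
    exact h p m hm

/-- Paths in `𝒞^γ` are Hölder continuous on dyadic intervals. -/
theorem MemC.holder {γ : ℝ} {g : ℝ → E} (hγ : 0 < γ) (hγ1 : γ < 1) (h : MemC γ g) :
    DyadicHolder ((2 : ℝ) ^ (-γ))
      ((hNorm γ g).toReal / (2 * (2 : ℝ) ^ (-γ) - 1) / (1 - (2 : ℝ) ^ (-γ))) g := by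
  have h1 : (2 : ℝ) ^ (-γ) < 1 := Real.rpow_lt_one_of_one_lt_of_neg (by norm_num) (by linarith)
  have h2 : 1 / 2 < (2 : ℝ) ^ (-γ) := by
    rw [one_div, ← Real.rpow_neg_one]
    exact Real.rpow_lt_rpow_of_exponent_lt (by norm_num) (by linarith)
  have h3 := (coeffBound_of_hNorm h.2).incr ENNReal.toReal_nonneg h2 h1
  exact h3.holder h.1 (div_nonneg ENNReal.toReal_nonneg (by linarith)) (by positivity) h1

/-- Generation `-1` carries the weight `2^{-γ}`, which exceeds `1/2` as `γ < 1`. -/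
theorem MemC.norm_zero_le {γ : ℝ} {g : ℝ → E} (hγ1 : γ < 1) (h : MemC γ g) :
    ‖g 0‖ ≤ 2 * (hNorm γ g).toReal := by
  have h1 := norm_zero_le_of_hNorm h.2
  have h2 : 1 / 2 < (2 : ℝ) ^ (-γ) := by
    rw [one_div, ← Real.rpow_neg_one]
    exact Real.rpow_lt_rpow_of_exponent_lt (by norm_num) (by linarith)
  nlinarith [norm_nonneg (g 0)]

theorem DyadicHolder.norm_le {ρ B : ℝ} {g : ℝ → E} (h : DyadicHolder ρ B g) {t : ℝ}
    (ht : t ∈ Icc (0 : ℝ) 1) : ‖g t‖ ≤ ‖g 0‖ + B := by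
  have := h 0 0 (by simp) t (by simpa [dyad] using ht)
  rw [dyad_zero, pow_zero, mul_one] at this
  have h2 := norm_le_norm_add_norm_sub' (g t) (g 0)
  linarith

end Paths

/-! ### The Schauder functions -/

theorem intervalIntegrable_step (a b c x y : ℝ) :
    IntervalIntegrable ((Ico a b).indicator fun _ => c) MeasureTheory.volume x y := by
  rw [intervalIntegrable_iff]
  exact (MeasureTheory.integrableOn_const (by simp)).indicator measurableSet_Ico

theorem integral_step {a b c t : ℝ} (ha : 0 ≤ a) (hab : a ≤ b) (ht : 0 ≤ t) :
    ∫ s in (0 : ℝ)..t, (Ico a b).indicator (fun _ => c) s = c * (min b t - min a t) := by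
  rw [intervalIntegral.integral_of_le ht, MeasureTheory.setIntegral_indicator measurableSet_Ico,
    MeasureTheory.setIntegral_const]
  have h : (Ioc 0 t ∩ Ico a b : Set ℝ) =ᵐ[MeasureTheory.volume] (Ioc 0 t ∩ Ioc a b : Set ℝ) :=
    MeasureTheory.ae_eq_set_inter (Filter.EventuallyEq.refl _ _)
      MeasureTheory.Ico_ae_eq_Ioc
  rw [MeasureTheory.measureReal_congr h, Ioc_inter_Ioc, sup_eq_right.2 ha, Real.volume_real_Ioc,
    smul_eq_mul, mul_comm]
  congr 1
  rcases le_total a t with h1 | h1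
  · rw [min_eq_left h1, max_eq_left (sub_nonneg.2 (le_min h1 hab)), inf_comm]
  · rw [min_eq_right h1, min_eq_right (h1.trans hab), inf_eq_left.2 (h1.trans hab),
      max_eq_right (by linarith), sub_self]

theorem haar_succ (p i : ℕ) (s : ℝ) :
    haar p (i + 1) s
      = (Ico (dyad p i) (dyad (p + 1) (2 * i + 1))).indicator (fun _ => (2 : ℝ) ^ p) s
        - (Ico (dyad (p + 1) (2 * i + 1)) (dyad p (i + 1))).indicator (fun _ => (2 : ℝ) ^ p) s := by
  have h1 := dyad_left_lt_mid p i
  simp only [haar, tLeft_succ, tMid_succ, tRight_succ, indicator, mem_Ico, Nat.add_eq_zero_iff,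
    one_ne_zero, and_false, if_false]
  split_ifs with h2 h3 h3
  · exact absurd h3.1 (not_le.2 h2.2)
  · ring
  · ring
  · ring

theorem haar_zero_zero : haar 0 0 = fun _ => 1 := by funext s; simp [haar]

theorem haar_pos_zero {p : ℕ} (hp : p ≠ 0) : haar p 0 = fun _ => 0 := by funext s; simp [haar, hp]

theorem intervalIntegrable_haar (p m : ℕ) (x y : ℝ) :
    IntervalIntegrable (haar p m) MeasureTheory.volume x y := by
  rcases m with _ | i
  · rcases eq_or_ne p 0 with rfl | hp
    · rw [haar_zero_zero]; exact intervalIntegrable_const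
    · rw [haar_pos_zero hp]; exact intervalIntegrable_const
  · rw [show haar p (i + 1) = fun s => _ from funext (haar_succ p i)]
    exact (intervalIntegrable_step _ _ _ _ _).sub (intervalIntegrable_step _ _ _ _ _)

theorem continuous_schauder (p m : ℕ) : Continuous (schauder p m) :=
  intervalIntegral.continuous_primitive (intervalIntegrable_haar p m) 0

theorem schauder_zero_zero (t : ℝ) : schauder 0 0 t = t := by simp [schauder, haar_zero_zero]

theorem schauder_succ (p i : ℕ) {t : ℝ} (ht : 0 ≤ t) :
    schauder p (i + 1) t = 2 ^ p * (min (dyad (p + 1) (2 * i + 1)) t - min (dyad p i) t)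
      - 2 ^ p * (min (dyad p (i + 1)) t - min (dyad (p + 1) (2 * i + 1)) t) := by
  unfold schauder
  simp_rw [haar_succ]
  rw [intervalIntegral.integral_sub (intervalIntegrable_step _ _ _ _ _)
    (intervalIntegrable_step _ _ _ _ _),
    integral_step (dyad_nonneg _ _) (dyad_left_lt_mid p i).le ht,
    integral_step (dyad_nonneg _ _) (dyad_mid_lt_right p i).le ht]

theorem dyad_mid (p i : ℕ) :
    dyad (p + 1) (2 * i + 1) = (dyad p i + dyad p (i + 1)) / 2 := by
  simp only [dyad]; push_cast; field_simp; ring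

theorem schauder_eq_zero_of_le (p i : ℕ) {t : ℝ} (ht : 0 ≤ t) (h : t ≤ dyad p i) :
    schauder p (i + 1) t = 0 := by
  have h1 := dyad_left_lt_mid p i
  have h2 := dyad_mid_lt_right p i
  rw [schauder_succ p i ht, min_eq_right h, min_eq_right (by linarith), min_eq_right (by linarith)]
  ring

theorem schauder_eq_zero_of_ge (p i : ℕ) {t : ℝ} (h : dyad p (i + 1) ≤ t) :
    schauder p (i + 1) t = 0 := by
  have h1 := dyad_left_lt_mid p i
  have h2 := dyad_mid_lt_right p i
  rw [schauder_succ p i ((dyad_nonneg _ _).trans h), min_eq_left h, min_eq_left (by linarith),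
    min_eq_left (by linarith), dyad_mid]
  ring

theorem schauder_of_mem_left (p i : ℕ) {t : ℝ}
    (h : t ∈ Icc (dyad p i) (dyad (p + 1) (2 * i + 1))) :
    schauder p (i + 1) t = 2 ^ p * (t - dyad p i) := by
  have h2 := dyad_mid_lt_right p i
  rw [schauder_succ p i ((dyad_nonneg _ _).trans h.1), min_eq_left h.1, min_eq_right h.2,
    min_eq_right (by linarith [h.2])]
  ring

theorem schauder_of_mem_right (p i : ℕ) {t : ℝ}
    (h : t ∈ Icc (dyad (p + 1) (2 * i + 1)) (dyad p (i + 1))) :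
    schauder p (i + 1) t = 2 ^ p * (dyad p (i + 1) - t) := by
  have h1 := dyad_left_lt_mid p i
  rw [schauder_succ p i ((dyad_nonneg _ _).trans h.1), min_eq_left h.1,
    min_eq_left (by linarith [h.1]), min_eq_right h.2, dyad_mid]
  ring

theorem schauder_mem_Icc (p i : ℕ) {t : ℝ} (h : t ∈ Icc (dyad p i) (dyad p (i + 1))) :
    schauder p (i + 1) t ∈ Icc (0 : ℝ) 1 := by
  have h1 := dyad_succ_sub p i
  have h2 : (2 : ℝ) ^ p * (2 ^ p)⁻¹ = 1 := by field_simp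
  have h3 : (0 : ℝ) < 2 ^ p := by positivity
  rcases le_total t (dyad (p + 1) (2 * i + 1)) with h4 | h4
  · rw [schauder_of_mem_left p i ⟨h.1, h4⟩]
    exact ⟨mul_nonneg h3.le (by linarith [h.1]), by nlinarith [h.2]⟩
  · rw [schauder_of_mem_right p i ⟨h4, h.2⟩]
    exact ⟨mul_nonneg h3.le (by linarith [h.2]), by nlinarith [h.1]⟩

theorem schauder_eq_zero_of_ne {p i j : ℕ} (hij : i ≠ j) {t : ℝ}
    (h : t ∈ Icc (dyad p i) (dyad p (i + 1))) : schauder p (j + 1) t = 0 := by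
  rcases lt_or_gt_of_ne hij with h1 | h1
  · exact schauder_eq_zero_of_le p j ((dyad_nonneg _ _).trans h.1)
      (h.2.trans (dyad_le_dyad h1))
  · exact schauder_eq_zero_of_ge p j ((dyad_le_dyad h1).trans h.1)

theorem haar_eq_zero_of_ne {p i j : ℕ} (hij : i ≠ j) {t : ℝ}
    (h : t ∈ Ico (dyad p i) (dyad p (i + 1))) : haar p (j + 1) t = 0 := by
  have h1 := dyad_left_lt_mid p j
  have h2 := dyad_mid_lt_right p j
  rw [haar_succ, indicator_of_notMem, indicator_of_notMem, sub_zero]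
  · rintro ⟨h3, h4⟩
    rcases lt_or_gt_of_ne hij with h5 | h5
    · linarith [h.2, dyad_le_dyad (p := p) h5]
    · linarith [h.1, dyad_le_dyad (p := p) h5]
  · rintro ⟨h3, h4⟩
    rcases lt_or_gt_of_ne hij with h5 | h5
    · linarith [h.2, dyad_le_dyad (p := p) h5]
    · linarith [h.1, dyad_le_dyad (p := p) h5]

/-! ### Blocks, and partial sums as piecewise linear interpolations. -/

section Paths

variable {E F : Type*} [NormedAddCommGroup E] [NormedSpace ℝ E]
  [NormedAddCommGroup F] [NormedSpace ℝ F]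

/-- On a dyadic interval of its own generation, a block has only one summand. -/
theorem block_of_mem {p i : ℕ} (hi : i < 2 ^ p) (g : ℝ → E) {t : ℝ}
    (h : t ∈ Icc (dyad p i) (dyad p (i + 1))) :
    block p g t = schauder p 0 t • coeff p 0 g + schauder p (i + 1) t • coeff p (i + 1) g := by
  rw [block, Finset.sum_range_succ', add_comm]
  congr 1
  refine Finset.sum_eq_single_of_mem i (Finset.mem_range.2 hi) fun j _ hj => ?_
  rw [schauder_eq_zero_of_ne hj.symm h, zero_smul]

/-- The derivative of the block `Δ_p g`. -/
def haarBlock (p : ℕ) (g : ℝ → E) (t : ℝ) : E :=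
  ∑ m ∈ Finset.range (2 ^ p + 1), haar p m t • coeff p m g

theorem haarBlock_of_mem {p i : ℕ} (hi : i < 2 ^ p) (g : ℝ → E) {t : ℝ}
    (h : t ∈ Ico (dyad p i) (dyad p (i + 1))) :
    haarBlock p g t = haar p 0 t • coeff p 0 g + haar p (i + 1) t • coeff p (i + 1) g := by
  rw [haarBlock, Finset.sum_range_succ', add_comm]
  congr 1
  refine Finset.sum_eq_single_of_mem i (Finset.mem_range.2 hi) fun j _ hj => ?_
  rw [haar_eq_zero_of_ne hj.symm h, zero_smul]

theorem sumBelow_succ (k : ℕ) (g : ℝ → E) (t : ℝ) :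
    sumBelow (k + 1) g t = sumBelow k g t + block k g t := by
  rw [sumBelow, sumBelow, Finset.sum_range_succ, add_assoc]

theorem sumBelow_zero (g : ℝ → E) (t : ℝ) : sumBelow 0 g t = g 0 := by simp [sumBelow]

/-- The linear part of generation zero is separated so that the induction can start there. -/
theorem sumBelow_add_eq (g : ℝ → E) (k : ℕ) : ∀ i < 2 ^ k, ∀ t ∈ Icc (dyad k i) (dyad k (i + 1)),
    sumBelow k g t + (schauder k 0 t • coeff k 0 g)
      = g (dyad k i) + ((t - dyad k i) * 2 ^ k) • (g (dyad k (i + 1)) - g (dyad k i)) := by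
  induction k with
  | zero =>
    intro i hi t _
    obtain rfl : i = 0 := by simpa using hi
    simp [sumBelow_zero, schauder_zero_zero, coeff_zero_zero, dyad]
  | succ k ih =>
    intro i hi t ht
    have hp : 2 ^ (k + 1) = 2 * 2 ^ k := by ring
    rw [sumBelow_succ, coeff_pos_zero k.succ_ne_zero, smul_zero, add_zero]
    have h3 := dyad_mid k (i / 2)
    have h4 := dyad_succ_sub k (i / 2)
    have h5 := dyad_left_lt_mid k (i / 2)
    have h6 := dyad_mid_lt_right k (i / 2)
    rcases Nat.even_or_odd' i with ⟨x, rfl | rfl⟩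
    · have hx : 2 * x / 2 = x := by omega
      rw [hx] at h3 h4 h5 h6
      rw [dyad_double] at ht ⊢
      have ht' : t ∈ Icc (dyad k x) (dyad k (x + 1)) := ⟨ht.1, ht.2.trans h6.le⟩
      rw [block_of_mem (by omega) g ht', ← add_assoc, ih x (by omega) t ht',
        schauder_of_mem_left k x ht, coeff_succ]
      match_scalars <;> ring
    · have hx : (2 * x + 1) / 2 = x := by omega
      rw [hx] at h3 h4 h5 h6
      rw [show 2 * x + 1 + 1 = 2 * (x + 1) by ring, dyad_double] at ht ⊢
      have ht' : t ∈ Icc (dyad k x) (dyad k (x + 1)) := ⟨h5.le.trans ht.1, ht.2⟩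
      rw [block_of_mem (by omega) g ht', ← add_assoc, ih x (by omega) t ht',
        schauder_of_mem_right k x ht, coeff_succ]
      have e : dyad k (x + 1) = dyad k x + (2 ^ k)⁻¹ := by linarith
      have e2 : (2 : ℝ) ^ k * (2 ^ k)⁻¹ = 1 := by field_simp
      match_scalars
      · rw [e]; linear_combination (-1) * e2
      · rw [h3, e, pow_succ]; linear_combination 0 * e2
      · rw [h3, e, pow_succ]; linear_combination e2

/-- `S_{k-1} g` is the piecewise linear interpolation of `g` at the dyadic points of
generation `k`. -/
theorem sumBelow_eq (g : ℝ → E) {k : ℕ} (hk : k ≠ 0) {i : ℕ} (hi : i < 2 ^ k) {t : ℝ}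
    (ht : t ∈ Icc (dyad k i) (dyad k (i + 1))) :
    sumBelow k g t
      = g (dyad k i) + ((t - dyad k i) * 2 ^ k) • (g (dyad k (i + 1)) - g (dyad k i)) := by
  have := sumBelow_add_eq g k i hi t ht
  rwa [coeff_pos_zero hk, smul_zero, add_zero] at this

/-- Differentiated form of `sumBelow_add_eq`, proved by the same induction. The intervals are
half-open because the Haar functions jump at the dyadic points. -/
theorem haarSum_add_eq (g : ℝ → E) (k : ℕ) : ∀ i < 2 ^ k, ∀ t ∈ Ico (dyad k i) (dyad k (i + 1)),
    ∑ q ∈ Finset.range k, haarBlock q g t + haar k 0 t • coeff k 0 g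
      = (2 : ℝ) ^ k • (g (dyad k (i + 1)) - g (dyad k i)) := by
  induction k with
  | zero =>
    intro i hi t _
    obtain rfl : i = 0 := by simpa using hi
    simp [haar_zero_zero, coeff_zero_zero, dyad]
  | succ k ih =>
    intro i hi t ht
    have hp : 2 ^ (k + 1) = 2 * 2 ^ k := by ring
    rw [Finset.sum_range_succ, coeff_pos_zero k.succ_ne_zero, smul_zero, add_zero]
    have h5 := dyad_left_lt_mid k (i / 2)
    have h6 := dyad_mid_lt_right k (i / 2)
    rcases Nat.even_or_odd' i with ⟨x, rfl | rfl⟩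
    · have hx : 2 * x / 2 = x := by omega
      rw [hx] at h5 h6
      rw [dyad_double] at ht ⊢
      have ht' : t ∈ Ico (dyad k x) (dyad k (x + 1)) := ⟨ht.1, ht.2.trans h6⟩
      rw [haarBlock_of_mem (by omega) g ht', ← add_assoc, ih x (by omega) t ht', haar_succ,
        indicator_of_mem ht, indicator_of_notMem (fun h => not_lt.2 h.1 ht.2), coeff_succ]
      match_scalars <;> ring
    · have hx : (2 * x + 1) / 2 = x := by omega
      rw [hx] at h5 h6
      rw [show 2 * x + 1 + 1 = 2 * (x + 1) by ring, dyad_double] at ht ⊢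
      have ht' : t ∈ Ico (dyad k x) (dyad k (x + 1)) := ⟨h5.le.trans ht.1, ht.2⟩
      rw [haarBlock_of_mem (by omega) g ht', ← add_assoc, ih x (by omega) t ht', haar_succ,
        indicator_of_mem ht, indicator_of_notMem (fun h => not_le.2 h.2 ht.1), coeff_succ]
      match_scalars <;> ring

/-- The slope of `S_{k-1} g` on a dyadic interval of generation `k`. -/
theorem haarSum_eq (g : ℝ → E) {k : ℕ} (hk : k ≠ 0) {i : ℕ} (hi : i < 2 ^ k) {t : ℝ}
    (ht : t ∈ Ico (dyad k i) (dyad k (i + 1))) :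
    ∑ q ∈ Finset.range k, haarBlock q g t
      = (2 : ℝ) ^ k • (g (dyad k (i + 1)) - g (dyad k i)) := by
  have := haarSum_add_eq g k i hi t ht
  rwa [coeff_pos_zero hk, smul_zero, add_zero] at this

theorem sumBelow_dyad (g : ℝ → E) {k : ℕ} (hk : k ≠ 0) {i : ℕ} (hi : i ≤ 2 ^ k) :
    sumBelow k g (dyad k i) = g (dyad k i) := by
  rcases hi.lt_or_eq with h | rfl
  · rw [sumBelow_eq g hk h ⟨le_rfl, dyad_le_dyad (by omega)⟩]; simp
  · have h1 : 1 ≤ 2 ^ k := Nat.one_le_two_pow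
    obtain ⟨x, hx⟩ : ∃ x, 2 ^ k = x + 1 := ⟨2 ^ k - 1, by omega⟩
    have e : (dyad k (x + 1) - dyad k x) * 2 ^ k = 1 := by rw [dyad_succ_sub]; field_simp
    rw [hx, sumBelow_eq g hk (by omega) ⟨dyad_le_dyad (by omega), le_rfl⟩, e, one_smul]
    abel

/-- A dyadic interval of a finer generation is contained in one of a coarser generation. -/
theorem dyad_interval_subset (k j i : ℕ) :
    Icc (dyad (k + j) i) (dyad (k + j) (i + 1))
      ⊆ Icc (dyad k (i / 2 ^ j)) (dyad k (i / 2 ^ j + 1)) := by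
  have h2 : 0 < 2 ^ j := by positivity
  refine Icc_subset_Icc ?_ ?_
  · rw [← dyad_mul_pow k j]
    exact dyad_le_dyad (Nat.div_mul_le_self i _)
  · rw [← dyad_mul_pow k j]
    refine dyad_le_dyad ?_
    have := Nat.lt_div_mul_add h2 (a := i)
    rw [add_mul, one_mul]; omega

theorem div_pow_lt {k j i : ℕ} (hi : i < 2 ^ (k + j)) : i / 2 ^ j < 2 ^ k := by
  rw [Nat.div_lt_iff_lt_mul (by positivity), ← pow_add]; exact hi

theorem sumBelow_dyad_of_le (g : ℝ → E) {k : ℕ} (hk : k ≠ 0) {p : ℕ} (hp : p ≤ k) {i : ℕ}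
    (hi : i ≤ 2 ^ p) : sumBelow k g (dyad p i) = g (dyad p i) := by
  obtain ⟨j, rfl⟩ := Nat.exists_eq_add_of_le hp
  rw [← dyad_mul_pow p j]
  refine sumBelow_dyad g hk ?_
  rw [pow_add]; gcongr

theorem coeff_sumBelow_of_lt (g : ℝ → E) {k p m : ℕ} (h : p < k) (hm : m ≤ 2 ^ p) :
    coeff p m (sumBelow k g) = coeff p m g := by
  have hk : k ≠ 0 := by omega
  have hp : 2 ^ (p + 1) = 2 * 2 ^ p := by ring
  rcases m with _ | i
  · rcases eq_or_ne p 0 with rfl | hp0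
    · have h0 := sumBelow_dyad_of_le g hk h.le (i := 0) (by omega)
      have h1 := sumBelow_dyad_of_le g hk h.le (i := 1) (by simp)
      have e : dyad 0 1 = 1 := by simp [dyad]
      rw [dyad_zero] at h0
      rw [e] at h1
      rw [coeff_zero_zero, coeff_zero_zero, h0, h1]
    · rw [coeff_pos_zero hp0, coeff_pos_zero hp0]
  · rw [coeff_succ, coeff_succ, sumBelow_dyad_of_le g hk h (by omega),
      sumBelow_dyad_of_le g hk h.le (by omega), sumBelow_dyad_of_le g hk h.le (by omega)]

/-- The interpolation is affine on each interval of generation `p ≥ k`, so its second differences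
there vanish. -/
theorem coeff_sumBelow_of_le (g : ℝ → E) {k p m : ℕ} (hk : k ≠ 0) (h : k ≤ p) (hm : m ≤ 2 ^ p) :
    coeff p m (sumBelow k g) = 0 := by
  rcases m with _ | i
  · exact coeff_pos_zero (by omega) _
  · obtain ⟨j, rfl⟩ := Nat.exists_eq_add_of_le h
    have hs := dyad_interval_subset k j i
    have hl := dyad_left_lt_mid (k + j) i
    have hr := dyad_mid_lt_right (k + j) i
    have hi := div_pow_lt (k := k) (j := j) (i := i) hm
    rw [coeff_succ, sumBelow_eq g hk hi (hs ⟨hl.le, hr.le⟩),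
      sumBelow_eq g hk hi (hs ⟨le_rfl, hl.le.trans hr.le⟩),
      sumBelow_eq g hk hi (hs ⟨hl.le.trans hr.le, le_rfl⟩), dyad_mid]
    module

theorem continuous_block (p : ℕ) (g : ℝ → E) : Continuous (block p g) := by
  unfold block
  exact continuous_finsetSum _ fun m _ => (continuous_schauder p m).smul continuous_const

theorem continuous_sumBelow (k : ℕ) (g : ℝ → E) : Continuous (sumBelow k g) := by
  unfold sumBelow
  exact continuous_const.add (continuous_finsetSum _ fun q _ => continuous_block q g)

/-! ### Estimates for the blocks -/

theorem norm_sumBelow_sub_le {ρ B : ℝ} {g : ℝ → E} (hB : 0 ≤ B) (hρ : 0 ≤ ρ)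
    (h : DyadicHolder ρ B g) (k : ℕ) {t : ℝ} (ht : t ∈ Icc (0 : ℝ) 1) :
    ‖sumBelow k g t - g t‖ ≤ 2 * B * ρ ^ k := by
  obtain ⟨i, hi, hti⟩ := exists_dyad_interval k ht
  have hB' : 0 ≤ B * ρ ^ k := by positivity
  have h1 := h k i hi t hti
  rw [norm_sub_rev] at h1
  -- The partial sum with `k = 0` is the constant `g 0`, not an interpolation, so this generation is
  -- treated by hand.
  rcases eq_or_ne k 0 with rfl | hk
  · obtain rfl : i = 0 := by simpa using hi
    rw [sumBelow_zero]
    rw [dyad_zero] at h1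
    linarith
  · have h2 := h.incr k i hi
    have h3 := dyad_succ_sub k i
    have h4 : (2 : ℝ) ^ k * (2 ^ k)⁻¹ = 1 := by field_simp
    have h5 : (0 : ℝ) < 2 ^ k := by positivity
    have h6 : 0 ≤ (t - dyad k i) * 2 ^ k := mul_nonneg (by linarith [hti.1]) h5.le
    have h7 : (t - dyad k i) * 2 ^ k ≤ 1 := by nlinarith [hti.2]
    have e : sumBelow k g t - g t = (g (dyad k i) - g t)
        + ((t - dyad k i) * 2 ^ k) • (g (dyad k (i + 1)) - g (dyad k i)) := by
      rw [sumBelow_eq g hk hi hti]; abel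
    rw [e]
    refine (norm_add_le _ _).trans ?_
    rw [norm_smul, Real.norm_of_nonneg h6]
    nlinarith [norm_nonneg (g (dyad k (i + 1)) - g (dyad k i))]

/-- The increments of `S_{k-1} g` over dyadic intervals of generation `k + j`. -/
theorem norm_sumBelow_incr_le {ρ B : ℝ} {g : ℝ → E} (hB : 0 ≤ B) (hρ : 0 ≤ ρ)
    (h : DyadicIncr ρ B g) (k j : ℕ) {i : ℕ} (hi : i < 2 ^ (k + j)) :
    ‖sumBelow k g (dyad (k + j) (i + 1)) - sumBelow k g (dyad (k + j) i)‖
      ≤ (2 ^ j)⁻¹ * (B * ρ ^ k) := by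
  rcases eq_or_ne k 0 with rfl | hk
  · rw [sumBelow_zero, sumBelow_zero, sub_self, norm_zero]; positivity
  · have hs := dyad_interval_subset k j i
    have hi' := div_pow_lt (k := k) (j := j) (i := i) hi
    have h1 := dyad_succ_sub (k + j) i
    have hl : dyad (k + j) i ≤ dyad (k + j) (i + 1) := dyad_le_dyad (by omega)
    have e : sumBelow k g (dyad (k + j) (i + 1)) - sumBelow k g (dyad (k + j) i)
        = ((2 : ℝ) ^ j)⁻¹ • (g (dyad k (i / 2 ^ j + 1)) - g (dyad k (i / 2 ^ j))) := by
      rw [sumBelow_eq g hk hi' (hs ⟨le_rfl, hl⟩), sumBelow_eq g hk hi' (hs ⟨hl, le_rfl⟩),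
        add_sub_add_left_eq_sub, ← sub_smul, ← sub_mul, sub_sub_sub_cancel_right, h1]
      congr 1
      rw [pow_add]; field_simp
    rw [e, norm_smul, Real.norm_of_nonneg (by positivity)]
    gcongr
    exact h k _ hi'

theorem norm_block_le {ρ B : ℝ} {g : ℝ → E} (hB : 0 ≤ B) (hρ : 0 ≤ ρ) (hρ1 : ρ ≤ 1)
    (h : DyadicHolder ρ B g) (k : ℕ) {t : ℝ} (ht : t ∈ Icc (0 : ℝ) 1) :
    ‖block k g t‖ ≤ 4 * B * ρ ^ k := by
  have e : block k g t = (sumBelow (k + 1) g t - g t) - (sumBelow k g t - g t) := by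
    rw [sumBelow_succ]; abel
  have h1 := norm_sumBelow_sub_le hB hρ h k ht
  have h2 := norm_sumBelow_sub_le hB hρ h (k + 1) ht
  have h3 : B * ρ ^ (k + 1) ≤ B * ρ ^ k := by
    gcongr B * ?_
    exact pow_le_pow_of_le_one hρ hρ1 (by omega)
  rw [e]
  refine (norm_sub_le _ _).trans ?_
  linarith

/-- The block is a difference of two interpolations, both affine on intervals of generation `k + 1`.
Their slopes contribute 1 and 2 to the constant 3. -/
theorem norm_block_incr_le {ρ B : ℝ} {g : ℝ → E} (hB : 0 ≤ B) (hρ : 0 ≤ ρ) (hρ1 : ρ ≤ 1)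
    (h : DyadicIncr ρ B g) (k j : ℕ) {i : ℕ} (hi : i < 2 ^ (k + (j + 1))) :
    ‖block k g (dyad (k + (j + 1)) (i + 1)) - block k g (dyad (k + (j + 1)) i)‖
      ≤ 3 * (2 ^ (j + 1))⁻¹ * (B * ρ ^ k) := by
  have e : ∀ t, block k g t = sumBelow (k + 1) g t - sumBelow k g t := fun t => by
    rw [sumBelow_succ]; abel
  have e' : k + (j + 1) = k + 1 + j := by ring
  have h1 := norm_sumBelow_incr_le hB hρ h k (j + 1) hi
  have h2 := norm_sumBelow_incr_le hB hρ h (k + 1) j (i := i) (by rwa [← e'])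
  rw [← e'] at h2
  have h3 : ((2 : ℝ) ^ j)⁻¹ * (B * ρ ^ (k + 1)) ≤ ((2 : ℝ) ^ j)⁻¹ * (B * ρ ^ k) := by
    gcongr _ * (B * ?_)
    exact pow_le_pow_of_le_one hρ hρ1 (by omega)
  have h4 : ((2 : ℝ) ^ j)⁻¹ = 2 * (2 ^ (j + 1))⁻¹ := by rw [pow_succ]; field_simp
  rw [h4] at h3
  rw [h4] at h2
  rw [e, e, sub_sub_sub_comm]
  refine (norm_sub_le _ _).trans ?_
  linarith

end Paths

/-! ### The paraproduct -/

section Paths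

variable {E F : Type*} [NormedAddCommGroup E] [NormedSpace ℝ E]
  [NormedAddCommGroup F] [NormedSpace ℝ F]

/-- Successive interpolations agree at the dyadic points they share. This makes the paraproduct
series finite at dyadic points. Generation `q = 0` is excluded because its block contains the linear
function. -/
theorem block_dyad_eq_zero (g : ℝ → E) {p q i : ℕ} (hq : q ≠ 0) (hpq : p ≤ q) (hi : i ≤ 2 ^ p) :
    block q g (dyad p i) = 0 := by
  have := sumBelow_succ q g (dyad p i)
  rw [sumBelow_dyad_of_le g (by omega) (by omega) hi, sumBelow_dyad_of_le g hq hpq hi] at this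
  simpa using this

theorem block_zero (g : ℝ → E) (q : ℕ) : block q g 0 = 0 := by
  have h0 : ∀ g : ℝ → E, ∀ k, sumBelow k g 0 = g 0 := fun g k => by
    rcases eq_or_ne k 0 with rfl | hk
    · exact sumBelow_zero g 0
    · simpa [dyad_zero] using sumBelow_dyad g hk (i := 0) (by positivity)
  have := sumBelow_succ q g 0
  rw [h0, h0] at this
  simpa using this

theorem paraproduct_zero (u : ℝ → E →L[ℝ] F) (w : ℝ → E) : paraproduct u w 0 = 0 := by
  simp [paraproduct, block_zero]

theorem paraproduct_dyad (u : ℝ → E →L[ℝ] F) (w : ℝ → E) {p i : ℕ} (hp : p ≠ 0)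
    (hi : i ≤ 2 ^ p) : paraproduct u w (dyad p i)
      = ∑ q ∈ Finset.range p, sumBelow q u (dyad p i) (block q w (dyad p i)) := by
  rw [paraproduct, tsum_eq_sum]
  intro q hq
  rw [Finset.mem_range, not_lt] at hq
  rw [block_dyad_eq_zero w (by omega) hq hi, map_zero]

theorem paraproduct_one (u : ℝ → E →L[ℝ] F) (w : ℝ → E) :
    paraproduct u w 1 = u 0 (w 1 - w 0) := by
  have e : (1 : ℝ) = dyad 1 2 := by norm_num [dyad]
  have h1 : sumBelow 1 w (dyad 1 2) = _ := sumBelow_succ 0 w (dyad 1 2)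
  rw [sumBelow_dyad w one_ne_zero (by norm_num), sumBelow_zero, ← e] at h1
  rw [e, paraproduct_dyad u w one_ne_zero (by norm_num), ← e]
  simp [sumBelow_zero, h1]

theorem sumBelow_eq_sum (w : ℝ → E) {p i : ℕ} (hp : p ≠ 0) (hi : i ≤ 2 ^ p) :
    w (dyad p i) = w 0 + ∑ q ∈ Finset.range p, block q w (dyad p i) := by
  conv_lhs => rw [← sumBelow_dyad w hp hi]
  rw [sumBelow]

theorem geom_sum_le_of_one_lt {x : ℝ} (hx : 1 < x) (p : ℕ) :
    ∑ q ∈ Finset.range p, x ^ q ≤ x ^ p / (x - 1) := by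
  rw [geom_sum_eq hx.ne']
  have : 0 < x - 1 := by linarith
  gcongr
  linarith

/-- The paraproduct is controlled by its second factor, with the first one as derivative. -/
theorem norm_paraproduct_incr_le {ρ σ U W : ℝ} {u : ℝ → E →L[ℝ] F} {w : ℝ → E} (hU : 0 ≤ U)
    (hW : 0 ≤ W) (hρ : 0 < ρ) (hσ : 0 < σ) (hσ1 : σ ≤ 1) (hρσ : 1 < 2 * (ρ * σ))
    (hu : DyadicHolder ρ U u) (hw : DyadicHolder σ W w) {p i : ℕ} (hi : i < 2 ^ p) :
    ‖paraproduct u w (dyad p (i + 1)) - paraproduct u w (dyad p i)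
        - u (dyad p i) (w (dyad p (i + 1)) - w (dyad p i))‖
      ≤ 14 / (2 * (ρ * σ) - 1) * (U * W) * (ρ * σ) ^ p := by
  have h0 : 0 < 2 * (ρ * σ) - 1 := by linarith
  rcases eq_or_ne p 0 with rfl | hp
  · obtain rfl : i = 0 := by simpa using hi
    have e : dyad 0 (0 + 1) = 1 := by simp [dyad]
    rw [e, dyad_zero, paraproduct_one, paraproduct_zero, sub_zero, sub_self, norm_zero]
    positivity
  have hs : dyad p i ∈ Icc (0 : ℝ) 1 := dyad_mem hi.le
  have hr : dyad p (i + 1) ∈ Icc (0 : ℝ) 1 := dyad_mem hi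
  set s := dyad p i
  set r := dyad p (i + 1)
  -- Expanding `w` in blocks as well leaves, in each generation, a product rule: the increment of
  -- `S_{q-1} u` times a block of `w`, and the interpolation error of `u` times an increment of that
  -- block.
  have e : paraproduct u w r - paraproduct u w s - u s (w r - w s)
      = ∑ q ∈ Finset.range p, ((sumBelow q u r - sumBelow q u s) (block q w r)
          + (sumBelow q u s - u s) (block q w r - block q w s)) := by
    rw [paraproduct_dyad u w hp hi, paraproduct_dyad u w hp hi.le, sumBelow_eq_sum w hp hi,
      sumBelow_eq_sum w hp hi.le, add_sub_add_left_eq_sub, ← Finset.sum_sub_distrib,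
      ← Finset.sum_sub_distrib, map_sum, ← Finset.sum_sub_distrib]
    refine Finset.sum_congr rfl fun q _ => ?_
    simp only [sub_apply, map_sub]
    abel
  -- The two products contribute 4 and 6; the remaining 4 in the constant 14 is slack.
  have hterm : ∀ q ∈ Finset.range p, ‖(sumBelow q u r - sumBelow q u s) (block q w r)
      + (sumBelow q u s - u s) (block q w r - block q w s)‖
      ≤ 14 * (U * W) * (2 ^ p)⁻¹ * (2 * (ρ * σ)) ^ q := by
    intro q hq
    obtain ⟨j, rfl⟩ : ∃ j, p = q + (j + 1) :=
      ⟨p - q - 1, by have := Finset.mem_range.1 hq; omega⟩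
    have h1 := norm_sumBelow_incr_le hU hρ.le hu.incr q (j + 1) hi
    have h2 := norm_block_le hW hσ.le hσ1 hw q hr
    have h3 := norm_sumBelow_sub_le hU hρ.le hu q hs
    have h4 := norm_block_incr_le hW hσ.le hσ1 hw.incr q j hi
    have e1 : 14 * (U * W) * (2 ^ (q + (j + 1)))⁻¹ * (2 * (ρ * σ)) ^ q
        = (2 ^ (j + 1))⁻¹ * (U * ρ ^ q) * (4 * W * σ ^ q)
          + 2 * U * ρ ^ q * (3 * (2 ^ (j + 1))⁻¹ * (W * σ ^ q))
          + 4 * ((2 ^ (j + 1))⁻¹ * (U * ρ ^ q) * (W * σ ^ q)) := by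
      rw [pow_add, mul_pow, mul_pow]; field_simp; ring
    have h5 : 0 ≤ 4 * (((2 : ℝ) ^ (j + 1))⁻¹ * (U * ρ ^ q) * (W * σ ^ q)) := by positivity
    have h6 := (ContinuousLinearMap.le_opNorm (sumBelow q u r - sumBelow q u s)
      (block q w r)).trans (mul_le_mul h1 h2 (norm_nonneg _) (by positivity))
    have h7 := (ContinuousLinearMap.le_opNorm (sumBelow q u s - u s)
      (block q w r - block q w s)).trans (mul_le_mul h3 h4 (norm_nonneg _) (by positivity))
    rw [e1]
    refine (norm_add_le _ _).trans ?_
    linarith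
  rw [e]
  refine (norm_sum_le _ _).trans ((Finset.sum_le_sum hterm).trans ?_)
  rw [← Finset.mul_sum]
  -- Since `2ρσ > 1`, the geometric sum is dominated by its finest generation, which turns `2^{-p}`
  -- into `(ρσ)^p`.
  calc 14 * (U * W) * (2 ^ p)⁻¹ * ∑ q ∈ Finset.range p, (2 * (ρ * σ)) ^ q
      ≤ 14 * (U * W) * (2 ^ p)⁻¹ * ((2 * (ρ * σ)) ^ p / (2 * (ρ * σ) - 1)) := by
        gcongr; exact geom_sum_le_of_one_lt hρσ p
    _ = _ := by rw [mul_pow]; field_simp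

theorem continuousOn_paraproduct [CompleteSpace F] {ρ σ U W : ℝ} {u : ℝ → E →L[ℝ] F}
    {w : ℝ → E} (hU : 0 ≤ U) (hW : 0 ≤ W) (hρ : 0 < ρ) (hρ1 : ρ ≤ 1) (hσ : 0 < σ) (hσ1 : σ < 1)
    (hu : DyadicHolder ρ U u) (hw : DyadicHolder σ W w) :
    ContinuousOn (paraproduct u w) (Icc 0 1) := by
  unfold paraproduct
  refine continuousOn_tsum (u := fun p : ℕ => (‖u 0‖ + U + 2 * U) * (4 * W * σ ^ p))
    (fun p => ((continuous_sumBelow p u).clm_apply (continuous_block p w)).continuousOn)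
    (((summable_geometric_of_lt_one hσ.le hσ1).mul_left _).mul_left _) fun p t ht => ?_
  have h1 := norm_sumBelow_sub_le hU hρ.le hu p ht
  have h2 := norm_block_le hW hσ.le hσ1.le hw p ht
  have h3 := hu.norm_le ht
  have h4 : U * ρ ^ p ≤ U := mul_le_of_le_one_right hU (pow_le_one₀ hρ.le hρ1)
  have h5 : ‖sumBelow p u t‖ ≤ ‖u 0‖ + U + 2 * U := by
    have := norm_le_norm_add_norm_sub' (sumBelow p u t) (u t)
    linarith
  exact (ContinuousLinearMap.le_opNorm _ _).trans
    (mul_le_mul h5 h2 (norm_nonneg _) (by positivity))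

/-- `g` is controlled by `w` with derivative `u` along dyadic intervals. -/
def DyadicControlled (κ R : ℝ) (w : ℝ → E) (g : ℝ → F) (u : ℝ → E →L[ℝ] F) : Prop :=
  ∀ p i, i < 2 ^ p → ‖g (dyad p (i + 1)) - g (dyad p i)
    - u (dyad p i) (w (dyad p (i + 1)) - w (dyad p i))‖ ≤ R * κ ^ p

/-- Passage from a regular remainder `g^♯` to an expansion of the increments of `g`;
`DyadicControlled.sharp_incr` is the way back. The price is the paraproduct error in both
directions. -/
theorem DyadicIncr.controlled {ρ σ U W S : ℝ} {g : ℝ → F} {u : ℝ → E →L[ℝ] F} {w : ℝ → E}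
    (hU : 0 ≤ U) (hW : 0 ≤ W) (hρ : 0 < ρ) (hσ : 0 < σ) (hσ1 : σ ≤ 1)
    (hρσ : 1 < 2 * (ρ * σ)) (hu : DyadicHolder ρ U u) (hw : DyadicHolder σ W w)
    (h : DyadicIncr (ρ * σ) S (sharp w g u)) :
    DyadicControlled (ρ * σ) (S + 14 / (2 * (ρ * σ) - 1) * (U * W)) w g u := by
  intro p i hi
  have h1 := h p i hi
  have h2 := norm_paraproduct_incr_le hU hW hρ hσ hσ1 hρσ hu hw hi
  rw [add_mul]
  refine le_trans (le_of_eq ?_) ((norm_add_le _ _).trans (add_le_add h1 h2))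
  congr 1
  simp only [sharp]; abel

theorem DyadicControlled.sharp_incr {ρ σ U W R : ℝ} {g : ℝ → F} {u : ℝ → E →L[ℝ] F} {w : ℝ → E}
    (hU : 0 ≤ U) (hW : 0 ≤ W) (hρ : 0 < ρ) (hσ : 0 < σ) (hσ1 : σ ≤ 1)
    (hρσ : 1 < 2 * (ρ * σ)) (hu : DyadicHolder ρ U u) (hw : DyadicHolder σ W w)
    (h : DyadicControlled (ρ * σ) R w g u) :
    DyadicIncr (ρ * σ) (R + 14 / (2 * (ρ * σ) - 1) * (U * W)) (sharp w g u) := by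
  intro p i hi
  have h1 := h p i hi
  have h2 := norm_paraproduct_incr_le hU hW hρ hσ hσ1 hρσ hu hw hi
  rw [add_mul]
  refine le_trans (le_of_eq ?_) ((norm_sub_le _ _).trans (add_le_add h1 h2))
  congr 1
  simp only [sharp]; abel

theorem DyadicControlled.incr {κ σ R W N : ℝ} {g : ℝ → F} {u : ℝ → E →L[ℝ] F} {w : ℝ → E}
    (hR : 0 ≤ R) (hκ : 0 ≤ κ) (hκσ : κ ≤ σ) (hN : ∀ t ∈ Icc (0 : ℝ) 1, ‖u t‖ ≤ N)
    (hw : DyadicIncr σ W w) (h : DyadicControlled κ R w g u) :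
    DyadicIncr σ (R + N * W) g := by
  intro p i hi
  have h1 := h p i hi
  have h2 := (ContinuousLinearMap.le_opNorm (u (dyad p i))
    (w (dyad p (i + 1)) - w (dyad p i))).trans
    (mul_le_mul (hN _ (dyad_mem hi.le)) (hw p i hi) (norm_nonneg _)
      ((norm_nonneg _).trans (hN _ (dyad_mem hi.le))))
  have h3 : R * κ ^ p ≤ R * σ ^ p := by gcongr
  have h4 := norm_le_norm_add_norm_sub' (g (dyad p (i + 1)) - g (dyad p i))
    (u (dyad p i) (w (dyad p (i + 1)) - w (dyad p i)))
  rw [add_mul, mul_assoc]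
  linarith

end Paths

/-! ### The Lévy area of the piecewise linear interpolations -/

section Paths

variable {E F : Type*} [NormedAddCommGroup E] [NormedSpace ℝ E]
  [NormedAddCommGroup F] [NormedSpace ℝ F]

theorem coeff_clm (T : E →L[ℝ] F) (p m : ℕ) (g : ℝ → E) :
    coeff p m (fun s => T (g s)) = T (coeff p m g) := by
  unfold coeff
  split_ifs <;> simp

theorem sumBelow_clm (T : E →L[ℝ] F) (k : ℕ) (g : ℝ → E) (t : ℝ) :
    sumBelow k (fun s => T (g s)) t = T (sumBelow k g t) := by
  simp [sumBelow, block, coeff_clm]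

end Paths

theorem schauderIntegral_intervalIntegrable (p m q n : ℕ) (x y : ℝ) :
    IntervalIntegrable (fun s => schauder p m s * haar q n s) MeasureTheory.volume x y :=
  (intervalIntegrable_haar q n x y).continuousOn_mul (continuous_schauder p m).continuousOn

theorem continuous_schauderIntegral (p m q n : ℕ) : Continuous (schauderIntegral p m q n) :=
  intervalIntegral.continuous_primitive (schauderIntegral_intervalIntegrable p m q n) 0

/-- The contribution of generation `p` to the Lévy area. -/
def levyBlock (p : ℕ) (v w : ℝ → ℝ) (t : ℝ) : ℝ :=
  ∑ q ∈ Finset.range p, ∑ m ∈ Finset.range (2 ^ p + 1), ∑ n ∈ Finset.range (2 ^ q + 1),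
    (coeff p m v * coeff q n w - coeff q n v * coeff p m w) * schauderIntegral p m q n t

theorem levyArea_sumBelow (v w : ℝ → ℝ) {k : ℕ} (hk : k ≠ 0) (t : ℝ) :
    levyArea (sumBelow k v) (sumBelow k w) t = ∑ p ∈ Finset.range k, levyBlock p v w t := by
  rw [levyArea, tsum_eq_sum (s := Finset.range k)]
  · refine Finset.sum_congr rfl fun p hp => Finset.sum_congr rfl fun q hq =>
      Finset.sum_congr rfl fun m hm => Finset.sum_congr rfl fun n hn => ?_
    have hp := Finset.mem_range.1 hp
    have hq := Finset.mem_range.1 hq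
    have hm := Finset.mem_range_succ_iff.1 hm
    have hn := Finset.mem_range_succ_iff.1 hn
    rw [coeff_sumBelow_of_lt v hp hm, coeff_sumBelow_of_lt w hp hm,
      coeff_sumBelow_of_lt v (hq.trans hp) hn, coeff_sumBelow_of_lt w (hq.trans hp) hn]
  · intro p hp
    have hp := not_lt.1 (mt Finset.mem_range.2 hp)
    refine Finset.sum_eq_zero fun q _ => Finset.sum_eq_zero fun m hm =>
      Finset.sum_eq_zero fun n _ => ?_
    have hm := Finset.mem_range_succ_iff.1 hm
    rw [coeff_sumBelow_of_le v hk hp hm, coeff_sumBelow_of_le w hk hp hm]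
    ring

theorem continuous_levyBlock (p : ℕ) (v w : ℝ → ℝ) : Continuous (levyBlock p v w) := by
  unfold levyBlock
  exact continuous_finsetSum _ fun q _ => continuous_finsetSum _ fun m _ =>
    continuous_finsetSum _ fun n _ => continuous_const.mul (continuous_schauderIntegral _ _ _ _)

/-- The sum of the Haar series over `q < p` is the derivative of the partial sum `S_{p-1}`, so
generation `p` of the Lévy area is the primitive of `Δ_p v dS_{p-1} w - Δ_p w dS_{p-1} v`. -/
theorem levyBlock_sub_eq_integral (p : ℕ) (v w : ℝ → ℝ) (s t : ℝ) :
    levyBlock p v w t - levyBlock p v w s = ∫ r in s..t,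
      (block p v r * ∑ q ∈ Finset.range p, haarBlock q w r
        - (∑ q ∈ Finset.range p, haarBlock q v r) * block p w r) := by
  have e : ∀ r, block p v r * ∑ q ∈ Finset.range p, haarBlock q w r
      - (∑ q ∈ Finset.range p, haarBlock q v r) * block p w r
      = ∑ q ∈ Finset.range p, ∑ m ∈ Finset.range (2 ^ p + 1), ∑ n ∈ Finset.range (2 ^ q + 1),
        (coeff p m v * coeff q n w - coeff q n v * coeff p m w)
          * (schauder p m r * haar q n r) := by
    intro r
    rw [mul_comm (∑ q ∈ Finset.range p, haarBlock q v r), Finset.mul_sum, Finset.mul_sum,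
      ← Finset.sum_sub_distrib]
    refine Finset.sum_congr rfl fun q _ => ?_
    rw [block, block, haarBlock, haarBlock, Finset.sum_mul_sum, Finset.sum_mul_sum]
    simp only [← Finset.sum_sub_distrib, smul_eq_mul]
    refine Finset.sum_congr rfl fun m _ => Finset.sum_congr rfl fun n _ => ?_
    ring
  have hi := schauderIntegral_intervalIntegrable
  have hi' : ∀ m q n x y, IntervalIntegrable (fun r =>
      (coeff p m v * coeff q n w - coeff q n v * coeff p m w) * (schauder p m r * haar q n r))
      MeasureTheory.volume x y := fun m q n x y => (hi p m q n x y).const_mul _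
  have hsum3 : ∀ m q x y, IntervalIntegrable (fun r => ∑ n ∈ Finset.range (2 ^ q + 1),
      (coeff p m v * coeff q n w - coeff q n v * coeff p m w) * (schauder p m r * haar q n r))
      MeasureTheory.volume x y := fun m q x y => by
    simpa only [Finset.sum_fn] using
      IntervalIntegrable.sum (Finset.range (2 ^ q + 1)) fun n _ => hi' m q n x y
  have hsum2 : ∀ q x y, IntervalIntegrable (fun r => ∑ m ∈ Finset.range (2 ^ p + 1),
      ∑ n ∈ Finset.range (2 ^ q + 1),
      (coeff p m v * coeff q n w - coeff q n v * coeff p m w) * (schauder p m r * haar q n r))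
      MeasureTheory.volume x y := fun q x y => by
    simpa only [Finset.sum_fn] using
      IntervalIntegrable.sum (Finset.range (2 ^ p + 1)) fun m _ => hsum3 m q x y
  simp_rw [e]
  rw [intervalIntegral.integral_finsetSum fun q _ => hsum2 q s t, levyBlock, levyBlock,
    ← Finset.sum_sub_distrib]
  refine Finset.sum_congr rfl fun q _ => ?_
  rw [intervalIntegral.integral_finsetSum fun m _ => hsum3 m q s t, ← Finset.sum_sub_distrib]
  refine Finset.sum_congr rfl fun m _ => ?_
  rw [intervalIntegral.integral_finsetSum fun n _ => hi' m q n s t, ← Finset.sum_sub_distrib]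
  refine Finset.sum_congr rfl fun n _ => ?_
  rw [intervalIntegral.integral_const_mul, ← mul_sub, schauderIntegral, schauderIntegral,
    intervalIntegral.integral_interval_sub_left (hi _ _ _ _ _ _) (hi _ _ _ _ _ _)]

/-- The increments of the contribution of generation `k` to the Lévy area, inside a dyadic interval
of generation `k`. -/
theorem levyBlock_sub_eq (v w : ℝ → ℝ) {k i : ℕ} (hk : k ≠ 0) (hi : i < 2 ^ k) {s t : ℝ}
    (hs : dyad k i ≤ s) (hst : s ≤ t) (ht : t ≤ dyad k (i + 1)) :
    levyBlock k v w t - levyBlock k v w s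
      = (coeff k (i + 1) v * (2 ^ k * (w (dyad k (i + 1)) - w (dyad k i)))
          - 2 ^ k * (v (dyad k (i + 1)) - v (dyad k i)) * coeff k (i + 1) w)
        * ∫ r in s..t, schauder k (i + 1) r := by
  rw [levyBlock_sub_eq_integral, ← intervalIntegral.integral_const_mul]
  -- On one interval of generation `k` the block has a single summand and the slopes of the coarser
  -- interpolations are constant. The open interval avoids the jump of the Haar functions at the
  -- right end.
  refine intervalIntegral.integral_congr_Ioo_of_le hst fun r hr => ?_
  have hr1 : r ∈ Ico (dyad k i) (dyad k (i + 1)) := ⟨hs.trans hr.1.le, hr.2.trans_le ht⟩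
  have hr2 := Ico_subset_Icc_self hr1
  rw [block_of_mem hi v hr2, block_of_mem hi w hr2, haarSum_eq v hk hi hr1, haarSum_eq w hk hi hr1,
    coeff_pos_zero hk, coeff_pos_zero hk]
  simp only [smul_eq_mul]
  ring

theorem integral_schauder_eq (k i : ℕ) :
    ∫ r in dyad k i..dyad k (i + 1), schauder k (i + 1) r = (2 ^ k)⁻¹ / 4 := by
  have h1 := dyad_left_lt_mid k i
  have h2 := dyad_mid_lt_right k i
  have hc := (continuous_schauder k (i + 1)).intervalIntegrable (μ := MeasureTheory.volume)
  rw [← intervalIntegral.integral_add_adjacent_intervals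
    (hc (dyad k i) (dyad (k + 1) (2 * i + 1))) (hc _ _),
    intervalIntegral.integral_congr (b := dyad (k + 1) (2 * i + 1))
      (g := fun r => 2 ^ k * (r - dyad k i)) (fun r hr => by
      rw [uIcc_of_le h1.le] at hr; exact schauder_of_mem_left k i hr),
    intervalIntegral.integral_congr (a := dyad (k + 1) (2 * i + 1))
      (g := fun r => 2 ^ k * (dyad k (i + 1) - r)) (fun r hr => by
      rw [uIcc_of_le h2.le] at hr; exact schauder_of_mem_right k i hr)]
  have e : dyad k (i + 1) = dyad k i + (2 ^ k)⁻¹ := by linarith [dyad_succ_sub k i]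
  have e2 : (2 : ℝ) ^ k * (2 ^ k)⁻¹ = 1 := by field_simp
  rw [intervalIntegral.integral_const_mul, intervalIntegral.integral_const_mul,
    intervalIntegral.integral_sub intervalIntegral.intervalIntegrable_id
      intervalIntegrable_const,
    intervalIntegral.integral_sub intervalIntegrable_const
      intervalIntegral.intervalIntegrable_id]
  simp only [integral_id, intervalIntegral.integral_const, smul_eq_mul, dyad_mid, e]
  field_simp
  ring

theorem abs_integral_schauder_le {k i : ℕ} {s t : ℝ} (hs : dyad k i ≤ s) (hst : s ≤ t)
    (ht : t ≤ dyad k (i + 1)) : |∫ r in s..t, schauder k (i + 1) r| ≤ t - s := by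
  have := intervalIntegral.norm_integral_le_of_norm_le_const (a := s) (b := t) (C := 1)
    (f := schauder k (i + 1)) fun r hr => by
      rw [uIoc_of_le hst] at hr
      have h := schauder_mem_Icc k i (t := r) ⟨hs.trans hr.1.le, hr.2.trans ht⟩
      rw [Real.norm_of_nonneg h.1]; exact h.2
  rwa [one_mul, abs_of_nonneg (by linarith : (0 : ℝ) ≤ t - s)] at this

theorem levyBlock_zero (v w : ℝ → ℝ) (t : ℝ) : levyBlock 0 v w t = 0 := by simp [levyBlock]

/-- Each of the two products is a coefficient, at most `2 V a^k`, times a slope, at most `2^k V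
a^k`. -/
theorem abs_levyBlock_sub_le {a V : ℝ} (ha : 0 < a) (ha1 : a < 1) (hV : 0 ≤ V) {v w : ℝ → ℝ}
    (hv : DyadicIncr a V v) (hw : DyadicIncr a V w) {k i : ℕ} (hi : i < 2 ^ k) {s t : ℝ}
    (hs : dyad k i ≤ s) (hst : s ≤ t) (ht : t ≤ dyad k (i + 1)) :
    |levyBlock k v w t - levyBlock k v w s| ≤ 4 * V ^ 2 * (2 * a ^ 2) ^ k * (t - s) := by
  have hts : 0 ≤ t - s := by linarith
  rcases eq_or_ne k 0 with rfl | hk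
  · rw [levyBlock_zero, levyBlock_zero, sub_self, abs_zero]; positivity
  rw [levyBlock_sub_eq v w hk hi hs hst ht, abs_mul]
  refine mul_le_mul ?_ (abs_integral_schauder_le hs hst ht) (abs_nonneg _) (by positivity)
  have h1 := hv.coeffBound hV ha ha1 k (i + 1) hi
  have h2 := hw.coeffBound hV ha ha1 k (i + 1) hi
  have h3 := hv k i hi
  have h4 := hw k i hi
  rw [Real.norm_eq_abs] at h1 h2 h3 h4
  refine (abs_sub _ _).trans ?_
  rw [abs_mul, abs_mul, abs_mul, abs_mul, abs_of_pos (by positivity : (0 : ℝ) < 2 ^ k)]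
  have h5 : |coeff k (i + 1) v| * (2 ^ k * |w (dyad k (i + 1)) - w (dyad k i)|)
      ≤ 2 * V * a ^ k * (2 ^ k * (V * a ^ k)) := by gcongr
  have h6 : 2 ^ k * |v (dyad k (i + 1)) - v (dyad k i)| * |coeff k (i + 1) w|
      ≤ 2 ^ k * (V * a ^ k) * (2 * V * a ^ k) := by gcongr
  refine (add_le_add h5 h6).trans (le_of_eq ?_)
  rw [mul_pow, ← pow_mul, mul_comm 2 k, pow_mul]
  ring

/-- All generations `p < k` see a time interval of length at most `2^{-k}`; as `2a² > 1`, the finest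
of them dominates. No assumption on the limiting Lévy area is needed at this scale. -/
theorem abs_sum_levyBlock_sub_le {a V : ℝ} (ha : 0 < a) (ha1 : a < 1) (ha2 : 1 < 2 * a ^ 2)
    (hV : 0 ≤ V) {v w : ℝ → ℝ} (hv : DyadicIncr a V v) (hw : DyadicIncr a V w) {k i : ℕ}
    (hi : i < 2 ^ k) {t : ℝ} (ht : t ∈ Icc (dyad k i) (dyad k (i + 1))) :
    |∑ p ∈ Finset.range k, levyBlock p v w t - ∑ p ∈ Finset.range k, levyBlock p v w (dyad k i)|
      ≤ 4 / (2 * a ^ 2 - 1) * V ^ 2 * (a ^ 2) ^ k := by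
  have hk : t - dyad k i ≤ (2 ^ k)⁻¹ := by rw [← dyad_succ_sub k i]; linarith [ht.2]
  have hk0 : 0 ≤ t - dyad k i := by linarith [ht.1]
  have h0 : 0 < 2 * a ^ 2 - 1 := by linarith
  have hterm : ∀ p ∈ Finset.range k, |levyBlock p v w t - levyBlock p v w (dyad k i)|
      ≤ 4 * V ^ 2 * (2 ^ k)⁻¹ * (2 * a ^ 2) ^ p := by
    intro p hp
    obtain ⟨j, rfl⟩ := Nat.exists_eq_add_of_le (Finset.mem_range.1 hp).le
    have hs := dyad_interval_subset p j i
    have h1 := abs_levyBlock_sub_le ha ha1 hV hv hw (div_pow_lt hi) (s := dyad (p + j) i) (t := t)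
      (hs ⟨le_rfl, dyad_le_dyad (by omega)⟩).1 ht.1 (hs ht).2
    refine h1.trans ?_
    have h2 : 0 ≤ 4 * V ^ 2 * (2 * a ^ 2) ^ p := by positivity
    calc _ ≤ 4 * V ^ 2 * (2 * a ^ 2) ^ p * (2 ^ (p + j))⁻¹ := by gcongr
      _ = _ := by ring
  rw [← Finset.sum_sub_distrib]
  refine (Finset.abs_sum_le_sum_abs _ _).trans ((Finset.sum_le_sum hterm).trans ?_)
  rw [← Finset.mul_sum]
  calc 4 * V ^ 2 * (2 ^ k)⁻¹ * ∑ q ∈ Finset.range k, (2 * a ^ 2) ^ q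
      ≤ 4 * V ^ 2 * (2 ^ k)⁻¹ * ((2 * a ^ 2) ^ k / (2 * a ^ 2 - 1)) := by
        gcongr; exact geom_sum_le_of_one_lt ha2 k
    _ = _ := by rw [mul_pow]; field_simp

/-! ### Tensors -/

section Tensor

variable {d : ℕ}

/-- The matrix `(x_i y_j)_{i,j}`. -/
def tensor (x y : EuclideanSpace ℝ (Fin d)) : EuclideanSpace ℝ (Fin d × Fin d) :=
  WithLp.toLp 2 fun ij => x ij.1 * y ij.2

theorem norm_tensor (x y : EuclideanSpace ℝ (Fin d)) : ‖tensor x y‖ = ‖x‖ * ‖y‖ := by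
  rw [EuclideanSpace.norm_eq, EuclideanSpace.norm_eq, EuclideanSpace.norm_eq,
    ← Real.sqrt_mul (by positivity), Finset.sum_mul_sum, Fintype.sum_prod_type]
  simp [tensor, mul_pow]

theorem norm_le_sum_abs {ι : Type*} [Fintype ι] (x : EuclideanSpace ℝ ι) :
    ‖x‖ ≤ ∑ i, |x i| := by
  rw [EuclideanSpace.norm_eq, Real.sqrt_le_left (Finset.sum_nonneg fun i _ => abs_nonneg _)]
  exact Finset.sum_sq_le_sq_sum_of_nonneg fun i _ => abs_nonneg _

theorem norm_le_card_mul {d : ℕ} {x : EuclideanSpace ℝ (Fin d × Fin d)} {B : ℝ}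
    (h : ∀ i j, |x (i, j)| ≤ B) : ‖x‖ ≤ (d : ℝ) ^ 2 * B := by
  refine (norm_le_sum_abs x).trans
    ((Finset.sum_le_card_nsmul _ _ B fun ij _ => h ij.1 ij.2).trans (le_of_eq ?_))
  simp [sq]

end Tensor

/-! ### The matrix-valued Lévy area -/

section Matrix

variable {d : ℕ} {v : ℝ → EuclideanSpace ℝ (Fin d)}

theorem levyMatrix_sumBelow_apply (v : ℝ → EuclideanSpace ℝ (Fin d)) {k : ℕ} (hk : k ≠ 0)
    (t : ℝ) (i j : Fin d) : levyMatrix (sumBelow k v) t (i, j)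
      = ∑ p ∈ Finset.range k, levyBlock p (fun s => v s i) (fun s => v s j) t := by
  have h : ∀ i : Fin d, (fun s => sumBelow k v s i) = sumBelow k (fun s => v s i) := fun i => by
    funext s
    exact (sumBelow_clm (EuclideanSpace.proj i) k v s).symm
  rw [← levyArea_sumBelow _ _ hk, ← h, ← h]
  rfl

theorem continuous_levyMatrix_sumBelow (v : ℝ → EuclideanSpace ℝ (Fin d)) {k : ℕ} (hk : k ≠ 0) :
    Continuous (levyMatrix (sumBelow k v)) := by
  refine (PiLp.continuous_toLp 2 _).comp (continuous_pi fun ij => ?_)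
  refine (continuous_finsetSum (Finset.range k) fun p _ =>
    continuous_levyBlock p (fun s => v s ij.1) (fun s => v s ij.2)).congr fun t => ?_
  exact (levyMatrix_sumBelow_apply v hk t ij.1 ij.2).symm

theorem DyadicIncr.apply {a V : ℝ} (hv : DyadicIncr a V v) (i : Fin d) :
    DyadicIncr a V (fun s => v s i) := fun p x hx =>
  (PiLp.norm_apply_le (v (dyad p (x + 1)) - v (dyad p x)) i).trans (hv p x hx)

/-- Inside dyadic intervals of generation `k`, the Lévy area of the interpolation of generation `k`
is as regular as its limit. -/
theorem norm_levyMatrix_sub_le {a V : ℝ} (ha : 0 < a) (ha1 : a < 1) (ha2 : 1 < 2 * a ^ 2)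
    (hV : 0 ≤ V) (hv : DyadicIncr a V v) {k i : ℕ} (hk : k ≠ 0)
    (hi : i < 2 ^ k) {t : ℝ} (ht : t ∈ Icc (dyad k i) (dyad k (i + 1))) :
    ‖levyMatrix (sumBelow k v) t - levyMatrix (sumBelow k v) (dyad k i)‖
      ≤ (d : ℝ) ^ 2 * (4 / (2 * a ^ 2 - 1) * V ^ 2 * (a ^ 2) ^ k) := by
  refine norm_le_card_mul fun x y => ?_
  rw [PiLp.sub_apply, levyMatrix_sumBelow_apply v hk, levyMatrix_sumBelow_apply v hk]
  exact abs_sum_levyBlock_sub_le ha ha1 ha2 hV (hv.apply x) (hv.apply y) hi ht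

/-- Only generation `k` is new. If `x` and `y` are the increments of `v` over the two halves, the
coefficient is `x - y`, the total increment is `x + y`, and the integral of the Schauder function is
`2^{-k}/4`; the antisymmetric half of `x ⊗ y` results. For `k = 0` this fails, since the Lévy area
does not pair the two members of generation 0. -/
theorem levyMatrix_succ_incr (v : ℝ → EuclideanSpace ℝ (Fin d)) {k x : ℕ} (hk : k ≠ 0)
    (hx : x < 2 ^ k) (i j : Fin d) :
    (levyMatrix (sumBelow (k + 1) v) (dyad k (x + 1)) (i, j)
        - levyMatrix (sumBelow (k + 1) v) (dyad k x) (i, j))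
      - (levyMatrix (sumBelow k v) (dyad k (x + 1)) (i, j)
        - levyMatrix (sumBelow k v) (dyad k x) (i, j))
      = 1 / 2 * ((v (dyad (k + 1) (2 * x + 1)) i - v (dyad k x) i)
            * (v (dyad k (x + 1)) j - v (dyad (k + 1) (2 * x + 1)) j)
          - (v (dyad (k + 1) (2 * x + 1)) j - v (dyad k x) j)
            * (v (dyad k (x + 1)) i - v (dyad (k + 1) (2 * x + 1)) i)) := by
  have h := levyBlock_sub_eq (fun s => v s i) (fun s => v s j) hk hx le_rfl
    (dyad_le_dyad (by omega : x ≤ x + 1)) le_rfl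
  rw [integral_schauder_eq, coeff_succ, coeff_succ] at h
  have e2 : (2 : ℝ) ^ k * (2 ^ k)⁻¹ = 1 := by field_simp
  rw [levyMatrix_sumBelow_apply v k.succ_ne_zero, levyMatrix_sumBelow_apply v k.succ_ne_zero,
    levyMatrix_sumBelow_apply v hk, levyMatrix_sumBelow_apply v hk, Finset.sum_range_succ,
    Finset.sum_range_succ, add_sub_add_comm, add_sub_cancel_left]
  refine h.trans ?_
  simp only [smul_eq_mul]
  generalize v (dyad (k + 1) (2 * x + 1)) i = mi
  generalize v (dyad (k + 1) (2 * x + 1)) j = mj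
  generalize v (dyad k x) i = li
  generalize v (dyad k x) j = lj
  generalize v (dyad k (x + 1)) i = ri
  generalize v (dyad k (x + 1)) j = rj
  linear_combination ((2 * mi - li - ri) * (rj - lj) - (ri - li) * (2 * mj - lj - rj)) / 4 * e2

/-! ### Stopped dyadic sums and the quadratic variation -/

/-- Stated for a general summand so that it serves both the quadratic variation and, through its
consequences, every sum stopped inside a dyadic interval: completed intervals, one partial interval,
and zeros. -/
theorem stopped_sum_eq {M : Type*} [AddCommGroup M] (Φ : ℕ → ℝ → ℝ → M) (hΦ : ∀ y s, Φ y s s = 0)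
    {k i : ℕ} (hi : i < 2 ^ k) {t : ℝ} (ht : t ∈ Icc (dyad k i) (dyad k (i + 1))) :
    ∑ y ∈ Finset.range (2 ^ k), Φ y (min (dyad k y) t) (min (dyad k (y + 1)) t)
      = ∑ y ∈ Finset.range i, Φ y (dyad k y) (dyad k (y + 1)) + Φ i (dyad k i) t := by
  rw [← Finset.sum_subset (Finset.range_mono (Nat.succ_le_of_lt hi)), Finset.sum_range_succ,
    min_eq_left ht.1, min_eq_right ht.2]
  · congr 1
    refine Finset.sum_congr rfl fun y hy => ?_
    have hy := Finset.mem_range.1 hy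
    rw [min_eq_left ((dyad_le_dyad hy.le).trans ht.1), min_eq_left ((dyad_le_dyad hy).trans ht.1)]
  · intro y _ hy
    have hy := not_lt.1 (mt Finset.mem_range.2 hy)
    have h1 : t ≤ dyad k y := ht.2.trans (dyad_le_dyad hy)
    rw [min_eq_right h1, min_eq_right (h1.trans (dyad_le_dyad (by omega))), hΦ]

theorem stopped_sum_sub_eq {M : Type*} [AddCommGroup M] (Φ : ℕ → ℝ → ℝ → M)
    (hΦ : ∀ y s, Φ y s s = 0) {k i : ℕ} (hi : i < 2 ^ k) {t : ℝ}
    (ht : t ∈ Icc (dyad k i) (dyad k (i + 1))) :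
    ∑ y ∈ Finset.range (2 ^ k), Φ y (min (dyad k y) t) (min (dyad k (y + 1)) t)
      - ∑ y ∈ Finset.range (2 ^ k), Φ y (min (dyad k y) (dyad k i))
          (min (dyad k (y + 1)) (dyad k i)) = Φ i (dyad k i) t := by
  rw [stopped_sum_eq Φ hΦ hi ht, stopped_sum_eq Φ hΦ hi ⟨le_rfl, dyad_le_dyad (by omega)⟩, hΦ]
  abel

/-- The increment of `v`, stopped at `t`, over the dyadic interval `y` of generation `k`. -/
def stopIncr {E : Type*} [NormedAddCommGroup E] (v : ℝ → E) (k y : ℕ) (t : ℝ) : E :=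
  v (min (dyad k (y + 1)) t) - v (min (dyad k y) t)

theorem quadVar_eq (k : ℕ) (v : ℝ → EuclideanSpace ℝ (Fin d)) (t : ℝ) :
    quadVar k v t = ∑ y ∈ Finset.range (2 ^ k), tensor (stopIncr v k y t) (stopIncr v k y t) := by
  ext ij
  rw [quadVar, WithLp.ofLp_sum, Finset.sum_apply]
  dsimp only
  rw [sum_Icc_one_eq_range]
  simp only [tLeft_succ, tRight_succ]
  rfl

theorem tensor_zero : tensor (0 : EuclideanSpace ℝ (Fin d)) 0 = 0 := by
  ext; simp [tensor]

theorem quadVar_sub_eq (v : ℝ → EuclideanSpace ℝ (Fin d)) {k i : ℕ} (hi : i < 2 ^ k) {t : ℝ}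
    (ht : t ∈ Icc (dyad k i) (dyad k (i + 1))) :
    quadVar k v t - quadVar k v (dyad k i) = tensor (v t - v (dyad k i)) (v t - v (dyad k i)) := by
  rw [quadVar_eq, quadVar_eq]
  exact stopped_sum_sub_eq (fun _ s u => tensor (v u - v s) (v u - v s))
    (fun _ s => by rw [sub_self, tensor_zero]) hi ht

/-- With half increments `x` and `y`, this is `x ⊗ x + y ⊗ y - (x + y) ⊗ (x + y)`. -/
theorem quadVar_succ_incr (v : ℝ → EuclideanSpace ℝ (Fin d)) {k x : ℕ}
    (hx : x < 2 ^ k) (i j : Fin d) :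
    (quadVar (k + 1) v (dyad k (x + 1)) (i, j) - quadVar (k + 1) v (dyad k x) (i, j))
      - (quadVar k v (dyad k (x + 1)) (i, j) - quadVar k v (dyad k x) (i, j))
      = -((v (dyad (k + 1) (2 * x + 1)) i - v (dyad k x) i)
            * (v (dyad k (x + 1)) j - v (dyad (k + 1) (2 * x + 1)) j)
          + (v (dyad (k + 1) (2 * x + 1)) j - v (dyad k x) j)
            * (v (dyad k (x + 1)) i - v (dyad (k + 1) (2 * x + 1)) i)) := by
  have hp : 2 ^ (k + 1) = 2 * 2 ^ k := by ring
  have h1 := congrArg (fun M : EuclideanSpace ℝ (Fin d × Fin d) => M (i, j))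
    (quadVar_sub_eq v hx ⟨dyad_le_dyad (by omega : x ≤ x + 1), le_rfl⟩)
  have h2 := congrArg (fun M : EuclideanSpace ℝ (Fin d × Fin d) => M (i, j))
    (quadVar_sub_eq v (k := k + 1) (i := 2 * x) (by omega)
      ⟨dyad_le_dyad (by omega : 2 * x ≤ 2 * x + 1), le_rfl⟩)
  have h3 := congrArg (fun M : EuclideanSpace ℝ (Fin d × Fin d) => M (i, j))
    (quadVar_sub_eq v (k := k + 1) (i := 2 * x + 1) (by omega)
      ⟨dyad_le_dyad (by omega : 2 * x + 1 ≤ 2 * x + 1 + 1), le_rfl⟩)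
  rw [show (2 * x + 1 + 1) = 2 * (x + 1) by ring, dyad_double] at h3
  rw [dyad_double] at h2
  simp only [PiLp.sub_apply, tensor] at h1 h2 h3
  linear_combination h2 + h3 - h1

/-- The trace of `quadVar`. -/
def quadTrace {E : Type*} [NormedAddCommGroup E] (k : ℕ) (v : ℝ → E) (t : ℝ) : ℝ :=
  ∑ y ∈ Finset.range (2 ^ k), ‖stopIncr v k y t‖ ^ 2

theorem quadTrace_le (k : ℕ) (v : ℝ → EuclideanSpace ℝ (Fin d)) (t : ℝ) :
    quadTrace k v t ≤ d * ‖quadVar k v t‖ := by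
  have e : quadTrace k v t = ∑ i : Fin d, quadVar k v t (i, i) := by
    simp only [quadTrace, quadVar_eq, WithLp.ofLp_sum, Finset.sum_apply]
    rw [Finset.sum_comm]
    refine Finset.sum_congr rfl fun y _ => ?_
    rw [EuclideanSpace.norm_sq_eq]
    refine Finset.sum_congr rfl fun i _ => ?_
    rw [Real.norm_eq_abs, sq_abs, tensor, sq]
  rw [e]
  refine (Finset.sum_le_card_nsmul _ _ ‖quadVar k v t‖ fun i _ => ?_).trans (le_of_eq (by simp))
  exact (le_abs_self _).trans (PiLp.norm_apply_le (quadVar k v t) (i, i))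

/-- Started at a dyadic point of generation `k`, every stopped increment is either complete already
or still zero. Hence the change is a sum of tensors `x ⊗ x`, whose norms `|x|²` add up to the change
of the trace. -/
theorem norm_quadVar_sub_le (v : ℝ → EuclideanSpace ℝ (Fin d)) (k x : ℕ) {u : ℝ}
    (hu : dyad k x ≤ u) :
    ‖quadVar k v u - quadVar k v (dyad k x)‖ ≤ quadTrace k v u - quadTrace k v (dyad k x) := by
  rw [quadVar_eq, quadVar_eq, quadTrace, quadTrace, ← Finset.sum_sub_distrib,
    ← Finset.sum_sub_distrib]
  refine (norm_sum_le _ _).trans (Finset.sum_le_sum fun y _ => ?_)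
  rcases lt_or_ge y x with h | h
  · have h1 : dyad k (y + 1) ≤ dyad k x := dyad_le_dyad h
    have h2 : dyad k y ≤ dyad k x := dyad_le_dyad h.le
    have e : stopIncr v k y u = stopIncr v k y (dyad k x) := by
      rw [stopIncr, stopIncr, min_eq_left h1, min_eq_left h2, min_eq_left (h1.trans hu),
        min_eq_left (h2.trans hu)]
    rw [e, sub_self, sub_self, norm_zero]
  · have e : stopIncr v k y (dyad k x) = 0 := by
      rw [stopIncr, min_eq_right (dyad_le_dyad h), min_eq_right (dyad_le_dyad (by omega)), sub_self]
    rw [e, tensor_zero, sub_zero, norm_tensor, norm_zero]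
    exact le_of_eq (by ring)

/-- The dyadic approximations of the quadratic variation have uniformly bounded variation. -/
theorem sum_norm_stopIncr_quadVar_le (v : ℝ → EuclideanSpace ℝ (Fin d)) (j n : ℕ) {t : ℝ}
    (ht : t ∈ Icc (0 : ℝ) 1) :
    ∑ x ∈ Finset.range (2 ^ j), ‖stopIncr (quadVar (j + n) v) j x t‖
      ≤ d * ‖quadVar (j + n) v t‖ := by
  have h : ∀ x, ‖stopIncr (quadVar (j + n) v) j x t‖
      ≤ quadTrace (j + n) v (min (dyad j (x + 1)) t) - quadTrace (j + n) v (min (dyad j x) t) := by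
    intro x
    rw [stopIncr]
    rcases le_total t (dyad j x) with h | h
    · rw [min_eq_right h, min_eq_right (h.trans (dyad_le_dyad (by omega))), sub_self, sub_self,
        norm_zero]
    · rw [min_eq_left h, ← dyad_mul_pow j n x]
      exact norm_quadVar_sub_le v _ _ (by
        rw [dyad_mul_pow]; exact le_min (dyad_le_dyad (by omega)) h)
  refine (Finset.sum_le_sum fun x _ => h x).trans ?_
  rw [Finset.sum_range_sub (fun x => quadTrace (j + n) v (min (dyad j x) t)), dyad_pow, dyad_zero,
    min_eq_right ht.2, min_eq_left ht.1]
  refine le_trans ?_ (quadTrace_le _ v t)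
  have : 0 ≤ quadTrace (j + n) v 0 := Finset.sum_nonneg fun _ _ => by positivity
  linarith

/-! ### The area `L - [v,v] / 2` of Itô type -/

/-- The dyadic approximations of the area of Itô type. -/
def itoArea (k : ℕ) (v : ℝ → EuclideanSpace ℝ (Fin d)) (t : ℝ) :
    EuclideanSpace ℝ (Fin d × Fin d) :=
  levyMatrix (sumBelow k v) t - (1 / 2 : ℝ) • quadVar k v t

/-- The central cancellation, a dyadic form of Chen's relation: the antisymmetric half of the tensor
and the symmetric half add up to the non-anticipating product. -/
theorem itoArea_succ_incr (v : ℝ → EuclideanSpace ℝ (Fin d)) {k x : ℕ} (hk : k ≠ 0)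
    (hx : x < 2 ^ k) :
    (itoArea (k + 1) v (dyad k (x + 1)) - itoArea (k + 1) v (dyad k x))
      - (itoArea k v (dyad k (x + 1)) - itoArea k v (dyad k x))
      = tensor (v (dyad (k + 1) (2 * x + 1)) - v (dyad k x))
          (v (dyad k (x + 1)) - v (dyad (k + 1) (2 * x + 1))) := by
  ext ⟨i, j⟩
  have h1 := levyMatrix_succ_incr v hk hx i j
  have h2 := quadVar_succ_incr v hx i j
  simp only [itoArea, PiLp.sub_apply, PiLp.smul_apply, smul_eq_mul, tensor]
  linear_combination h1 - 1 / 2 * h2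

theorem norm_itoArea_sub_le {a V : ℝ} (ha : 0 < a) (ha1 : a < 1) (ha2 : 1 < 2 * a ^ 2)
    (hV : 0 ≤ V) (hv : DyadicHolder a V v) {k i : ℕ} (hk : k ≠ 0)
    (hi : i < 2 ^ k) {t : ℝ} (ht : t ∈ Icc (dyad k i) (dyad k (i + 1))) :
    ‖itoArea k v t - itoArea k v (dyad k i)‖
      ≤ ((d : ℝ) ^ 2 * (4 / (2 * a ^ 2 - 1)) + 1) * V ^ 2 * (a ^ 2) ^ k := by
  have h1 := norm_levyMatrix_sub_le ha ha1 ha2 hV hv.incr hk hi ht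
  have h2 := hv k i hi t ht
  have e : itoArea k v t - itoArea k v (dyad k i)
      = (levyMatrix (sumBelow k v) t - levyMatrix (sumBelow k v) (dyad k i))
        - (1 / 2 : ℝ) • tensor (v t - v (dyad k i)) (v t - v (dyad k i)) := by
    rw [← quadVar_sub_eq v hi ht, itoArea, itoArea, smul_sub]; abel
  rw [e]
  refine (norm_sub_le _ _).trans ?_
  rw [norm_smul, norm_tensor, Real.norm_of_nonneg (by norm_num)]
  have h3 : ‖v t - v (dyad k i)‖ * ‖v t - v (dyad k i)‖ ≤ V * a ^ k * (V * a ^ k) := by gcongr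
  have h4 : V * a ^ k * (V * a ^ k) = V ^ 2 * (a ^ 2) ^ k := by ring
  have h5 : 0 ≤ V ^ 2 * (a ^ 2) ^ k := by positivity
  nlinarith

end Matrix

/-! ### Compensated Riemann sums -/

section Compensated

variable {E F M : Type*} [NormedAddCommGroup E] [NormedSpace ℝ E]
  [NormedAddCommGroup F] [NormedSpace ℝ F] [NormedAddCommGroup M] [NormedSpace ℝ M]

theorem stopped_sum_dyad {G : Type*} [AddCommGroup G] (Φ : ℕ → ℝ → ℝ → G)
    (hΦ : ∀ y s, Φ y s s = 0) {k i : ℕ} (hi : i ≤ 2 ^ k) :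
    ∑ y ∈ Finset.range (2 ^ k), Φ y (min (dyad k y) (dyad k i)) (min (dyad k (y + 1)) (dyad k i))
      = ∑ y ∈ Finset.range i, Φ y (dyad k y) (dyad k (y + 1)) := by
  rw [← Finset.sum_subset (Finset.range_mono hi)]
  · refine Finset.sum_congr rfl fun y hy => ?_
    have hy := Finset.mem_range.1 hy
    rw [min_eq_left (dyad_le_dyad hy.le), min_eq_left (dyad_le_dyad hy)]
  · intro y _ hy
    have hy := not_lt.1 (mt Finset.mem_range.2 hy)
    rw [min_eq_right (dyad_le_dyad hy), min_eq_right (dyad_le_dyad (by omega)), hΦ]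

theorem stopIncr_of_le (v : ℝ → E) {k y : ℕ} {t : ℝ} (h : dyad k (y + 1) ≤ t) :
    stopIncr v k y t = v (dyad k (y + 1)) - v (dyad k y) := by
  rw [stopIncr, min_eq_left h, min_eq_left ((dyad_le_dyad (by omega)).trans h)]

theorem stopIncr_of_ge (v : ℝ → E) {k y : ℕ} {t : ℝ} (h : t ≤ dyad k y) :
    stopIncr v k y t = 0 := by
  rw [stopIncr, min_eq_right h, min_eq_right (h.trans (dyad_le_dyad (by omega))), sub_self]

theorem stopIncr_split (v : ℝ → E) (k y : ℕ) (t : ℝ) :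
    stopIncr v (k + 1) (2 * y) t + stopIncr v (k + 1) (2 * y + 1) t = stopIncr v k y t := by
  rw [stopIncr, stopIncr, stopIncr, show 2 * y + 1 + 1 = 2 * (y + 1) by ring, dyad_double,
    dyad_double]
  abel

theorem norm_stopIncr_le_of {w : ℝ → E} {B : ℝ} (hB : 0 ≤ B) {k y : ℕ}
    (h : ∀ t ∈ Icc (dyad k y) (dyad k (y + 1)), ‖w t - w (dyad k y)‖ ≤ B) (t : ℝ) :
    ‖stopIncr w k y t‖ ≤ B := by
  rcases le_total t (dyad k y) with h1 | h1
  · rwa [stopIncr_of_ge w h1, norm_zero]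
  · rw [stopIncr, min_eq_left h1]
    exact h _ ⟨le_min (dyad_le_dyad (by omega)) h1, min_le_left _ _⟩

theorem DyadicHolder.stopIncr {ρ B : ℝ} {w : ℝ → E} (h : DyadicHolder ρ B w) (hB : 0 ≤ B)
    (hρ : 0 ≤ ρ) {k y : ℕ} (hy : y < 2 ^ k) (t : ℝ) :
    ‖SchauderIto.stopIncr w k y t‖ ≤ B * ρ ^ k :=
  norm_stopIncr_le_of (by positivity) (h k y hy) t

theorem itoSum_eq (k : ℕ) (f : ℝ → E →L[ℝ] F) (v : ℝ → E) (t : ℝ) :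
    itoSum k f v t = ∑ y ∈ Finset.range (2 ^ k), f (dyad k y) (stopIncr v k y t) := by
  rw [itoSum, sum_Icc_one_eq_range]
  simp only [tLeft_succ, tRight_succ]
  rfl

/-- A summand of a compensated Riemann sum. -/
def compTerm (f : ℝ → E →L[ℝ] F) (v : ℝ → E) (g : ℝ → M →L[ℝ] F) (D : ℕ → ℝ → M) (k y : ℕ)
    (t : ℝ) : F :=
  f (dyad k y) (stopIncr v k y t) + g (dyad k y) (stopIncr (D k) k y t)

/-- The compensator of a Riemann sum, with the integrand sampled along dyadic intervals of
generation `k`. -/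
def compensator (g : ℝ → M →L[ℝ] F) (D : ℝ → M) (k : ℕ) (t : ℝ) : F :=
  ∑ y ∈ Finset.range (2 ^ k), g (dyad k y) (stopIncr D k y t)

/-- The compensated Riemann sums. -/
def compSum (f : ℝ → E →L[ℝ] F) (v : ℝ → E) (g : ℝ → M →L[ℝ] F) (D : ℕ → ℝ → M) (k : ℕ)
    (t : ℝ) : F :=
  ∑ y ∈ Finset.range (2 ^ k), compTerm f v g D k y t

theorem compSum_eq (f : ℝ → E →L[ℝ] F) (v : ℝ → E) (g : ℝ → M →L[ℝ] F) (D : ℕ → ℝ → M) (k : ℕ)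
    (t : ℝ) : compSum f v g D k t = itoSum k f v t + compensator g (D k) k t := by
  rw [itoSum_eq, compensator, ← Finset.sum_add_distrib]
  rfl

/-- The left half keeps the sampling point of its parent, so the integrands change on the right half
only. The last summand, the change of the approximation itself, is what cancels the leading part of
the first. -/
theorem compTerm_split (f : ℝ → E →L[ℝ] F) (v : ℝ → E) (g : ℝ → M →L[ℝ] F) (D : ℕ → ℝ → M)
    (k y : ℕ) (t : ℝ) :
    compTerm f v g D (k + 1) (2 * y) t + compTerm f v g D (k + 1) (2 * y + 1) t
        - compTerm f v g D k y t
      = (f (dyad (k + 1) (2 * y + 1)) - f (dyad k y)) (stopIncr v (k + 1) (2 * y + 1) t)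
        + (g (dyad (k + 1) (2 * y + 1)) - g (dyad k y)) (stopIncr (D (k + 1)) (k + 1) (2 * y + 1) t)
        + g (dyad k y) (stopIncr (D (k + 1)) k y t - stopIncr (D k) k y t) := by
  simp only [compTerm, dyad_double]
  rw [← stopIncr_split v k y t, ← stopIncr_split (D (k + 1)) k y t]
  simp only [sub_apply, map_sub, map_add]
  abel

/-- The vanishing of the compensators. -/
theorem compensator_tendsto_zero {b γ G N B : ℝ} (hb : 0 < b) (hγ : 0 < γ) (hbγ : b * γ < 1)
    (hG : 0 ≤ G) (hB : 0 ≤ B) {g : ℝ → M →L[ℝ] F} {D : ℕ → ℝ → M}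
    (hg : DyadicHolder b G g) (hN : ∀ t ∈ Icc (0 : ℝ) 1, ‖g t‖ ≤ N)
    (hD : ∀ᶠ K in atTop, ∀ j ≤ K, ∀ t ∈ Icc (0 : ℝ) 1,
      ∑ y ∈ Finset.range (2 ^ j), ‖stopIncr (D K) j y t‖ ≤ B * γ ^ j)
    (hD0 : TendstoUniformlyOn D 0 atTop (Icc 0 1)) :
    TendstoUniformlyOn (fun K => compensator g (D K) K) 0 atTop (Icc 0 1) := by
  have h1 : 0 < 1 - b * γ := by linarith
  have hN0 : 0 ≤ N := (norm_nonneg _).trans (hN 0 (by simp))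
  have hbγ0 : 0 < b * γ := by positivity
  rw [Metric.tendstoUniformlyOn_iff] at hD0 ⊢
  intro ε hε
  -- the generation at which the integrand is frozen
  obtain ⟨n, hn⟩ : ∃ n : ℕ, G * (B * γ) / (1 - b * γ) * (b * γ) ^ n < ε / 2 := by
    have := (tendsto_pow_atTop_nhds_zero_of_lt_one hbγ0.le hbγ).const_mul
      (G * (B * γ) / (1 - b * γ))
    rw [mul_zero] at this
    exact (this.eventually_lt_const (half_pos hε)).exists
  -- The frozen sum has `2^n` summands, each at most `N * 2δ`. Using `N + 1` avoids division by zero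
  -- and makes the final inequality strict.
  set δ : ℝ := ε / (4 * (2 ^ n * (N + 1))) with hδ
  have hδ0 : 0 < δ := by positivity
  filter_upwards [hD, hD0 δ hδ0, eventually_ge_atTop n] with K hK1 hK2 hnK t ht
  -- The integrator `D K` stays fixed while the sampling of `g` is refined; `hD` then bounds the
  -- total of its increments over generation `j + 1`.
  have hstep : ∀ j, j + 1 ≤ K → ‖compensator g (D K) (j + 1) t - compensator g (D K) j t‖
      ≤ G * (B * γ) * (b * γ) ^ j := by
    intro j hj
    have e : compensator g (D K) (j + 1) t - compensator g (D K) j t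
        = ∑ y ∈ Finset.range (2 ^ j), (g (dyad (j + 1) (2 * y + 1)) - g (dyad j y))
            (stopIncr (D K) (j + 1) (2 * y + 1) t) := by
      rw [compensator, compensator, pow_succ', sum_range_double, ← Finset.sum_sub_distrib]
      refine Finset.sum_congr rfl fun y _ => ?_
      rw [← stopIncr_split (D K) j y t, dyad_double, map_add, sub_apply]
      abel
    have h2 := hK1 (j + 1) hj t ht
    rw [pow_succ' 2, sum_range_double] at h2
    rw [e]
    refine (norm_sum_le _ _).trans ?_
    calc ∑ y ∈ Finset.range (2 ^ j), ‖(g (dyad (j + 1) (2 * y + 1)) - g (dyad j y))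
            (stopIncr (D K) (j + 1) (2 * y + 1) t)‖
        ≤ ∑ y ∈ Finset.range (2 ^ j), G * b ^ j * (‖stopIncr (D K) (j + 1) (2 * y) t‖
            + ‖stopIncr (D K) (j + 1) (2 * y + 1) t‖) := by
          refine Finset.sum_le_sum fun y hy => ?_
          have h3 := hg j y (Finset.mem_range.1 hy) (dyad (j + 1) (2 * y + 1))
            ⟨(dyad_left_lt_mid j y).le, (dyad_mid_lt_right j y).le⟩
          refine (ContinuousLinearMap.le_opNorm _ _).trans (mul_le_mul h3 ?_ (norm_nonneg _)
            (by positivity))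
          exact le_add_of_nonneg_left (norm_nonneg _)
      _ ≤ G * b ^ j * (B * γ ^ (j + 1)) := by
          rw [← Finset.mul_sum]; gcongr
      _ = _ := by rw [mul_pow, pow_succ]; ring
  have htel : ∀ m, n + m ≤ K → ‖compensator g (D K) (n + m) t - compensator g (D K) n t‖
      ≤ G * (B * γ) / (1 - b * γ) * (b * γ) ^ n * (1 - (b * γ) ^ m) := by
    intro m
    induction m with
    | zero => intro _; simp
    | succ m ih =>
      intro hm
      have e : G * (B * γ) / (1 - b * γ) * (b * γ) ^ n * (1 - (b * γ) ^ (m + 1))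
          = G * (B * γ) * (b * γ) ^ (n + m)
            + G * (B * γ) / (1 - b * γ) * (b * γ) ^ n * (1 - (b * γ) ^ m) := by
        rw [pow_add]
        generalize b * γ = x at h1 ⊢
        field_simp
        ring
      rw [e, ← sub_add_sub_cancel _ (compensator g (D K) (n + m) t)]
      exact (norm_add_le _ _).trans (add_le_add (hstep (n + m) hm) (ih (by omega)))
  have hcoarse : ‖compensator g (D K) n t‖ ≤ 2 ^ n * (N * (2 * δ)) := by
    have hDK : ∀ s ∈ Icc (0 : ℝ) 1, ‖D K s‖ ≤ δ := fun s hs => by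
      simpa using (hK2 s hs).le
    refine (norm_sum_le _ _).trans ((Finset.sum_le_card_nsmul _ _ (N * (2 * δ)) ?_).trans
      (le_of_eq (by simp)))
    intro y hy
    have hy := Finset.mem_range.1 hy
    refine (ContinuousLinearMap.le_opNorm _ _).trans (mul_le_mul (hN _ (dyad_mem hy.le)) ?_
      (norm_nonneg _) hN0)
    have h3 := hDK (min (dyad n (y + 1)) t)
      ⟨le_min (dyad_nonneg _ _) ht.1, (min_le_right _ _).trans ht.2⟩
    have h4 := hDK (min (dyad n y) t) ⟨le_min (dyad_nonneg _ _) ht.1, (min_le_right _ _).trans ht.2⟩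
    refine (norm_sub_le _ _).trans ?_
    linarith
  obtain ⟨m, rfl⟩ := Nat.exists_eq_add_of_le hnK
  have h5 := htel m le_rfl
  have h6 : G * (B * γ) / (1 - b * γ) * (b * γ) ^ n * (1 - (b * γ) ^ m)
      ≤ G * (B * γ) / (1 - b * γ) * (b * γ) ^ n :=
    mul_le_of_le_one_right (by positivity) (by have : 0 < (b * γ) ^ m := by positivity
                                               linarith)
  have h7 : (2 : ℝ) ^ n * (N * (2 * δ)) < ε / 2 + 0 := by
    have e : ε / 2 = 2 ^ n * ((N + 1) * (2 * δ)) := by rw [hδ]; field_simp; ring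
    rw [e, add_zero]
    gcongr
    linarith
  have h8 := norm_le_norm_add_norm_sub' (compensator g (D (n + m)) (n + m) t)
    (compensator g (D (n + m)) n t)
  simp only [Pi.zero_apply, dist_zero_left]
  linarith

/-! ### Sewing: convergence of the compensated sums and the local expansion of their limit. -/

variable {f : ℝ → E →L[ℝ] F} {v : ℝ → E} {g : ℝ → M →L[ℝ] F} {D : ℕ → ℝ → M}

/-- The summands of compensated Riemann sums are almost additive on full intervals. -/
def AlmostAdditive (κ c : ℝ) (f : ℝ → E →L[ℝ] F) (v : ℝ → E) (g : ℝ → M →L[ℝ] F)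
    (D : ℕ → ℝ → M) : Prop :=
  ∀ k ≠ 0, ∀ y < 2 ^ k, ∀ t, dyad k (y + 1) ≤ t →
    ‖compTerm f v g D (k + 1) (2 * y) t + compTerm f v g D (k + 1) (2 * y + 1) t
        - compTerm f v g D k y t‖ ≤ c * κ ^ k

/-- Meant for the one interval that `t` may cut, where the cancellation is not available. The three
compensators are estimated separately; the rate `a²` is poor, but is paid once per generation. -/
theorem norm_compTerm_split_le {a U V N S : ℝ} (ha : 0 ≤ a) (ha1 : a ≤ 1) (hU : 0 ≤ U)
    (hV : 0 ≤ V) (hS : 0 ≤ S) (hf : DyadicHolder a U f) (hv : DyadicHolder a V v)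
    (hN : ∀ t ∈ Icc (0 : ℝ) 1, ‖g t‖ ≤ N)
    (hD : ∀ k ≠ 0, ∀ y < 2 ^ k, ∀ t ∈ Icc (dyad k y) (dyad k (y + 1)),
      ‖D k t - D k (dyad k y)‖ ≤ S * (a ^ 2) ^ k)
    {k y : ℕ} (hk : k ≠ 0) (hy : y < 2 ^ k) (t : ℝ) :
    ‖compTerm f v g D (k + 1) (2 * y) t + compTerm f v g D (k + 1) (2 * y + 1) t
        - compTerm f v g D k y t‖ ≤ (U * V + 3 * (N * S)) * (a ^ 2) ^ k := by
  have hp : 2 ^ (k + 1) = 2 * 2 ^ k := by ring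
  have hN0 : 0 ≤ N := (norm_nonneg _).trans (hN 0 (by simp))
  have hD' : ∀ k ≠ 0, ∀ y < 2 ^ k, ‖stopIncr (D k) k y t‖ ≤ S * (a ^ 2) ^ k := fun k hk y hy =>
    norm_stopIncr_le_of (by positivity) (hD k hk y hy) t
  have hg : ∀ k ≠ 0, ∀ y < 2 ^ k, ‖g (dyad k y) (stopIncr (D k) k y t)‖
      ≤ N * (S * (a ^ 2) ^ k) := fun k hk y hy =>
    (ContinuousLinearMap.le_opNorm _ _).trans (mul_le_mul (hN _ (dyad_mem hy.le)) (hD' k hk y hy)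
      (norm_nonneg _) hN0)
  have hmono : N * (S * (a ^ 2) ^ (k + 1)) ≤ N * (S * (a ^ 2) ^ k) := by
    gcongr N * (S * ?_)
    exact pow_le_pow_of_le_one (by positivity) (pow_le_one₀ ha ha1) (by omega)
  have hsv := hv.stopIncr hV ha (k := k + 1) (y := 2 * y + 1) (by omega) t
  have hVm : V * a ^ (k + 1) ≤ V * a ^ k := by
    gcongr V * ?_
    exact pow_le_pow_of_le_one ha ha1 (by omega)
  have h1 : ‖(f (dyad (k + 1) (2 * y + 1)) - f (dyad k y)) (stopIncr v (k + 1) (2 * y + 1) t)‖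
      ≤ U * a ^ k * (V * a ^ k) :=
    (ContinuousLinearMap.le_opNorm _ _).trans (mul_le_mul (hf k y hy _
      ⟨(dyad_left_lt_mid k y).le, (dyad_mid_lt_right k y).le⟩) (hsv.trans hVm)
      (norm_nonneg _) (by positivity))
  have h2 := hg (k + 1) (by omega) (2 * y) (by omega)
  have h3 := hg (k + 1) (by omega) (2 * y + 1) (by omega)
  have h4 := hg k hk y hy
  have e : compTerm f v g D (k + 1) (2 * y) t + compTerm f v g D (k + 1) (2 * y + 1) t
        - compTerm f v g D k y t
      = (f (dyad (k + 1) (2 * y + 1)) - f (dyad k y)) (stopIncr v (k + 1) (2 * y + 1) t)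
        + g (dyad (k + 1) (2 * y)) (stopIncr (D (k + 1)) (k + 1) (2 * y) t)
        + g (dyad (k + 1) (2 * y + 1)) (stopIncr (D (k + 1)) (k + 1) (2 * y + 1) t)
        - g (dyad k y) (stopIncr (D k) k y t) := by
    simp only [compTerm]
    rw [← stopIncr_split v k y t, dyad_double]
    simp only [sub_apply, map_add]
    abel
  rw [e]
  have e2 : (U * V + 3 * (N * S)) * (a ^ 2) ^ k
      = U * a ^ k * (V * a ^ k) + 3 * (N * (S * (a ^ 2) ^ k)) := by ring
  rw [e2]
  refine (norm_sub_le _ _).trans ?_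
  refine (add_le_add_left ((norm_add_le _ _).trans
    (add_le_add_left (norm_add_le _ _) _)) _).trans ?_
  linarith

/-- Intervals to the left of `t` are complete and almost additive, those to the right contribute
nothing, and the one containing `t` is covered by the crude bound. -/
theorem norm_compSum_succ_sub_le {κ c a C : ℝ} (hc : 0 ≤ c) (hκ : 0 ≤ κ)
    (hadd : AlmostAdditive κ c f v g D)
    (hcrude : ∀ k ≠ 0, ∀ y < 2 ^ k, ∀ t,
      ‖compTerm f v g D (k + 1) (2 * y) t + compTerm f v g D (k + 1) (2 * y + 1) t
        - compTerm f v g D k y t‖ ≤ C * a ^ k)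
    {k : ℕ} (hk : k ≠ 0) {t : ℝ} (ht : t ∈ Icc (0 : ℝ) 1) :
    ‖compSum f v g D (k + 1) t - compSum f v g D k t‖ ≤ c * (2 * κ) ^ k + C * a ^ k := by
  obtain ⟨i, hi, hti⟩ := exists_dyad_interval k ht
  rw [compSum, compSum, pow_succ', sum_range_double, ← Finset.sum_sub_distrib]
  have hterm : ∀ y ∈ Finset.range (2 ^ k),
      ‖compTerm f v g D (k + 1) (2 * y) t + compTerm f v g D (k + 1) (2 * y + 1) t
        - compTerm f v g D k y t‖ ≤ c * κ ^ k + if y = i then C * a ^ k else 0 := by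
    intro y hy
    have hy := Finset.mem_range.1 hy
    have h0 : 0 ≤ c * κ ^ k := by positivity
    rcases lt_trichotomy y i with h | rfl | h
    · rw [if_neg h.ne, add_zero]
      exact hadd k hk y hy t ((dyad_le_dyad h).trans hti.1)
    · rw [if_pos rfl]
      exact (hcrude k hk y hy t).trans (by linarith)
    · rw [if_neg h.ne', add_zero]
      have h1 : t ≤ dyad k y := hti.2.trans (dyad_le_dyad h)
      have h2 : t ≤ dyad (k + 1) (2 * y) := by rwa [dyad_double]
      have h3 : t ≤ dyad (k + 1) (2 * y + 1) := h1.trans (dyad_left_lt_mid k y).le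
      simpa [compTerm, stopIncr_of_ge _ h1, stopIncr_of_ge _ h2, stopIncr_of_ge _ h3] using h0
  refine (norm_sum_le _ _).trans ((Finset.sum_le_sum hterm).trans (le_of_eq ?_))
  rw [Finset.sum_add_distrib, Finset.sum_const, Finset.sum_ite_eq', if_pos (Finset.mem_range.2 hi)]
  simp only [Finset.card_range, nsmul_eq_mul]
  push_cast
  rw [mul_pow]; ring

theorem exists_compSum_limit [CompleteSpace F] {κ c a C : ℝ} (hc : 0 ≤ c) (hκ : 0 ≤ κ)
    (hκ1 : 2 * κ < 1) (ha : 0 ≤ a) (ha1 : a < 1)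
    (hadd : AlmostAdditive κ c f v g D)
    (hcrude : ∀ k ≠ 0, ∀ y < 2 ^ k, ∀ t,
      ‖compTerm f v g D (k + 1) (2 * y) t + compTerm f v g D (k + 1) (2 * y + 1) t
        - compTerm f v g D k y t‖ ≤ C * a ^ k) :
    ∃ J : ℝ → F, TendstoUniformlyOn (compSum f v g D) J atTop (Icc 0 1) := by
  have hsum : Summable fun k : ℕ => c * (2 * κ) ^ (k + 1) + C * a ^ (k + 1) :=
    (((summable_nat_add_iff 1).2 (summable_geometric_of_lt_one (by positivity) hκ1)).mul_left c).add
      (((summable_nat_add_iff 1).2 (summable_geometric_of_lt_one ha ha1)).mul_left C)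
  have h := tendstoUniformlyOn_tsum_nat hsum (s := Icc (0 : ℝ) 1)
    (f := fun k t => compSum f v g D (k + 1 + 1) t - compSum f v g D (k + 1) t)
    fun k t ht => norm_compSum_succ_sub_le hc hκ hadd hcrude k.succ_ne_zero ht
  refine ⟨fun t => compSum f v g D 1 t
    + ∑' k, (compSum f v g D (k + 1 + 1) t - compSum f v g D (k + 1) t), ?_⟩
  rw [Metric.tendstoUniformlyOn_iff] at h ⊢
  intro ε hε
  obtain ⟨n, hn⟩ := eventually_atTop.1 (h ε hε)
  refine eventually_atTop.2 ⟨n + 1, fun k hk t ht => ?_⟩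
  obtain ⟨k, rfl⟩ : ∃ m, k = m + 1 := ⟨k - 1, by omega⟩
  have h1 := hn k (by omega) t ht
  rw [Finset.sum_range_sub (fun k => compSum f v g D (k + 1) t)] at h1
  rw [dist_eq_norm] at h1 ⊢
  convert h1 using 2
  abel

/-- The limit of compensated Riemann sums is close to the summand over a single interval. -/
theorem norm_limit_sub_le {κ c : ℝ} (hc : 0 ≤ c) (hκ : 0 ≤ κ) (hκ1 : 2 * κ < 1)
    (hadd : AlmostAdditive κ c f v g D) {J : ℝ → F}
    (hJ : ∀ t ∈ Icc (0 : ℝ) 1, Tendsto (fun k => compSum f v g D k t) atTop (nhds (J t)))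
    {p i : ℕ} (hp : p ≠ 0) (hi : i < 2 ^ p) :
    ‖J (dyad p (i + 1)) - J (dyad p i) - compTerm f v g D p i 1‖ ≤ c / (1 - 2 * κ) * κ ^ p := by
  have h1 : 0 < 1 - 2 * κ := by linarith
  -- The compensated sum over the fixed interval, refined `n` times. Evaluation at time 1 means that
  -- no increment is stopped.
  set Z : ℕ → F := fun n =>
    ∑ y ∈ Finset.Ico (i * 2 ^ n) ((i + 1) * 2 ^ n), compTerm f v g D (p + n) y 1 with hZ
  have hle : ∀ n, (i + 1) * 2 ^ n ≤ 2 ^ (p + n) := fun n => by rw [pow_add]; gcongr; omega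
  have hval : ∀ n x, x ≤ 2 ^ (p + n) → compSum f v g D (p + n) (dyad (p + n) x)
      = ∑ y ∈ Finset.range x, compTerm f v g D (p + n) y 1 := by
    intro n x hx
    refine (stopped_sum_dyad (fun y s u => f (dyad (p + n) y) (v u - v s)
      + g (dyad (p + n) y) (D (p + n) u - D (p + n) s)) (fun y s => by simp) hx).trans ?_
    refine Finset.sum_congr rfl fun y hy => ?_
    have hy : y + 1 ≤ 2 ^ (p + n) := by have := Finset.mem_range.1 hy; omega
    rw [compTerm, stopIncr_of_le v (dyad_le_one hy), stopIncr_of_le _ (dyad_le_one hy)]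
  have hZeq : ∀ n, compSum f v g D (p + n) (dyad p (i + 1)) - compSum f v g D (p + n) (dyad p i)
      = Z n := by
    intro n
    have h2 : i * 2 ^ n ≤ (i + 1) * 2 ^ n := by gcongr; omega
    rw [← dyad_mul_pow p n (i + 1), ← dyad_mul_pow p n i, hval n _ (hle n),
      hval n _ (h2.trans (hle n))]
    exact (Finset.sum_Ico_eq_sub _ h2).symm
  -- There are `2^n` subintervals, each with an error `c κ^{p+n}`; the ratio `2κ < 1` makes the
  -- errors summable.
  have hstep : ∀ n, ‖Z (n + 1) - Z n‖ ≤ c * κ ^ p * (2 * κ) ^ n := by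
    intro n
    have e : ∀ x, x * 2 ^ (n + 1) = 2 * (x * 2 ^ n) := fun x => by ring
    simp only [hZ, e]
    rw [sum_Ico_double, ← Finset.sum_sub_distrib]
    refine (norm_sum_le _ _).trans ((Finset.sum_le_card_nsmul _ _ (c * κ ^ (p + n)) ?_).trans
      (le_of_eq ?_))
    · intro y hy
      have hy : y + 1 ≤ 2 ^ (p + n) := by
        have := (Finset.mem_Ico.1 hy).2
        have := hle n
        omega
      exact hadd (p + n) (by omega) y hy 1 (dyad_le_one hy)
    · rw [Nat.card_Ico, ← Nat.sub_mul, Nat.add_sub_cancel_left, one_mul, nsmul_eq_mul]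
      push_cast
      rw [mul_pow, pow_add]; ring
  have hbound : ∀ n, ‖Z n - Z 0‖ ≤ c / (1 - 2 * κ) * κ ^ p * (1 - (2 * κ) ^ n) := by
    intro n
    induction n with
    | zero => simp
    | succ n ih =>
      have e : c / (1 - 2 * κ) * κ ^ p * (1 - (2 * κ) ^ (n + 1))
          = c * κ ^ p * (2 * κ) ^ n + c / (1 - 2 * κ) * κ ^ p * (1 - (2 * κ) ^ n) := by
        field_simp; ring
      rw [e, ← sub_add_sub_cancel _ (Z n)]
      exact (norm_add_le _ _).trans (add_le_add (hstep n) ih)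
  have hZ0 : Z 0 = compTerm f v g D p i 1 := by simp [hZ]
  have hlim : Tendsto Z atTop (nhds (J (dyad p (i + 1)) - J (dyad p i))) := by
    have h2 := ((hJ _ (dyad_mem hi)).sub (hJ _ (dyad_mem hi.le))).comp (tendsto_add_atTop_nat p)
    refine h2.congr fun n => ?_
    rw [← hZeq n, Function.comp_apply, add_comm n p]
  rw [← hZ0]
  refine le_of_tendsto (hlim.sub_const _).norm (Eventually.of_forall fun n => (hbound n).trans ?_)
  exact mul_le_of_le_one_right (by positivity)
    (by have : 0 ≤ (2 * κ) ^ n := by positivity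
        linarith)

end Compensated

/-! ### Contractions of bilinear maps with matrices -/

section Contract

variable {d : ℕ} {F : Type*} [NormedAddCommGroup F] [NormedSpace ℝ F]

/-- The contraction `T ↦ (M ↦ ∑_{i,j} M_{ij} T(e_i, e_j))`. -/
def contract (d : ℕ) (F : Type*) [NormedAddCommGroup F] [NormedSpace ℝ F] :
    (EuclideanSpace ℝ (Fin d) →L[ℝ] EuclideanSpace ℝ (Fin d) →L[ℝ] F) →L[ℝ]
      (EuclideanSpace ℝ (Fin d × Fin d) →L[ℝ] F) :=
  ∑ ij : Fin d × Fin d,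
    (ContinuousLinearMap.smulRightL ℝ (EuclideanSpace ℝ (Fin d × Fin d)) F
      (EuclideanSpace.proj ij)).comp
      ((ContinuousLinearMap.apply ℝ F (EuclideanSpace.single ij.2 (1 : ℝ))).comp
        (ContinuousLinearMap.apply ℝ (EuclideanSpace ℝ (Fin d) →L[ℝ] F)
          (EuclideanSpace.single ij.1 (1 : ℝ))))

theorem contract_apply (T : EuclideanSpace ℝ (Fin d) →L[ℝ] EuclideanSpace ℝ (Fin d) →L[ℝ] F)
    (M : EuclideanSpace ℝ (Fin d × Fin d)) :
    contract d F T M = ∑ ij : Fin d × Fin d, M ij •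
      T (EuclideanSpace.single ij.1 (1 : ℝ)) (EuclideanSpace.single ij.2 (1 : ℝ)) := by
  simp [contract]

theorem contract_tensor (T : EuclideanSpace ℝ (Fin d) →L[ℝ] EuclideanSpace ℝ (Fin d) →L[ℝ] F)
    (x y : EuclideanSpace ℝ (Fin d)) : contract d F T (tensor x y) = T x y := by
  have h : ∀ x : EuclideanSpace ℝ (Fin d),
      x = ∑ i, x i • EuclideanSpace.single i (1 : ℝ) := fun x => by
    ext j
    simp [Finset.sum_apply, Pi.single_apply]
  rw [contract_apply, Fintype.sum_prod_type]
  conv_rhs => rw [h x, h y]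
  simp only [map_sum, map_smul, sum_apply, smul_apply,
    Finset.smul_sum, tensor, mul_smul]
  rw [Finset.sum_comm]
  exact Finset.sum_congr rfl fun i _ => Finset.sum_congr rfl fun j _ => smul_comm _ _ _

theorem norm_contract_le
    (T : EuclideanSpace ℝ (Fin d) →L[ℝ] EuclideanSpace ℝ (Fin d) →L[ℝ] F) :
    ‖contract d F T‖ ≤ (d : ℝ) ^ 2 * ‖T‖ := by
  refine ContinuousLinearMap.opNorm_le_bound _ (by positivity) fun M => ?_
  rw [contract_apply]
  refine (norm_sum_le _ _).trans ((Finset.sum_le_card_nsmul _ _ (‖M‖ * ‖T‖) fun ij _ => ?_).trans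
    (le_of_eq (by simp [sq]; ring)))
  rw [norm_smul]
  refine mul_le_mul (PiLp.norm_apply_le M ij) ?_ (norm_nonneg _) (norm_nonneg _)
  refine (ContinuousLinearMap.le_opNorm₂ _ _ _).trans (le_of_eq ?_)
  simp

end Contract

theorem tendstoUniformlyOn_of_succ {E : Type*} [NormedAddCommGroup E] {u : ℕ → ℝ → E} {U : ℝ → E}
    {s : Set ℝ} (h : TendstoUniformlyOn (fun k => u (k + 1)) U atTop s) :
    TendstoUniformlyOn u U atTop s := by
  rw [Metric.tendstoUniformlyOn_iff] at h ⊢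
  intro ε hε
  obtain ⟨n, hn⟩ := eventually_atTop.1 (h ε hε)
  refine eventually_atTop.2 ⟨n + 1, fun k hk t ht => ?_⟩
  obtain ⟨k, rfl⟩ : ∃ m, k = m + 1 := ⟨k - 1, by omega⟩
  exact hn k (by omega) t ht

/-! ### The compensators of the Itô sums -/

section Ito

variable {d : ℕ} {F : Type*} [NormedAddCommGroup F] [NormedSpace ℝ F]
  {v : ℝ → EuclideanSpace ℝ (Fin d)} {f : ℝ → EuclideanSpace ℝ (Fin d) →L[ℝ] F}
  {f' : ℝ → EuclideanSpace ℝ (Fin d) →L[ℝ] EuclideanSpace ℝ (Fin d) →L[ℝ] F}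
  {A Q : ℝ → EuclideanSpace ℝ (Fin d × Fin d)}

/-- The difference between the area of Itô type `L(v,v) - [v,v] / 2` and its approximations. -/
def areaDefect (A Q : ℝ → EuclideanSpace ℝ (Fin d × Fin d)) (v : ℝ → EuclideanSpace ℝ (Fin d))
    (k : ℕ) (t : ℝ) : EuclideanSpace ℝ (Fin d × Fin d) :=
  A t - (1 / 2 : ℝ) • Q t - itoArea k v t

/-- Control at the matching generation only. Increments of the defect of generation `K` over coarser
intervals are the subject of `sum_norm_stopIncr_areaDefect_le`. -/
theorem norm_areaDefect_sub_le {a V HA HQ : ℝ} (ha : 0 < a) (ha1 : a < 1) (ha2 : 1 < 2 * a ^ 2)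
    (hV : 0 ≤ V) (hv : DyadicHolder a V v) (hA : DyadicHolder (a ^ 2) HA A)
    (hQ : DyadicHolder (a ^ 2) HQ Q) : ∀ k ≠ 0, ∀ i < 2 ^ k,
    ∀ t ∈ Icc (dyad k i) (dyad k (i + 1)),
      ‖areaDefect A Q v k t - areaDefect A Q v k (dyad k i)‖
        ≤ (HA + 1 / 2 * HQ + ((d : ℝ) ^ 2 * (4 / (2 * a ^ 2 - 1)) + 1) * V ^ 2) * (a ^ 2) ^ k := by
  intro k hk i hi t ht
  have h1 := hA k i hi t ht
  have h2 := hQ k i hi t ht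
  have h3 := norm_itoArea_sub_le ha ha1 ha2 hV hv hk hi ht
  have e : areaDefect A Q v k t - areaDefect A Q v k (dyad k i)
      = (A t - A (dyad k i)) - (1 / 2 : ℝ) • (Q t - Q (dyad k i))
        - (itoArea k v t - itoArea k v (dyad k i)) := by
    simp only [areaDefect, smul_sub]; abel
  rw [e]
  refine (norm_sub_le _ _).trans ((add_le_add_left (norm_sub_le _ _) _).trans ?_)
  rw [norm_smul, Real.norm_of_nonneg (by norm_num)]
  linarith

theorem areaDefect_tendsto
    (hL : TendstoUniformlyOn (fun k => levyMatrix (sumBelow k v)) A atTop (Icc 0 1))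
    (hQ : TendstoUniformlyOn (fun k => quadVar k v) Q atTop (Icc 0 1)) :
    TendstoUniformlyOn (areaDefect A Q v) 0 atTop (Icc 0 1) := by
  rw [Metric.tendstoUniformlyOn_iff] at hL hQ ⊢
  intro ε hε
  filter_upwards [hL (ε / 2) (half_pos hε), hQ (ε / 2) (half_pos hε)] with k h1 h2 t ht
  have h1 := h1 t ht
  have h2 := h2 t ht
  rw [dist_eq_norm] at h1 h2
  have e : areaDefect A Q v k t
      = (A t - levyMatrix (sumBelow k v) t) - (1 / 2 : ℝ) • (Q t - quadVar k v t) := by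
    simp only [areaDefect, itoArea, smul_sub]; abel
  rw [Pi.zero_apply, dist_zero_left, e]
  refine (norm_sub_le _ _).trans_lt ?_
  rw [norm_smul, Real.norm_of_nonneg (by norm_num)]
  have := norm_nonneg (Q t - quadVar k v t)
  linarith

/-- The Hölder terms give `2^j` increments of size `(a²)^j`. The quadratic variation is bounded
through its total variation, with no growth in `j`, and this is absorbed because `2a² > 1`; uniform
convergence bounds its size for large `K`. -/
theorem sum_norm_stopIncr_areaDefect_le {a HA HQ HL : ℝ} (ha : 0 < a) (ha2 : 1 < 2 * a ^ 2)
    (hHA : 0 ≤ HA) (hHQ : 0 ≤ HQ) (hHL : 0 ≤ HL) (hA : DyadicHolder (a ^ 2) HA A)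
    (hQ : DyadicHolder (a ^ 2) HQ Q)
    (hLH : ∀ k ≠ 0, DyadicHolder (a ^ 2) HL (levyMatrix (sumBelow k v)))
    (hQlim : TendstoUniformlyOn (fun k => quadVar k v) Q atTop (Icc 0 1)) :
    ∀ᶠ K in atTop, ∀ j ≤ K, ∀ t ∈ Icc (0 : ℝ) 1,
      ∑ y ∈ Finset.range (2 ^ j), ‖stopIncr (areaDefect A Q v K) j y t‖
        ≤ (HA + HQ + HL + d * (‖Q 0‖ + HQ + 1)) * (2 * a ^ 2) ^ j := by
  rw [Metric.tendstoUniformlyOn_iff] at hQlim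
  filter_upwards [hQlim 1 one_pos, eventually_ge_atTop 1] with K hK hK1 j hj t ht
  have hQt : ‖quadVar K v t‖ ≤ ‖Q 0‖ + HQ + 1 := by
    have h1 := hK t ht
    rw [dist_eq_norm, norm_sub_rev] at h1
    have h2 := hQ.norm_le ht
    have h3 := norm_le_norm_add_norm_sub' (quadVar K v t) (Q t)
    linarith
  have hterm : ∀ y ∈ Finset.range (2 ^ j), ‖stopIncr (areaDefect A Q v K) j y t‖
      ≤ (HA + HQ + HL) * (a ^ 2) ^ j + ‖stopIncr (quadVar K v) j y t‖ := by
    intro y hy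
    have hy := Finset.mem_range.1 hy
    have h1 := hA.stopIncr hHA (by positivity) hy t
    have h2 := hQ.stopIncr hHQ (by positivity) hy t
    have h3 := (hLH K (by omega)).stopIncr hHL (by positivity) hy t
    have e : stopIncr (areaDefect A Q v K) j y t
        = (stopIncr A j y t - (1 / 2 : ℝ) • stopIncr Q j y t)
          - (stopIncr (levyMatrix (sumBelow K v)) j y t
            - (1 / 2 : ℝ) • stopIncr (quadVar K v) j y t) := by
      simp only [stopIncr, areaDefect, itoArea, smul_sub]; abel
    rw [e]
    refine (norm_sub_le _ _).trans ((add_le_add (norm_sub_le _ _) (norm_sub_le _ _)).trans ?_)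
    rw [norm_smul, norm_smul, Real.norm_of_nonneg (by norm_num)]
    have h4 := norm_nonneg (stopIncr Q j y t)
    have h5 := norm_nonneg (stopIncr (quadVar K v) j y t)
    linarith
  obtain ⟨n, rfl⟩ := Nat.exists_eq_add_of_le hj
  have hvar := sum_norm_stopIncr_quadVar_le v j n ht
  have h6 : (1 : ℝ) ≤ (2 * a ^ 2) ^ j := one_le_pow₀ ha2.le
  refine (Finset.sum_le_sum hterm).trans ?_
  rw [Finset.sum_add_distrib, Finset.sum_const, Finset.card_range, nsmul_eq_mul]
  push_cast
  have h7 : (d : ℝ) * ‖quadVar (j + n) v t‖ ≤ d * (‖Q 0‖ + HQ + 1) := by gcongr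
  have h8 : (d : ℝ) * (‖Q 0‖ + HQ + 1) ≤ d * (‖Q 0‖ + HQ + 1) * (2 * a ^ 2) ^ j :=
    le_mul_of_one_le_right (by positivity) h6
  have e : (2 : ℝ) ^ j * ((HA + HQ + HL) * (a ^ 2) ^ j) = (HA + HQ + HL) * (2 * a ^ 2) ^ j := by
    rw [mul_pow]; ring
  rw [e, add_mul]
  linarith

/-- The contraction of `f'` with the tensor of half increments turns the increment of `f` into its
controlled remainder, of order `(b a)^k`. Together with an increment of `v` this gives `(b a²)^k`,
as does the increment of `f'` times that of the defect. -/
theorem almostAdditive_areaDefect {a b V R G S : ℝ} (ha : 0 < a) (ha1 : a < 1) (hb : 0 < b)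
    (hb1 : b ≤ 1) (hV : 0 ≤ V) (hR : 0 ≤ R) (hG : 0 ≤ G) (hS : 0 ≤ S)
    (hv : DyadicHolder a V v)
    (hf : DyadicControlled (b * a) R v f f')
    (hg : DyadicHolder b G fun t => contract d F (f' t))
    (hD : ∀ k ≠ 0, ∀ y < 2 ^ k, ∀ t ∈ Icc (dyad k y) (dyad k (y + 1)),
      ‖areaDefect A Q v k t - areaDefect A Q v k (dyad k y)‖ ≤ S * (a ^ 2) ^ k) :
    AlmostAdditive (b * a ^ 2) (R * V + G * S) f v (fun t => contract d F (f' t))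
      (areaDefect A Q v) := by
  intro k hk y hy t ht
  have hp : 2 ^ (k + 1) = 2 * 2 ^ k := by ring
  have hl := dyad_left_lt_mid k y
  have hr := dyad_mid_lt_right k y
  have e2 : 2 * y + 1 + 1 = 2 * (y + 1) := by ring
  have hb' : stopIncr v (k + 1) (2 * y + 1) t
      = v (dyad k (y + 1)) - v (dyad (k + 1) (2 * y + 1)) := by
    rw [stopIncr_of_le v (by rw [e2, dyad_double]; exact ht), e2, dyad_double]
  have hdef : stopIncr (areaDefect A Q v (k + 1)) k y t - stopIncr (areaDefect A Q v k) k y t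
      = -tensor (v (dyad (k + 1) (2 * y + 1)) - v (dyad k y))
          (v (dyad k (y + 1)) - v (dyad (k + 1) (2 * y + 1))) := by
    rw [← itoArea_succ_incr v hk hy, stopIncr_of_le _ ht, stopIncr_of_le _ ht]
    simp only [areaDefect]; abel
  rw [compTerm_split, hdef, map_neg, contract_tensor, hb']
  have e : (f (dyad (k + 1) (2 * y + 1)) - f (dyad k y))
        (v (dyad k (y + 1)) - v (dyad (k + 1) (2 * y + 1)))
      + (contract d F (f' (dyad (k + 1) (2 * y + 1))) - contract d F (f' (dyad k y)))
        (stopIncr (areaDefect A Q v (k + 1)) (k + 1) (2 * y + 1) t)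
      + -f' (dyad k y) (v (dyad (k + 1) (2 * y + 1)) - v (dyad k y))
          (v (dyad k (y + 1)) - v (dyad (k + 1) (2 * y + 1)))
      = (f (dyad (k + 1) (2 * y + 1)) - f (dyad k y)
          - f' (dyad k y) (v (dyad (k + 1) (2 * y + 1)) - v (dyad k y)))
        (v (dyad k (y + 1)) - v (dyad (k + 1) (2 * y + 1)))
      + (contract d F (f' (dyad (k + 1) (2 * y + 1))) - contract d F (f' (dyad k y)))
        (stopIncr (areaDefect A Q v (k + 1)) (k + 1) (2 * y + 1) t) := by
    simp only [sub_apply]; abel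
  rw [e]
  have h1 := hf (k + 1) (2 * y) (by omega)
  have h2 := hv.incr (k + 1) (2 * y + 1) (by omega)
  rw [e2] at h2
  rw [dyad_double] at h1 h2
  have h3 := hg k y hy _ ⟨hl.le, hr.le⟩
  have h4 := norm_stopIncr_le_of (by positivity) (hD (k + 1) (by omega) (2 * y + 1) (by omega)) t
  have ha' : a ^ (k + 1) ≤ a ^ k := pow_le_pow_of_le_one ha.le ha1.le (by omega)
  have hba : (b * a) ^ (k + 1) ≤ (b * a) ^ k :=
    pow_le_pow_of_le_one (by positivity) (mul_le_one₀ hb1 ha.le ha1.le) (by omega)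
  have haa : (a ^ 2) ^ (k + 1) ≤ (a ^ 2) ^ k :=
    pow_le_pow_of_le_one (by positivity) (pow_le_one₀ ha.le ha1.le) (by omega)
  have h5 := (ContinuousLinearMap.le_opNorm (f (dyad (k + 1) (2 * y + 1)) - f (dyad k y)
    - f' (dyad k y) (v (dyad (k + 1) (2 * y + 1)) - v (dyad k y)))
    (v (dyad k (y + 1)) - v (dyad (k + 1) (2 * y + 1)))).trans
    (mul_le_mul (h1.trans (mul_le_mul_of_nonneg_left hba hR))
      (h2.trans (mul_le_mul_of_nonneg_left ha' hV)) (norm_nonneg _) (by positivity))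
  have h6 := (ContinuousLinearMap.le_opNorm
    (contract d F (f' (dyad (k + 1) (2 * y + 1))) - contract d F (f' (dyad k y)))
    (stopIncr (areaDefect A Q v (k + 1)) (k + 1) (2 * y + 1) t)).trans
    (mul_le_mul h3 (h4.trans (mul_le_mul_of_nonneg_left haa hS)) (norm_nonneg _) (by positivity))
  refine (norm_add_le _ _).trans ((add_le_add h5 h6).trans (le_of_eq ?_))
  ring

theorem itoSum_at_zero (k : ℕ) (f : ℝ → EuclideanSpace ℝ (Fin d) →L[ℝ] F)
    (v : ℝ → EuclideanSpace ℝ (Fin d)) : itoSum k f v 0 = 0 := by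
  rw [itoSum_eq]
  refine Finset.sum_eq_zero fun y _ => ?_
  rw [stopIncr_of_ge v (dyad_nonneg k y), map_zero]

theorem continuousOn_itoSum (k : ℕ) (f : ℝ → EuclideanSpace ℝ (Fin d) →L[ℝ] F)
    (hv : ContinuousOn v (Icc 0 1)) : ContinuousOn (itoSum k f v) (Icc 0 1) := by
  have h : ∀ y, ContinuousOn (fun t => v (min (dyad k y) t)) (Icc 0 1) := fun y =>
    hv.comp (by fun_prop) fun t ht => ⟨le_min (dyad_nonneg k y) ht.1, (min_le_right _ _).trans ht.2⟩
  refine (continuousOn_finsetSum (Finset.range (2 ^ k)) fun y _ =>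
    (f (dyad k y)).continuous.comp_continuousOn ((h (y + 1)).sub (h y))).congr fun t _ => ?_
  exact itoSum_eq k f v t

/-- The Itô sums converge, and the limit is controlled by `v` with derivative `f`. -/
theorem exists_ito_integral [CompleteSpace F] {a b V R U N G S HA HQ HL : ℝ}
    (ha : 0 < a) (ha1 : a < 1) (ha2 : 1 < 2 * a ^ 2) (hb : 0 < b) (hb1 : b < 1)
    (hab : 2 * (b * a ^ 2) < 1)
    (hV : 0 ≤ V) (hR : 0 ≤ R) (hU : 0 ≤ U) (hG : 0 ≤ G) (hHA : 0 ≤ HA)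
    (hHQ : 0 ≤ HQ) (hHL : 0 ≤ HL)
    (hSdef : S = HA + 1 / 2 * HQ + ((d : ℝ) ^ 2 * (4 / (2 * a ^ 2 - 1)) + 1) * V ^ 2)
    (hvc : ContinuousOn v (Icc 0 1)) (hv : DyadicHolder a V v)
    (hfU : DyadicHolder a U f) (hf : DyadicControlled (b * a) R v f f')
    (hg : DyadicHolder b G fun t => contract d F (f' t))
    (hN : ∀ t ∈ Icc (0 : ℝ) 1, ‖contract d F (f' t)‖ ≤ N)
    (hA : DyadicHolder (a ^ 2) HA A) (hQ : DyadicHolder (a ^ 2) HQ Q)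
    (hLH : ∀ k ≠ 0, DyadicHolder (a ^ 2) HL (levyMatrix (sumBelow k v)))
    (hL : TendstoUniformlyOn (fun k => levyMatrix (sumBelow k v)) A atTop (Icc 0 1))
    (hQlim : TendstoUniformlyOn (fun k => quadVar k v) Q atTop (Icc 0 1)) :
    ∃ J : ℝ → F, TendstoUniformlyOn (fun k => itoSum k f v) J atTop (Icc 0 1) ∧
      ContinuousOn J (Icc 0 1) ∧ J 0 = 0 ∧
      DyadicControlled (a * a)
        (2 * (N * S + (R * V + G * S) / (1 - 2 * (b * a ^ 2))) + U * V) v J f := by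
  have hN0 : 0 ≤ N := (norm_nonneg _).trans (hN 0 (by simp))
  have h2a : 0 < 2 * a ^ 2 - 1 := by linarith
  have hS : 0 ≤ S := by rw [hSdef]; positivity
  have hκ : 0 < 1 - 2 * (b * a ^ 2) := by linarith
  have hD := norm_areaDefect_sub_le ha ha1 ha2 hV hv hA hQ
  rw [← hSdef] at hD
  have hadd := almostAdditive_areaDefect ha ha1 hb hb1.le hV hR hG hS hv hf hg hD
  have hcrude := fun k hk y hy => norm_compTerm_split_le (k := k) (y := y) ha.le ha1.le hU hV hS
    hfU hv hN hD hk hy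
  obtain ⟨J, hJ⟩ := exists_compSum_limit (by positivity) (by positivity) hab (by positivity)
    (pow_lt_one₀ ha.le ha1 two_ne_zero) hadd hcrude
  have hcomp := compensator_tendsto_zero hb (by positivity) (by linarith) hG (by positivity) hg hN
    (sum_norm_stopIncr_areaDefect_le ha ha2 hHA hHQ hHL hA hQ hLH hQlim)
    (areaDefect_tendsto hL hQlim)
  -- The compensated sums converge and the compensators vanish, so the plain Itô sums have the same
  -- limit.
  have hI : TendstoUniformlyOn (fun k => itoSum k f v) J atTop (Icc 0 1) := by
    rw [Metric.tendstoUniformlyOn_iff] at hJ hcomp ⊢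
    intro ε hε
    filter_upwards [hJ (ε / 2) (half_pos hε), hcomp (ε / 2) (half_pos hε)] with k h1 h2 t ht
    have h1 := h1 t ht
    have h2 := h2 t ht
    rw [compSum_eq, dist_eq_norm] at h1
    rw [Pi.zero_apply, dist_zero_left] at h2
    rw [dist_eq_norm]
    have e : J t - itoSum k f v t = (J t - (itoSum k f v t
        + compensator (fun t => contract d F (f' t)) (areaDefect A Q v k) k t))
        + compensator (fun t => contract d F (f' t)) (areaDefect A Q v k) k t := by abel
    rw [e]
    exact (norm_add_le _ _).trans_lt (by linarith)
  have hlocal : ∀ p i, p ≠ 0 → i < 2 ^ p → ‖J (dyad p (i + 1)) - J (dyad p i)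
      - f (dyad p i) (v (dyad p (i + 1)) - v (dyad p i))‖
      ≤ (N * S + (R * V + G * S) / (1 - 2 * (b * a ^ 2))) * (a ^ 2) ^ p := by
    intro p i hp hi
    have h1 := norm_limit_sub_le (by positivity) (by positivity) hab hadd
      (fun t ht => hJ.tendsto_at ht) hp hi
    have h2 := hD p hp i hi (dyad p (i + 1)) ⟨dyad_le_dyad (by omega), le_rfl⟩
    have h3 := (ContinuousLinearMap.le_opNorm (contract d F (f' (dyad p i)))
      (areaDefect A Q v p (dyad p (i + 1)) - areaDefect A Q v p (dyad p i))).trans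
      (mul_le_mul (hN _ (dyad_mem hi.le)) h2 (norm_nonneg _) hN0)
    rw [compTerm, stopIncr_of_le v (dyad_le_one hi), stopIncr_of_le _ (dyad_le_one hi)] at h1
    have h4 : (R * V + G * S) / (1 - 2 * (b * a ^ 2)) * (b * a ^ 2) ^ p
        ≤ (R * V + G * S) / (1 - 2 * (b * a ^ 2)) * (a ^ 2) ^ p := by
      gcongr
      exact mul_le_of_le_one_left (by positivity) hb1.le
    rw [add_mul, mul_assoc N]
    refine le_trans (le_of_eq ?_) ((norm_add_le _ _).trans (add_le_add h3 (h1.trans h4)))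
    congr 1
    abel
  refine ⟨J, hI,
    hI.continuousOn (Frequently.of_forall fun k => continuousOn_itoSum k f hvc), ?_, ?_⟩
  · refine tendsto_nhds_unique (hI.tendsto_at (x := 0) (by simp)) ?_
    simp only [itoSum_at_zero]
    exact tendsto_const_nhds
  · have hC : 0 ≤ N * S + (R * V + G * S) / (1 - 2 * (b * a ^ 2)) := by positivity
    set C := N * S + (R * V + G * S) / (1 - 2 * (b * a ^ 2))
    have hUV : 0 ≤ U * V := by positivity
    intro p i hi
    rcases eq_or_ne p 0 with rfl | hp
    · obtain rfl : i = 0 := by simpa using hi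
      -- The local estimate starts at generation 1. Over `[0,1]` it is assembled from the two
      -- halves, which explains the factor 2 and the extra `U * V` in the constant.
      have h1 := hlocal 1 0 one_ne_zero (by norm_num)
      have h2 := hlocal 1 1 one_ne_zero (by norm_num)
      have h3 := hfU 0 0 (by norm_num) (dyad 1 1) (by norm_num [dyad])
      have h4 := hv.incr 1 1 (by norm_num)
      have e0 : dyad 0 0 = dyad 1 0 := by simp [dyad]
      have e1 : dyad 0 (0 + 1) = dyad 1 (1 + 1) := by norm_num [dyad]
      rw [zero_add] at h1
      rw [e0] at h3
      rw [e0, e1, pow_zero, mul_one]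
      have e : J (dyad 1 (1 + 1)) - J (dyad 1 0) - f (dyad 1 0) (v (dyad 1 (1 + 1)) - v (dyad 1 0))
          = (J (dyad 1 1) - J (dyad 1 0) - f (dyad 1 0) (v (dyad 1 1) - v (dyad 1 0)))
            + (J (dyad 1 (1 + 1)) - J (dyad 1 1) - f (dyad 1 1) (v (dyad 1 (1 + 1)) - v (dyad 1 1)))
            + (f (dyad 1 1) - f (dyad 1 0)) (v (dyad 1 (1 + 1)) - v (dyad 1 1)) := by
        simp only [sub_apply, map_sub]; abel
      rw [e]
      have h5 := (ContinuousLinearMap.le_opNorm (f (dyad 1 1) - f (dyad 1 0))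
        (v (dyad 1 (1 + 1)) - v (dyad 1 1))).trans
        (mul_le_mul h3 h4 (norm_nonneg _) (by positivity))
      have h6 : C * (a ^ 2) ^ 1 ≤ C :=
        mul_le_of_le_one_right hC (by rw [pow_one]; exact pow_le_one₀ ha.le ha1.le)
      have h7 : U * a ^ 0 * (V * a ^ 1) ≤ U * V := by
        rw [pow_zero, mul_one, pow_one, ← mul_assoc]
        exact mul_le_of_le_one_right hUV ha1.le
      refine (norm_add_le _ _).trans ((add_le_add_left (norm_add_le _ _) _).trans ?_)
      linarith
    · refine (hlocal p i hp hi).trans ?_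
      rw [← sq]
      gcongr
      linarith

end Ito

/-! ### Limits and constants -/

section Limits

variable {E : Type*} [NormedAddCommGroup E] [NormedSpace ℝ E]

theorem DyadicHolder.mono {ρ B B' : ℝ} {g : ℝ → E} (h : DyadicHolder ρ B g) (hB : B ≤ B')
    (hρ : 0 ≤ ρ) : DyadicHolder ρ B' g := fun p i hi t ht =>
  (h p i hi t ht).trans (by gcongr)

/-- The norm is a supremum of functions of finitely many point values, hence lower semicontinuous
under pointwise convergence. It puts the limiting Lévy area in `𝒞^{2α}`. -/
theorem hNorm_le_of_tendsto {γ : ℝ} {u : ℕ → ℝ → E} {U : ℝ → E} {M : ℝ≥0∞}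
    (h : ∀ t ∈ Icc (0 : ℝ) 1, Tendsto (fun k => u k t) atTop (nhds (U t)))
    (hM : ∀ k, hNorm γ (u k) ≤ M) : hNorm γ U ≤ M := by
  have hlim : ∀ (c : ℝ≥0∞) (w : ℕ → E) (W : E), c ≠ ∞ → Tendsto w atTop (nhds W) →
      (∀ k, c * ‖w k‖ₑ ≤ M) → c * ‖W‖ₑ ≤ M := fun c w W hc hw hle =>
    le_of_tendsto' (ENNReal.Tendsto.const_mul ((continuous_enorm.tendsto W).comp hw) (Or.inr hc))
      hle
  refine max_le ?_ (iSup_le fun p => iSup_le fun m => iSup_le fun hm => ?_)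
  · exact hlim _ _ _ ENNReal.ofReal_ne_top (h 0 (by simp)) fun k =>
      (le_max_left _ _).trans (hM k)
  · refine hlim _ (fun k => coeff p m (u k)) _ ENNReal.ofReal_ne_top ?_ fun k => ?_
    · rcases m with _ | i
      · rcases eq_or_ne p 0 with rfl | hp
        · simp only [coeff_zero_zero]
          exact (h 1 (by simp)).sub (h 0 (by simp))
        · simp only [coeff_pos_zero hp]
          exact tendsto_const_nhds
      · have hp : 2 ^ (p + 1) = 2 * 2 ^ p := by ring
        simp only [coeff_succ]
        exact (((h _ (dyad_mem (by omega))).const_smul 2).sub (h _ (dyad_mem (by omega)))).sub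
          (h _ (dyad_mem hm))
    · refine le_trans ?_ ((le_max_right _ _).trans (hM k))
      exact le_iSup_of_le p (le_iSup_of_le m (le_iSup (fun _ : m ≤ 2 ^ p =>
        ENNReal.ofReal ((2 : ℝ) ^ ((p : ℝ) * γ)) * ‖coeff p m (u k)‖ₑ) hm))

end Limits

/-- Bookkeeping of degrees: `G` and `N` are linear in the norm `y = nf + nS`, `R` and `U` are at
most of order `y (1 + nv)`, and `S` is of order `P = 1 + nv² + nA + nQ`. Products with `V` gain one
more `nv`, and `(1 + nv) nv ≤ 2P`; so everything is linear in `y` and at most linear in `P`. -/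
theorem exists_bound_constant {ks kv kf kA ku kκ e₁ e₂ cc cd : ℝ} (hks : 0 ≤ ks) (hkv : 0 ≤ kv)
    (hkf : 0 ≤ kf) (hkA : 0 ≤ kA) (hku : 0 ≤ ku) (hkκ : 0 ≤ kκ) (he₁ : 0 ≤ e₁) (he₂ : 0 ≤ e₂)
    (hcc : 0 ≤ cc) (hcd : 0 ≤ cd) :
    ∃ C : ℝ, 0 ≤ C ∧ ∀ nf nS nv nA nQ V G N R U S : ℝ, 0 ≤ nf → 0 ≤ nS → 0 ≤ nv → 0 ≤ nA →
      0 ≤ nQ → V = nv * kv → G = nf * kf → N = 2 * nf + G → R = nS * ks + e₁ * (G * V) →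
      U = (R + N * V) * ku → S = nA * kA + 1 / 2 * (nQ * kA) + cd * V ^ 2 →
      2 * (R + N * V) + 2 * nS
        + 2 * (2 * (cc * N * S + (R * V + cc * G * S) * kκ) + U * V + e₂ * (U * V))
        ≤ C * ((nf + nS) * (1 + nv ^ 2 + nA + nQ)) := by
  set r := ks + e₁ * kf * kv + (2 + kf) * kv with hr
  set s := kA + cd * kv ^ 2 with hs
  have hr0 : 0 ≤ r := by positivity
  have hs0 : 0 ≤ s := by positivity
  refine ⟨4 * r + 2 + 2 * (2 * (cc * (2 + kf) * s + (2 * (r * kv) + cc * kf * s) * kκ)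
    + 2 * (r * ku * kv) + e₂ * (2 * (r * ku * kv))), by positivity, ?_⟩
  intro nf nS nv nA nQ V G N R U S hnf hnS hnv hnA hnQ hV hG hN hR hU hS
  set y := nf + nS with hy
  set P := 1 + nv ^ 2 + nA + nQ with hP
  have hy0 : 0 ≤ y := by positivity
  have hfy : nf ≤ y := by linarith
  have hSy : nS ≤ y := by linarith
  have hP0 : 0 ≤ P := by positivity
  have hsq := sq_nonneg (nv - 1)
  have hnvP : 1 + nv ≤ 2 * P := by nlinarith
  have hnvP2 : (1 + nv) * nv ≤ 2 * P := by nlinarith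
  have h1P : 1 ≤ P := by nlinarith
  have hV0 : 0 ≤ V := by rw [hV]; positivity
  have hG0 : 0 ≤ G := by rw [hG]; positivity
  have hN0 : 0 ≤ N := by rw [hN]; positivity
  have hR0 : 0 ≤ R := by rw [hR]; positivity
  have hU0 : 0 ≤ U := by rw [hU]; positivity
  have hS0 : 0 ≤ S := by rw [hS]; positivity
  have hGy : G ≤ kf * y := by rw [hG, mul_comm]; gcongr
  have hNy : N ≤ (2 + kf) * y := by rw [hN, add_mul]; linarith
  have hRN : R + N * V ≤ r * (y * (1 + nv)) := by
    have h1 : nS * ks ≤ y * ks := by gcongr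
    have h2 : e₁ * (G * V) ≤ e₁ * (kf * y * (nv * kv)) := by rw [hV]; gcongr
    have h3 : N * V ≤ (2 + kf) * y * (nv * kv) := by rw [hV]; gcongr
    have h4 : 0 ≤ y * ks * nv := by positivity
    have h5 : 0 ≤ (e₁ * kf * kv + (2 + kf) * kv) * y := by positivity
    have e : r * (y * (1 + nv)) = y * ks + e₁ * (kf * y * (nv * kv)) + (2 + kf) * y * (nv * kv)
        + y * ks * nv + (e₁ * kf * kv + (2 + kf) * kv) * y := by rw [hr]; ring
    rw [hR, e]
    linarith
  have hRy : R ≤ r * (y * (1 + nv)) := le_trans (le_add_of_nonneg_right (by positivity)) hRN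
  have hUy : U ≤ r * ku * (y * (1 + nv)) := by
    rw [hU]
    calc (R + N * V) * ku ≤ r * (y * (1 + nv)) * ku := by gcongr
      _ = _ := by ring
  have hSP : S ≤ s * P := by
    have h1 : 0 ≤ cd * kv ^ 2 * (1 + nA + nQ) := by positivity
    have h2 : 0 ≤ kA * (1 + nv ^ 2 + 1 / 2 * nQ) := by positivity
    have e : s * P = nA * kA + 1 / 2 * (nQ * kA) + cd * (nv * kv) ^ 2
        + cd * kv ^ 2 * (1 + nA + nQ) + kA * (1 + nv ^ 2 + 1 / 2 * nQ) := by rw [hs, hP]; ring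
    rw [hS, hV, e]
    linarith
  have hy1 : y * (1 + nv) ≤ 2 * (y * P) := by
    rw [mul_left_comm]; gcongr
  have hyv : y * (1 + nv) * nv ≤ 2 * (y * P) := by
    rw [mul_left_comm, mul_assoc]; gcongr
  have hUV : U * V ≤ 2 * (r * ku * kv) * (y * P) := by
    calc U * V ≤ r * ku * (y * (1 + nv)) * (nv * kv) := by rw [hV]; gcongr
      _ = r * ku * kv * (y * (1 + nv) * nv) := by ring
      _ ≤ r * ku * kv * (2 * (y * P)) := by gcongr
      _ = _ := by ring
  have hRV : R * V ≤ 2 * (r * kv) * (y * P) := by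
    calc R * V ≤ r * (y * (1 + nv)) * (nv * kv) := by rw [hV]; gcongr
      _ = r * kv * (y * (1 + nv) * nv) := by ring
      _ ≤ r * kv * (2 * (y * P)) := by gcongr
      _ = _ := by ring
  have hNS : cc * N * S ≤ cc * (2 + kf) * s * (y * P) := by
    calc cc * N * S ≤ cc * ((2 + kf) * y) * (s * P) := by gcongr
      _ = _ := by ring
  have hGS : cc * G * S ≤ cc * kf * s * (y * P) := by
    calc cc * G * S ≤ cc * (kf * y) * (s * P) := by gcongr
      _ = _ := by ring
  have hA : 2 * (R + N * V) ≤ 4 * r * (y * P) := by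
    calc 2 * (R + N * V) ≤ 2 * (r * (2 * (y * P))) := by
          gcongr; exact hRN.trans (by gcongr)
      _ = _ := by ring
  have hB : 2 * nS ≤ 2 * (y * P) := by
    gcongr; exact hSy.trans (le_mul_of_one_le_right hy0 h1P)
  have hC : (R * V + cc * G * S) * kκ
      ≤ (2 * (r * kv) + cc * kf * s) * kκ * (y * P) := by
    calc (R * V + cc * G * S) * kκ
        ≤ (2 * (r * kv) * (y * P) + cc * kf * s * (y * P)) * kκ := by gcongr
      _ = _ := by ring
  have hD : e₂ * (U * V) ≤ e₂ * (2 * (r * ku * kv)) * (y * P) := by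
    calc e₂ * (U * V) ≤ e₂ * (2 * (r * ku * kv) * (y * P)) := by gcongr
      _ = _ := by ring
  linarith

/-- The estimates of the Itô integral, in terms of dyadic increments. -/
theorem exists_ito_integral_bound (d : ℕ) (F : Type*) [NormedAddCommGroup F] [NormedSpace ℝ F]
    [CompleteSpace F] {a b : ℝ} (ha : 0 < a) (ha1 : a < 1) (ha2 : 1 < 2 * a ^ 2) (hb : 0 < b)
    (hb1 : b < 1) (hba : 1 < 2 * (b * a)) (hab : 2 * (b * a ^ 2) < 1) :
    ∃ C : ℝ, 0 ≤ C ∧ ∀ (v : ℝ → EuclideanSpace ℝ (Fin d))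
      (f : ℝ → EuclideanSpace ℝ (Fin d) →L[ℝ] F)
      (f' : ℝ → EuclideanSpace ℝ (Fin d) →L[ℝ] EuclideanSpace ℝ (Fin d) →L[ℝ] F)
      (A Q : ℝ → EuclideanSpace ℝ (Fin d × Fin d)) (nf nS nv nA nQ HL : ℝ),
      0 ≤ nf → 0 ≤ nS → 0 ≤ nv → 0 ≤ nA → 0 ≤ nQ → 0 ≤ HL →
      ContinuousOn v (Icc 0 1) → ContinuousOn f (Icc 0 1) →
      DyadicHolder a (nv * (1 / (2 * a - 1) / (1 - a))) v →
      DyadicHolder b (nf * (1 / (2 * b - 1) / (1 - b))) f' →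
      ‖f' 0‖ ≤ 2 * nf →
      DyadicIncr (b * a) (nS * (1 / (2 * (b * a) - 1))) (sharp v f f') →
      DyadicHolder (a ^ 2) (nA * (1 / (2 * a ^ 2 - 1) / (1 - a ^ 2))) A →
      DyadicHolder (a ^ 2) (nQ * (1 / (2 * a ^ 2 - 1) / (1 - a ^ 2))) Q →
      (∀ k ≠ 0, DyadicHolder (a ^ 2) HL (levyMatrix (sumBelow k v))) →
      TendstoUniformlyOn (fun k => levyMatrix (sumBelow k v)) A atTop (Icc 0 1) →
      TendstoUniformlyOn (fun k => quadVar k v) Q atTop (Icc 0 1) →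
      ∃ J : ℝ → F, TendstoUniformlyOn (fun k => itoSum k f v) J atTop (Icc 0 1) ∧
        ContinuousOn J (Icc 0 1) ∧ ContinuousOn (sharp v J f) (Icc 0 1) ∧ J 0 = 0 ∧
        ∃ B₁ B₂ B₃ : ℝ, 0 ≤ B₁ ∧ 0 ≤ B₂ ∧ 0 ≤ B₃ ∧ DyadicIncr a B₁ f ∧
          DyadicIncr (a * a) B₂ (sharp v J f) ∧ DyadicIncr a B₃ J ∧
          2 * B₁ + 2 * nS + 2 * B₂ ≤ C * ((nf + nS) * (1 + nv ^ 2 + nA + nQ)) := by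
  have h2a : 0 < 2 * a - 1 := by nlinarith
  have h2b : 0 < 2 * b - 1 := by nlinarith
  have h2aa : 0 < 2 * a ^ 2 - 1 := by linarith
  have h2ba : 0 < 2 * (b * a) - 1 := by linarith
  have h1a : 0 < 1 - a := by linarith
  have h1b : 0 < 1 - b := by linarith
  have h1aa : 0 < 1 - a ^ 2 := by nlinarith
  have hκ : 0 < 1 - 2 * (b * a ^ 2) := by linarith
  obtain ⟨cc, hcc⟩ : ∃ x : ℝ, x = (d : ℝ) ^ 2 := ⟨_, rfl⟩
  have hcc0 : 0 ≤ cc := by rw [hcc]; positivity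
  obtain ⟨C, hC0, hC⟩ := exists_bound_constant (ks := 1 / (2 * (b * a) - 1))
    (kv := 1 / (2 * a - 1) / (1 - a)) (kf := 1 / (2 * b - 1) / (1 - b))
    (kA := 1 / (2 * a ^ 2 - 1) / (1 - a ^ 2)) (ku := 1 / (1 - a))
    (kκ := 1 / (1 - 2 * (b * a ^ 2))) (e₁ := 14 / (2 * (b * a) - 1))
    (e₂ := 14 / (2 * (a * a) - 1)) (cc := cc) (cd := (d : ℝ) ^ 2 * (4 / (2 * a ^ 2 - 1)) + 1)
    (by positivity) (by positivity) (by positivity) (by positivity) (by positivity) (by positivity)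
    (by positivity) (by rw [← sq]; positivity) (by positivity) (by positivity)
  refine ⟨C, hC0, ?_⟩
  intro v f f' A Q nf nS nv nA nQ HL hnf0 hnS0 hnv0 hnA0 hnQ0 hHL0 hvc hfcont hvH hf'H hf'0 hSincr
    hAH hQH hLH hL hQlim
  obtain ⟨V, hV⟩ : ∃ x : ℝ, x = nv * (1 / (2 * a - 1) / (1 - a)) := ⟨_, rfl⟩
  obtain ⟨G, hG⟩ : ∃ x : ℝ, x = nf * (1 / (2 * b - 1) / (1 - b)) := ⟨_, rfl⟩
  obtain ⟨N, hN⟩ : ∃ x : ℝ, x = 2 * nf + G := ⟨_, rfl⟩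
  obtain ⟨R, hR⟩ : ∃ x : ℝ, x =
    nS * (1 / (2 * (b * a) - 1)) + 14 / (2 * (b * a) - 1) * (G * V) := ⟨_, rfl⟩
  obtain ⟨U, hU⟩ : ∃ x : ℝ, x = (R + N * V) * (1 / (1 - a)) := ⟨_, rfl⟩
  obtain ⟨S, hS⟩ : ∃ x : ℝ, x = nA * (1 / (2 * a ^ 2 - 1) / (1 - a ^ 2))
    + 1 / 2 * (nQ * (1 / (2 * a ^ 2 - 1) / (1 - a ^ 2)))
    + ((d : ℝ) ^ 2 * (4 / (2 * a ^ 2 - 1)) + 1) * V ^ 2 := ⟨_, rfl⟩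
  have hC' := hC nf nS nv nA nQ V G N R U S hnf0 hnS0 hnv0 hnA0 hnQ0 hV hG hN hR hU hS
  have hV0 : 0 ≤ V := by rw [hV]; positivity
  have hG0 : 0 ≤ G := by rw [hG]; positivity
  have hN0 : 0 ≤ N := by rw [hN]; positivity
  have hR0 : 0 ≤ R := by rw [hR]; positivity
  have hU0 : 0 ≤ U := by rw [hU]; positivity
  rw [← hV] at hvH
  rw [← hG] at hf'H
  have hf'N : ∀ t ∈ Icc (0 : ℝ) 1, ‖f' t‖ ≤ N := fun t ht =>
    (hf'H.norm_le ht).trans (by linarith)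
  -- The regularity of `f` itself is recovered from `f'` and `f^♯`, so that the constant involves
  -- only the paracontrolled norm and not `‖f‖_α`.
  have hfc : DyadicControlled (b * a) R v f f' := by
    rw [hR]; exact hSincr.controlled hG0 hV0 hb ha ha1.le hba hf'H hvH
  have hfI : DyadicIncr a (R + N * V) f :=
    hfc.incr hR0 (by positivity) (mul_le_of_le_one_left ha.le hb1.le) hf'N hvH.incr
  have hfH : DyadicHolder a U f := by
    rw [hU, ← div_eq_mul_one_div]
    exact hfI.holder hfcont (by positivity) ha ha1
  have hgH : DyadicHolder b (cc * G)
      fun t => contract d F (f' t) := by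
    intro p i hi t ht
    rw [← map_sub, mul_assoc]
    exact (norm_contract_le _).trans (by rw [hcc]; gcongr; exact hf'H p i hi t ht)
  have hgN : ∀ t ∈ Icc (0 : ℝ) 1, ‖contract d F (f' t)‖ ≤ cc * N :=
    fun t ht => (norm_contract_le _).trans (by rw [hcc]; gcongr; exact hf'N t ht)
  have hHA0 : 0 ≤ nA * (1 / (2 * a ^ 2 - 1) / (1 - a ^ 2)) := by positivity
  have hHQ0 : 0 ≤ nQ * (1 / (2 * a ^ 2 - 1) / (1 - a ^ 2)) := by positivity
  obtain ⟨J, hJlim, hJc, hJ0, hJ⟩ := exists_ito_integral ha ha1 ha2 hb hb1 hab hV0 hR0 hU0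
    (mul_nonneg hcc0 hG0) hHA0 hHQ0 hHL0 hS hvc hvH hfH hfc hgH hgN hAH hQH hLH hL hQlim
  have hS0 : 0 ≤ S := by rw [hS]; positivity
  obtain ⟨K, hK⟩ : ∃ x : ℝ, x =
      2 * (cc * N * S + (R * V + cc * G * S) / (1 - 2 * (b * a ^ 2))) + U * V := ⟨_, rfl⟩
  have hK0 : 0 ≤ K := by rw [hK]; positivity
  rw [← hK] at hJ
  have haa : 1 < 2 * (a * a) := by rw [← sq]; exact ha2
  have haa1 : a * a < 1 := mul_lt_one_of_nonneg_of_lt_one_left ha.le ha1 ha1.le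
  have h2aa' : 0 < 2 * (a * a) - 1 := by linarith
  -- Of the three bounds, the first is for the derivative `f` and the second for the remainder of
  -- `J`; the third only serves to show that `J` is in `𝒞^α`.
  refine ⟨J, hJlim, hJc, hJc.sub (continuousOn_paraproduct hU0 hV0 ha ha1.le ha ha1 hfH hvH), hJ0,
    R + N * V, K + 14 / (2 * (a * a) - 1) * (U * V), K + (‖f 0‖ + U) * V, by positivity,
    by positivity, by positivity, hfI, hJ.sharp_incr hU0 hV0 ha ha ha1.le haa hfH hvH,
    hJ.incr hK0 (by positivity) (mul_le_of_le_one_left ha.le ha1.le)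
      (fun t ht => hfH.norm_le ht) hvH.incr, ?_⟩
  refine le_trans (le_of_eq ?_) hC'
  rw [hK]
  ring

end SchauderIto

end

theorem corollary5p4 (d n : ℕ) (α β : ℝ) (hα : 0 < α) (hα' : α < 1 / 2) (hβα : β ≤ α)
    (hαβ : 1 < 2 * α + β) :
    ∃ C : ℝ≥0,
      ∀ (v : ℝ → EuclideanSpace ℝ (Fin d))
        (f : ℝ → EuclideanSpace ℝ (Fin d) →L[ℝ] EuclideanSpace ℝ (Fin n))
        (f' : ℝ → EuclideanSpace ℝ (Fin d) →L[ℝ]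
          EuclideanSpace ℝ (Fin d) →L[ℝ] EuclideanSpace ℝ (Fin n))
        (A Q : ℝ → EuclideanSpace ℝ (Fin d × Fin d)),
        SchauderIto.MemC α v →
        SchauderIto.IsParacontrolled α β v f f' →
        TendstoUniformlyOn
          (fun k : ℕ => SchauderIto.levyMatrix (SchauderIto.sumBelow (k + 1) v)) A atTop
          (Icc 0 1) →
        (∃ M : ℝ≥0, ∀ k : ℕ, SchauderIto.hNorm (2 * α)
          (SchauderIto.levyMatrix (SchauderIto.sumBelow (k + 1) v)) ≤ M) →
        TendstoUniformlyOn (fun k : ℕ => SchauderIto.quadVar k v) Q atTop (Icc 0 1) →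
        SchauderIto.MemC (2 * α) Q →
        ∃ J : ℝ → EuclideanSpace ℝ (Fin n),
          TendstoUniformlyOn (fun k : ℕ => SchauderIto.itoSum k f v) J atTop (Icc 0 1) ∧
          SchauderIto.IsParacontrolled α α v J f ∧
          SchauderIto.paraNorm α α v J f ≤
            C * SchauderIto.paraNorm α β v f f' *
              (1 + SchauderIto.hNorm α v ^ 2 + SchauderIto.hNorm (2 * α) A +
                SchauderIto.hNorm (2 * α) Q) := by
  open SchauderIto in
  have hβ : 0 < β := by linarith
  obtain ⟨a, ha_def⟩ : ∃ x : ℝ, x = (2 : ℝ) ^ (-α) := ⟨_, rfl⟩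
  obtain ⟨b, hb_def⟩ : ∃ x : ℝ, x = (2 : ℝ) ^ (-β) := ⟨_, rfl⟩
  have ha : 0 < a := by rw [ha_def]; positivity
  have hb : 0 < b := by rw [hb_def]; positivity
  have hhalf : (1 / 2 : ℝ) = (2 : ℝ) ^ (-1 : ℝ) := by rw [Real.rpow_neg_one]; norm_num
  have ha1 : a < 1 := ha_def.trans_lt <|
    Real.rpow_lt_one_of_one_lt_of_neg (by norm_num) (by linarith)
  have hb1 : b < 1 := hb_def.trans_lt <|
    Real.rpow_lt_one_of_one_lt_of_neg (by norm_num) (by linarith)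
  have eaa : (2 : ℝ) ^ (-(2 * α)) = a ^ 2 := by
    rw [ha_def, sq, ← Real.rpow_add (by norm_num)]; congr 1; ring
  have eaa' : (2 : ℝ) ^ (-(α + α)) = a * a := by
    rw [ha_def, ← Real.rpow_add (by norm_num)]; congr 1; ring
  have eba : (2 : ℝ) ^ (-(α + β)) = b * a := by
    rw [ha_def, hb_def, ← Real.rpow_add (by norm_num)]; congr 1; ring
  have ebaa : (2 : ℝ) ^ (-(2 * α + β)) = b * a ^ 2 := by
    rw [← eaa, hb_def, ← Real.rpow_add (by norm_num)]; congr 1; ring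
  -- The next three inequalities are `2α < 1`, `α + β < 1` and `2α + β > 1` in terms of `a = 2^{-α}`
  -- and `b = 2^{-β}`.
  have ha2 : 1 < 2 * a ^ 2 := by
    have : (1 / 2 : ℝ) < (2 : ℝ) ^ (-(2 * α)) := by
      rw [hhalf]; exact Real.rpow_lt_rpow_of_exponent_lt (by norm_num) (by linarith)
    rw [← eaa]; linarith
  have hba : 1 < 2 * (b * a) := by
    have : (1 / 2 : ℝ) < (2 : ℝ) ^ (-(α + β)) := by
      rw [hhalf]; exact Real.rpow_lt_rpow_of_exponent_lt (by norm_num) (by linarith)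
    rw [← eba]; linarith
  have hab : 2 * (b * a ^ 2) < 1 := by
    have : (2 : ℝ) ^ (-(2 * α + β)) < (1 / 2 : ℝ) := by
      rw [hhalf]; exact Real.rpow_lt_rpow_of_exponent_lt (by norm_num) (by linarith)
    rw [← ebaa]; linarith
  obtain ⟨C, hC0, hC⟩ := exists_ito_integral_bound d (EuclideanSpace ℝ (Fin n)) ha ha1 ha2 hb hb1
    hba hab
  refine ⟨C.toNNReal, ?_⟩
  intro v f f' A Q hv hf hL hLM hQlim hQ
  obtain ⟨M, hM⟩ := hLM
  have hLM' : ∀ k, MemC (2 * α) (levyMatrix (sumBelow (k + 1) v)) := fun k =>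
    ⟨(continuous_levyMatrix_sumBelow v k.succ_ne_zero).continuousOn,
      (hM k).trans_lt ENNReal.coe_lt_top⟩
  have hA : MemC (2 * α) A :=
    ⟨hL.continuousOn (Frequently.of_forall fun k => (hLM' k).1),
      (hNorm_le_of_tendsto (fun t ht => hL.tendsto_at ht) hM).trans_lt ENNReal.coe_lt_top⟩
  obtain ⟨nv, hnv⟩ : ∃ x : ℝ, x = (hNorm α v).toReal := ⟨_, rfl⟩
  obtain ⟨nf, hnf⟩ : ∃ x : ℝ, x = (hNorm β f').toReal := ⟨_, rfl⟩
  obtain ⟨nS, hnS⟩ : ∃ x : ℝ, x = (hNorm (α + β) (sharp v f f')).toReal := ⟨_, rfl⟩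
  obtain ⟨nA, hnA⟩ : ∃ x : ℝ, x = (hNorm (2 * α) A).toReal := ⟨_, rfl⟩
  obtain ⟨nQ, hnQ⟩ : ∃ x : ℝ, x = (hNorm (2 * α) Q).toReal := ⟨_, rfl⟩
  have hnv0 : 0 ≤ nv := hnv.symm ▸ ENNReal.toReal_nonneg
  have hnf0 : 0 ≤ nf := hnf.symm ▸ ENNReal.toReal_nonneg
  have hnS0 : 0 ≤ nS := hnS.symm ▸ ENNReal.toReal_nonneg
  have hnA0 : 0 ≤ nA := hnA.symm ▸ ENNReal.toReal_nonneg
  have hnQ0 : 0 ≤ nQ := hnQ.symm ▸ ENNReal.toReal_nonneg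
  have hvH : DyadicHolder a (nv * (1 / (2 * a - 1) / (1 - a))) v := by
    have h1 := hv.holder hα (by linarith)
    rw [← ha_def, ← hnv] at h1
    convert h1 using 1
    ring
  have hf'H : DyadicHolder b (nf * (1 / (2 * b - 1) / (1 - b))) f' := by
    have h1 := hf.mem_deriv.holder hβ (by linarith)
    rw [← hb_def, ← hnf] at h1
    convert h1 using 1
    ring
  have hAH : DyadicHolder (a ^ 2) (nA * (1 / (2 * a ^ 2 - 1) / (1 - a ^ 2))) A := by
    have h1 := hA.holder (by linarith) (by linarith)
    rw [eaa, ← hnA] at h1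
    convert h1 using 1
    ring
  have hQH : DyadicHolder (a ^ 2) (nQ * (1 / (2 * a ^ 2 - 1) / (1 - a ^ 2))) Q := by
    have h1 := hQ.holder (by linarith) (by linarith)
    rw [eaa, ← hnQ] at h1
    convert h1 using 1
    ring
  have h2aa : 0 < 2 * a ^ 2 - 1 := by linarith
  have h1aa : 0 < 1 - a ^ 2 := by nlinarith
  -- `S_k v` is `sumBelow (k + 1) v`, so the uniform bound covers exactly the indices `k ≠ 0`.
  have hLH : ∀ k ≠ 0, DyadicHolder (a ^ 2) (M / (2 * a ^ 2 - 1) / (1 - a ^ 2))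
      (levyMatrix (sumBelow k v)) := by
    intro k hk
    obtain ⟨k, rfl⟩ := Nat.exists_eq_succ_of_ne_zero hk
    have h1 := (hLM' k).holder (by linarith) (by linarith)
    rw [eaa] at h1
    refine h1.mono ?_ (by positivity)
    gcongr
    exact ENNReal.toReal_le_coe_of_le_coe (hM k)
  have hSincr : DyadicIncr (b * a) (nS * (1 / (2 * (b * a) - 1))) (sharp v f f') := by
    have h1 := coeffBound_of_hNorm hf.mem_sharp.2
    rw [eba, ← hnS] at h1
    have h2 := h1.incr hnS0 (by linarith) (mul_lt_one_of_nonneg_of_lt_one_left hb.le hb1 ha1.le)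
    rwa [div_eq_mul_one_div] at h2
  have hf'0 := hf.mem_deriv.norm_zero_le (by linarith)
  rw [← hnf] at hf'0
  obtain ⟨J, hJlim, hJc, hJsc, hJ0, B₁, B₂, B₃, hB₁, hB₂, hB₃, hfI, hJs, hJi, hle⟩ :=
    hC v f f' A Q nf nS nv nA nQ (M / (2 * a ^ 2 - 1) / (1 - a ^ 2)) hnf0 hnS0 hnv0 hnA0 hnQ0
      (by positivity) hv.1 hf.mem.1 hvH hf'H hf'0 hSincr hAH hQH hLH
      (tendstoUniformlyOn_of_succ (u := fun k => levyMatrix (sumBelow k v)) hL) hQlim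
  have haa1 : a * a < 1 := mul_lt_one_of_nonneg_of_lt_one_left ha.le ha1 ha1.le
  have hB1 : hNorm α f ≤ ENNReal.ofReal (2 * B₁ + 2 * nS) := by
    -- The paraproduct vanishes at 0, so `f 0 = f^♯ 0`; this is where the summand `2 * nS` is
    -- needed. The factor 2 at `B₁` comes from passing from increments to coefficients.
    refine hNorm_le_ofReal ?_ ?_
    · have h1 : f 0 = sharp v f f' 0 := by rw [sharp, paraproduct_zero, sub_zero]
      have h2 := hf.mem_sharp.norm_zero_le (by linarith)
      rw [← h1, ← hnS] at h2
      have h3 : a * ‖f 0‖ ≤ ‖f 0‖ := mul_le_of_le_one_left (norm_nonneg _) ha1.le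
      have h4 : 0 ≤ 2 * B₁ := by positivity
      rw [← ha_def]
      linarith
    · intro p m hm
      refine (hfI.coeffBound hB₁ ha ha1 p m hm).trans ?_
      rw [← ha_def]
      gcongr
      linarith
  have hB2 : hNorm (α + α) (sharp v J f)
      ≤ ENNReal.ofReal (2 * B₂) := by
    refine hNorm_le_ofReal ?_ ?_
    · rw [sharp, hJ0, paraproduct_zero, sub_zero, norm_zero, mul_zero]
      positivity
    · rw [eaa']; exact hJs.coeffBound hB₂ (by positivity) haa1
  refine ⟨J, hJlim, ⟨⟨hJc, ?_⟩, hf.mem, ⟨?_, hB2.trans_lt ENNReal.ofReal_lt_top⟩⟩, ?_⟩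
  · refine (hNorm_le_ofReal ?_ (ha_def ▸ hJi.coeffBound hB₃ ha ha1)).trans_lt ENNReal.ofReal_lt_top
    rw [hJ0, norm_zero, mul_zero]
    positivity
  · exact hJsc
  · have e1 : hNorm β f' = ENNReal.ofReal nf := by
      rw [hnf, ENNReal.ofReal_toReal hf.mem_deriv.2.ne]
    have e2 : hNorm (α + β) (sharp v f f') = ENNReal.ofReal nS := by
      rw [hnS, ENNReal.ofReal_toReal hf.mem_sharp.2.ne]
    have e3 : hNorm α v = ENNReal.ofReal nv := by
      rw [hnv, ENNReal.ofReal_toReal hv.2.ne]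
    have e4 : hNorm (2 * α) A = ENNReal.ofReal nA := by
      rw [hnA, ENNReal.ofReal_toReal hA.2.ne]
    have e5 : hNorm (2 * α) Q = ENNReal.ofReal nQ := by
      rw [hnQ, ENNReal.ofReal_toReal hQ.2.ne]
    have e6 : (C.toNNReal : ℝ≥0∞) = ENNReal.ofReal C := rfl
    rw [paraNorm, paraNorm, e1, e2, e3, e4, e5, e6, ← ENNReal.ofReal_one,
      ← ENNReal.ofReal_pow hnv0, ← ENNReal.ofReal_add hnf0 hnS0,
      ← ENNReal.ofReal_add zero_le_one (by positivity),
      ← ENNReal.ofReal_add (by positivity) hnA0, ← ENNReal.ofReal_add (by positivity) hnQ0,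
      ← ENNReal.ofReal_mul hC0, ← ENNReal.ofReal_mul (by positivity)]
    refine (add_le_add hB1 hB2).trans ?_
    rw [← ENNReal.ofReal_add (by positivity) (by positivity)]
    refine ENNReal.ofReal_le_ofReal ?_
    rw [mul_assoc C]
    exact hle
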